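/- Proposition (lower semicontinuity of mass for $k$-chains). Let $X$ be a real Banach space, let $(G,|\cdot|)$ be a normed abelian group that is complete in the metric of its norm, and let $k\ge 0$. Polyhedral chains. A convex $k$-polyhedron is a nonempty bounded set of affine dimension $k$ that is the intersection of a finite-dimensional affine subspace of $X$ with finitely many closed half-spaces. The group $\mathcal P_k=\mathcal P_k(X,G)$ of polyhedral $k$-chains consists of the finite formal sums $\sum_i g_i[P_i]$, with $g_i\in G$ and $P_i$ an oriented convex $k$-polyhedron, modulo the relations $(g+h)[P]=g[P]+h[P]$, $(-g)[P]=g[-P]$ (where $-P$ is $P$ with the opposite orientation), and $g[P_1\cup P_2]=g[P_1]+g[P_2]$ whenever $P_1$, $P_2$ and $P_1\cup P_2$ are convex $k$-polyhedra with the same orientation and $P_1,P_2$ have disjoint relative interiors. The boundary $\partial:\mathcal P_{k+1}\to\mathcal P_k$ is the additive map that sends $g[P]$ to $\sum_F g[F]$, where $F$ runs over the facets of $P$ with the orientations induced by $P$. For $f\in X^*$ and $r\in\mathbb R$, let $P_r$ be the part of the chain $P$ in $f^{-1}((-\infty,r))$; the slice of a chain $P\in\mathcal P_{k+1}$ by $f$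 at $r$ is $P\cap f^{-1}(r)=\partial(P_r)-(\partial P)_r\in\mathcal P_k$, which is defined for almost every $r$. Mass. The mass $M$ is defined by induction on $k$. For a single point, $M(g[x])=|g|$. For $k\ge 1$ and a simple chain $g[P]$, $$M(g[P])=\sup_{f\in X^*,\ \|f\|=1}\ \int_{-\infty}^{\infty}M\big(g[P]\cap f^{-1}(r)\big)\,dr .$$ For $k\ge 0$ and an arbitrary $P\in\mathcal P_k$, $M(P)=\sum_i M(g_i[P_i])$, where $P=\sum_i g_i[P_i]$ is any representation in which the polyhedra $P_i$ have pairwise disjoint relative interiors. The flat norm of $P\in\mathcal P_k$ is $$F(P)=\inf_{Q\in\mathcal P_{k+1}}\big(M(Q)+M(\partial Q-P)\big).$$ Statement. If $P_1,P_2,\dots$ and $P$ are polyhedral $k$-chains in $X$ with coefficients in $G$ and $F(P_j-P)\to 0$ as $j\to\infty$, then $$M(P)\le\liminf_{j\to\infty}M(P_j).$$ -/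

import Mathlib

open Set Filter Topology MeasureTheory
open scoped ENNReal

noncomputable section

namespace FlatChains

variable {X : Type*} [NormedAddCommGroup X] [NormedSpace ℝ X]

/-- A (closed, bounded) convex polyhedron: a bounded set that is the intersection of a
finite-dimensional affine subspace with finitely many closed half-spaces. -/
def IsConvexPolyhedron (S : Set X) : Prop :=
  Bornology.IsBounded S ∧
    ∃ (A : AffineSubspace ℝ X) (L : Finset ((X →L[ℝ] ℝ) × ℝ)),
      FiniteDimensional ℝ A.direction ∧ S = {x | x ∈ A ∧ ∀ p ∈ L, p.1 x ≤ p.2}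

theorem IsConvexPolyhedron.inter_halfspace {S : Set X} (hS : IsConvexPolyhedron S)
    (f : X →L[ℝ] ℝ) (r : ℝ) : IsConvexPolyhedron (S ∩ {x | f x ≤ r}) := by
  classical
  obtain ⟨hb, A, L, hA, rfl⟩ := hS
  refine ⟨hb.subset inter_subset_left, A, insert (f, r) L, hA, ?_⟩
  ext x
  simp only [mem_inter_iff, mem_ofPred_eq, Finset.mem_insert, forall_eq_or_imp]
  tauto

theorem IsConvexPolyhedron.convex {S : Set X} (hS : IsConvexPolyhedron S) : Convex ℝ S := by
  obtain ⟨-, A, L, -, rfl⟩ := hS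
  intro x hx y hy a b ha hb hab
  refine ⟨A.convex hx.1 hy.1 ha hb hab, fun p hp => ?_⟩
  have h1 := hx.2 p hp
  have h2 := hy.2 p hp
  simp only [map_add, map_smul, smul_eq_mul]
  calc a * p.1 x + b * p.1 y ≤ a * p.2 + b * p.2 := by gcongr
    _ = p.2 := by rw [← add_mul, hab, one_mul]

theorem IsConvexPolyhedron.finiteDimensional {S : Set X} (hS : IsConvexPolyhedron S) :
    FiniteDimensional ℝ (vectorSpan ℝ S) := by
  obtain ⟨-, A, L, hA, rfl⟩ := hS
  have : vectorSpan ℝ {x | x ∈ A ∧ ∀ p ∈ L, p.1 x ≤ p.2} ≤ A.direction :=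
    vectorSpan_mono ℝ (fun x hx => hx.1)
  exact Submodule.finiteDimensional_of_le this

theorem vectorSpan_inter_halfspace {S : Set X} (hS : Convex ℝ S) (f : X →L[ℝ] ℝ) (r : ℝ)
    (h : (S ∩ {x | f x < r}).Nonempty) :
    vectorSpan ℝ (S ∩ {x | f x ≤ r}) = vectorSpan ℝ S := by
  refine le_antisymm (vectorSpan_mono ℝ inter_subset_left) ?_
  obtain ⟨p, hpS, hp⟩ := h
  simp only [mem_ofPred_eq] at hp
  rw [vectorSpan_eq_span_vsub_set_right ℝ hpS, Submodule.span_le]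
  rintro _ ⟨q, hq, rfl⟩
  obtain ⟨t, ht0, ht1, ht⟩ : ∃ t : ℝ, 0 < t ∧ t ≤ 1 ∧ f p + t * (f q - f p) ≤ r := by
    by_cases hqr : f q ≤ r
    · exact ⟨1, one_pos, le_rfl, by linarith⟩
    · push Not at hqr
      refine ⟨(r - f p) / (f q - f p), div_pos (by linarith) (by linarith), ?_, ?_⟩
      · rw [div_le_one (by linarith)]; linarith
      · rw [div_mul_cancel₀ _ (by linarith)]; linarith
  have hm : p + t • (q - p) ∈ S ∩ {x | f x ≤ r} := by
    refine ⟨hS.add_smul_sub_mem hpS hq ⟨ht0.le, ht1⟩, ?_⟩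
    simpa using ht
  have hmp : p ∈ S ∩ {x | f x ≤ r} := ⟨hpS, hp.le⟩
  have := vsub_mem_vectorSpan ℝ hm hmp
  simp only [vsub_eq_sub, add_sub_cancel_left] at this
  simpa using (Submodule.smul_mem_iff _ ht0.ne').1 this

/-- A `k`-dimensional convex polyhedron in `X`, oriented by an ordered basis `frame` of its
direction space. -/
structure OrientedPolyhedron (X : Type*) [NormedAddCommGroup X] [NormedSpace ℝ X] (k : ℕ) where
  carrier : Set X
  isPolyhedron : IsConvexPolyhedron carrier
  nonempty : carrier.Nonempty
  frame : Fin k → X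
  linearIndependent : LinearIndependent ℝ frame
  span_frame : Submodule.span ℝ (Set.range frame) = vectorSpan ℝ carrier

/-- The ordered bases `v` and `w` (of one subspace) define the same orientation. -/
def SameOrientation {k : ℕ} (v w : Fin k → X) : Prop :=
  ∃ A : Matrix (Fin k) (Fin k) ℝ, (∀ j, w j = ∑ i, A i j • v i) ∧ 0 < A.det

/-- The ordered bases `v` and `w` (of one subspace) define opposite orientations. -/
def OppositeOrientation {k : ℕ} (v w : Fin k → X) : Prop :=
  ∃ A : Matrix (Fin k) (Fin k) ℝ, (∀ j, w j = ∑ i, A i j • v i) ∧ A.det < 0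

/-! ### Polyhedral chains -/

/-- Finite formal sums `∑ gᵢ [Pᵢ]` of oriented convex `k`-polyhedra with coefficients in `G`
(the rule `(g₁ + g₂)[P] = g₁[P] + g₂[P]` is built in). -/
abbrev FormalSum (X G : Type*) [NormedAddCommGroup X] [NormedSpace ℝ X]
    [NormedAddCommGroup G] (k : ℕ) : Type _ :=
  OrientedPolyhedron X k →₀ G

section Chains

variable {G : Type*} [NormedAddCommGroup G]

/-- The relations between formal sums: a polyhedron only depends on the orientation that its
frame defines, `(-g)[P] = g[-P]`, and `g[P₁ ∪ P₂] = g[P₁] + g[P₂]` if `P₁`, `P₂` have disjoint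
relative interiors (and `P₁`, `P₂`, `P₁ ∪ P₂` carry the same orientation). -/
inductive Relation {k : ℕ} : FormalSum X G k → Prop
  | same (S T : OrientedPolyhedron X k) (g : G) (hc : S.carrier = T.carrier)
      (ho : SameOrientation S.frame T.frame) :
      Relation (Finsupp.single S g - Finsupp.single T g)
  | opposite (S T : OrientedPolyhedron X k) (g : G) (hc : S.carrier = T.carrier)
      (ho : OppositeOrientation S.frame T.frame) :
      Relation (Finsupp.single S (-g) - Finsupp.single T g)
  | union (S S₁ S₂ : OrientedPolyhedron X k) (g : G)
      (hc : S.carrier = S₁.carrier ∪ S₂.carrier)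
      (hd : Disjoint (intrinsicInterior ℝ S₁.carrier) (intrinsicInterior ℝ S₂.carrier))
      (h₁ : SameOrientation S.frame S₁.frame) (h₂ : SameOrientation S.frame S₂.frame) :
      Relation (Finsupp.single S g - (Finsupp.single S₁ g + Finsupp.single S₂ g))

/-- The subgroup of formal sums that represent the zero chain. -/
def relations (X G : Type*) [NormedAddCommGroup X] [NormedSpace ℝ X] [NormedAddCommGroup G]
    (k : ℕ) : AddSubgroup (FormalSum X G k) :=
  AddSubgroup.closure {P | Relation P}

/-- The group `𝒫ₖ(X, G)` of polyhedral `k`-chains in `X` with coefficients in `G`. -/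
abbrev PolyhedralChain (X G : Type*) [NormedAddCommGroup X] [NormedSpace ℝ X]
    [NormedAddCommGroup G] (k : ℕ) : Type _ :=
  FormalSum X G k ⧸ relations X G k

/-- The polyhedral chain represented by a formal sum. -/
def FormalSum.toChain {k : ℕ} (P : FormalSum X G k) : PolyhedralChain X G k :=
  QuotientAddGroup.mk P

/-! ### Boundary -/

/-- The facets of a `(k+1)`-dimensional polyhedron: its `k`-dimensional exposed faces. -/
def facets {k : ℕ} (S : OrientedPolyhedron X (k + 1)) : Set (Set X) :=
  {F | IsExposed ℝ S.carrier F ∧ F.Nonempty ∧ Module.finrank ℝ (vectorSpan ℝ F) = k}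

theorem isPolyhedron_of_mem_facets {k : ℕ} {S : OrientedPolyhedron X (k + 1)} {F : Set X}
    (hF : F ∈ facets S) : IsConvexPolyhedron F := by
  obtain ⟨he, ⟨x, hx⟩, -⟩ := hF
  obtain ⟨l, hl⟩ := he ⟨x, hx⟩
  have : F = S.carrier ∩ {y | (-l) y ≤ -(l x)} := by
    rw [hl] at hx
    rw [hl]
    ext y
    simp only [mem_ofPred_eq, mem_inter_iff, neg_apply, neg_le_neg_iff]
    exact ⟨fun h => ⟨h.1, h.2 x hx.1⟩, fun h => ⟨h.1, fun z hz => (hx.2 z hz).trans h.2⟩⟩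
  rw [this]
  exact S.isPolyhedron.inter_halfspace _ _

theorem exists_frame {k : ℕ} {F : Set X} (hF : IsConvexPolyhedron F)
    (hk : Module.finrank ℝ (vectorSpan ℝ F) = k) :
    ∃ w : Fin k → X, LinearIndependent ℝ w ∧
      Submodule.span ℝ (Set.range w) = vectorSpan ℝ F := by
  have := hF.finiteDimensional
  let b := Module.finBasisOfFinrankEq ℝ (vectorSpan ℝ F) hk
  refine ⟨fun i => (b i : X), b.linearIndependent.map' (vectorSpan ℝ F).subtype
    (Submodule.ker_subtype _), ?_⟩
  have : Set.range (fun i => (b i : X)) = (vectorSpan ℝ F).subtype '' Set.range b := by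
    rw [← Set.range_comp]; rfl
  rw [this, Submodule.span_image, b.span_eq, Submodule.map_top, Submodule.range_subtype]

/-- A facet, with an arbitrarily chosen orientation. -/
def facet {k : ℕ} (S : OrientedPolyhedron X (k + 1)) (F : facets S) :
    OrientedPolyhedron X k where
  carrier := F
  isPolyhedron := isPolyhedron_of_mem_facets F.2
  nonempty := F.2.2.1
  frame := (exists_frame (isPolyhedron_of_mem_facets F.2) F.2.2.2).choose
  linearIndependent := (exists_frame (isPolyhedron_of_mem_facets F.2) F.2.2.2).choose_spec.1
  span_frame := (exists_frame (isPolyhedron_of_mem_facets F.2) F.2.2.2).choose_spec.2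

/-- The chosen orientation of the facet `F` is the one induced by `S`: an outward pointing vector
followed by the frame of `F` is a positively oriented basis. -/
def IsInducedOrientation {k : ℕ} (S : OrientedPolyhedron X (k + 1)) (F : facets S) : Prop :=
  ∃ y ∈ (F : Set X), ∃ x ∈ S.carrier \ (F : Set X),
    SameOrientation S.frame (Fin.cons (y - x) (facet S F).frame : Fin (k + 1) → X)

theorem facets_finite {k : ℕ} (S : OrientedPolyhedron X (k + 1)) : (facets S).Finite := by
  classical
  have hfd := S.isPolyhedron.finiteDimensional
  have hrank : Module.finrank ℝ (vectorSpan ℝ S.carrier) = k + 1 := by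
    rw [← S.span_frame, finrank_span_eq_card S.linearIndependent, Fintype.card_fin]
  obtain ⟨-, A, L, hA, hS⟩ := S.isPolyhedron
  refine (L.finite_toSet.image (fun p => {x ∈ S.carrier | p.1 x = p.2})).subset ?_
  intro F hF
  have hFconv : Convex ℝ F := (isPolyhedron_of_mem_facets hF).convex
  obtain ⟨he, hne, hk⟩ := hF
  obtain ⟨l, hl⟩ := he hne
  have hFS : F ⊆ S.carrier := fun x hx => by rw [hl] at hx; exact hx.1
  have hle : ∀ x ∈ S.carrier, ∀ p ∈ L, p.1 x ≤ p.2 := fun x hx => by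
    rw [hS] at hx; exact hx.2
  have key : ∃ p ∈ L, (∀ x ∈ F, p.1 x = p.2) ∧ ∃ q ∈ S.carrier, p.1 q ≠ p.2 := by
    by_contra hcon
    push Not at hcon
    have hp : ∀ L' : Finset ((X →L[ℝ] ℝ) × ℝ), L' ⊆ L →
        ∃ x ∈ F, ∀ p ∈ L', (∀ q ∈ S.carrier, p.1 q = p.2) ∨ p.1 x < p.2 := by
      intro L'
      induction L' using Finset.induction_on with
      | empty => exact fun _ => ⟨hne.choose, hne.choose_spec, by simp⟩
      | insert p L' _ ih =>
        intro hsub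
        obtain ⟨x, hx, hxL⟩ := ih ((Finset.subset_insert _ _).trans hsub)
        have hpL : p ∈ L := hsub (Finset.mem_insert_self _ _)
        by_cases hc : ∀ x ∈ F, p.1 x = p.2
        · refine ⟨x, hx, fun p' hp' => ?_⟩
          rcases Finset.mem_insert.1 hp' with rfl | h
          · exact Or.inl (hcon _ hpL hc)
          · exact hxL _ h
        · push Not at hc
          obtain ⟨y, hy, hyp⟩ := hc
          refine ⟨(1 / 2 : ℝ) • x + (1 / 2 : ℝ) • y,
            hFconv hx hy (by norm_num) (by norm_num) (by norm_num), fun p' hp' => ?_⟩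
          have hp'L : p' ∈ L := hsub hp'
          have h1 := hle x (hFS hx) p' hp'L
          have h2 := hle y (hFS hy) p' hp'L
          simp only [map_add, map_smul, smul_eq_mul]
          rcases Finset.mem_insert.1 hp' with rfl | h
          · right
            have := lt_of_le_of_ne h2 hyp
            linarith
          · rcases hxL _ h with h | h
            · exact Or.inl h
            · right; linarith
    obtain ⟨x, hx, hxL⟩ := hp L subset_rfl
    have hxS := hFS hx
    have hFS' : ∃ q ∈ S.carrier, q ∉ F := by
      by_contra hcon
      push Not at hcon
      have : F = S.carrier := Subset.antisymm hFS hcon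
      rw [this] at hk
      omega
    obtain ⟨q, hq, hqF⟩ := hFS'
    have hxmax : ∀ y ∈ S.carrier, l y ≤ l x := by
      have := hx; rw [hl] at this; exact this.2
    have hlq : l q < l x := by
      by_contra hcon
      push Not at hcon
      refine hqF ?_
      rw [hl]
      exact ⟨hq, fun y hy => (hxmax y hy).trans hcon⟩
    have hev : ∀ᶠ t in 𝓝[>] (0 : ℝ), x + t • (x - q) ∈ S.carrier := by
      have h1 : ∀ᶠ t in 𝓝[>] (0 : ℝ), ∀ p ∈ L, p.1 (x + t • (x - q)) ≤ p.2 := by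
        rw [Filter.eventually_all_finset]
        intro p hpL
        rcases hxL p hpL with h | h
        · refine Eventually.of_forall fun t => ?_
          simp [h x hxS, h q hq]
        · have hcont : Continuous fun t : ℝ => p.1 (x + t • (x - q)) := by fun_prop
          have : ∀ᶠ t in 𝓝 (0 : ℝ), p.1 (x + t • (x - q)) < p.2 :=
            hcont.continuousAt.eventually_lt continuousAt_const (by simpa using h)
          exact (this.filter_mono nhdsWithin_le_nhds).mono fun t ht => ht.le
      filter_upwards [h1] with t ht
      rw [hS]
      refine ⟨?_, ht⟩
      have hxA : x ∈ A := by rw [hS] at hxS; exact hxS.1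
      have hqA : q ∈ A := by rw [hS] at hq; exact hq.1
      have := A.smul_vsub_vadd_mem t hxA hqA hxA
      simpa [add_comm] using this
    obtain ⟨t, ht, ht0⟩ := (hev.and self_mem_nhdsWithin).exists
    have := hxmax _ ht
    simp only [map_add, map_smul, map_sub, smul_eq_mul] at this
    have : 0 < t * (l x - l q) := mul_pos ht0 (by linarith)
    linarith
  obtain ⟨p, hpL, hpF, q, hq, hpq⟩ := key
  refine ⟨p, hpL, ?_⟩
  set E : Set X := {x ∈ S.carrier | p.1 x = p.2} with hE
  have hFE : F ⊆ E := fun x hx => ⟨hFS hx, hpF x hx⟩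
  obtain ⟨x, hx⟩ := hne
  have hxE := hFE hx
  have hEker : vectorSpan ℝ E ≤ LinearMap.ker (p.1 : X →ₗ[ℝ] ℝ) := by
    rw [vectorSpan_eq_span_vsub_set_right ℝ hxE, Submodule.span_le]
    rintro _ ⟨y, hy, rfl⟩
    simp [hy.2, hxE.2]
  have hES : vectorSpan ℝ E < vectorSpan ℝ S.carrier := by
    refine lt_of_le_of_ne (vectorSpan_mono ℝ (fun y hy => hy.1)) fun h => ?_
    have h1 : q -ᵥ x ∈ vectorSpan ℝ E := h ▸ vsub_mem_vectorSpan ℝ hq hxE.1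
    have h2 := hEker h1
    simp only [vsub_eq_sub, LinearMap.mem_ker, map_sub, sub_eq_zero] at h2
    exact hpq (by simpa [hxE.2] using h2)
  have hlt := Submodule.finrank_lt_finrank_of_lt hES
  have hEfd : FiniteDimensional ℝ (vectorSpan ℝ E) := Submodule.finiteDimensional_of_le hES.le
  have heq : vectorSpan ℝ F = vectorSpan ℝ E :=
    Submodule.eq_of_le_of_finrank_le (vectorSpan_mono ℝ hFE) (by omega)
  refine Subset.antisymm (fun y hy => ?_) hFE
  have hFker : vectorSpan ℝ F ≤ LinearMap.ker (l : X →ₗ[ℝ] ℝ) := by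
    rw [vectorSpan_eq_span_vsub_set_right ℝ hx, Submodule.span_le]
    rintro _ ⟨z, hz, rfl⟩
    have hx' := hx
    rw [hl] at hz hx'
    simp [le_antisymm (hx'.2 z hz.1) (hz.2 x hx'.1)]
  have h1 : y -ᵥ x ∈ vectorSpan ℝ F := heq ▸ vsub_mem_vectorSpan ℝ hy hxE
  have h2 := hFker h1
  simp only [vsub_eq_sub, LinearMap.mem_ker, map_sub, sub_eq_zero] at h2
  have h3 : l y = l x := h2
  have hx' := hx
  rw [hl] at hx' ⊢
  exact ⟨hy.1, fun z hz => h3 ▸ hx'.2 z hz⟩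

instance {k : ℕ} (S : OrientedPolyhedron X (k + 1)) : Finite (facets S) :=
  (facets_finite S).to_subtype

instance {k : ℕ} (S : OrientedPolyhedron X (k + 1)) : Fintype (facets S) :=
  Fintype.ofFinite _

open Classical in
/-- The boundary of a formal sum: `∂(g[S])` is the sum of the facets of `S` with the induced
orientations and coefficient `g`. -/
def boundary {k : ℕ} (P : FormalSum X G (k + 1)) : FormalSum X G k :=
  P.sum fun S g => ∑ F : facets S,
    if IsInducedOrientation S F then Finsupp.single (facet S F) g
    else Finsupp.single (facet S F) (-g)

/-! ### Restriction to half-spaces and slices -/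

/-- The part of the polyhedron `S` in the half-space `{f < r}` (if it is not empty), as a closed
polyhedron with the orientation of `S`. -/
def cut {k : ℕ} (S : OrientedPolyhedron X k) (f : X →L[ℝ] ℝ) (r : ℝ)
    (h : (S.carrier ∩ {x | f x < r}).Nonempty) : OrientedPolyhedron X k where
  carrier := S.carrier ∩ {x | f x ≤ r}
  isPolyhedron := S.isPolyhedron.inter_halfspace f r
  nonempty := by
    obtain ⟨x, hx, hr⟩ := h
    exact ⟨x, hx, le_of_lt (show f x < r from hr)⟩
  frame := S.frame
  linearIndependent := S.linearIndependent
  span_frame := by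
    rw [S.span_frame, vectorSpan_inter_halfspace S.isPolyhedron.convex f r h]

open Classical in
/-- The portion of `P` in `f⁻¹((-∞, r))`. -/
def restrict {k : ℕ} (f : X →L[ℝ] ℝ) (r : ℝ) (P : FormalSum X G k) : FormalSum X G k :=
  P.sum fun S g =>
    if h : (S.carrier ∩ {x | f x < r}).Nonempty then Finsupp.single (cut S f r h) g else 0

/-- The slice `P ∩ f⁻¹(r) = ∂(P_r) - (∂P)_r`. -/
def slice {k : ℕ} (f : X →L[ℝ] ℝ) (r : ℝ) (P : FormalSum X G (k + 1)) : FormalSum X G k :=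
  boundary (restrict f r P) - restrict f r (boundary P)

/-! ### Mass and flat norm -/

/-- The summands of the formal sum are pairwise disjoint as relatively open polyhedra. -/
def IsDisjointSum {k : ℕ} (P : FormalSum X G k) : Prop :=
  (P.support : Set (OrientedPolyhedron X k)).Pairwise fun S T =>
    Disjoint (intrinsicInterior ℝ S.carrier) (intrinsicInterior ℝ T.carrier)

/-- Extension of a mass `m S g` of simple chains `g[S]` to arbitrary chains: the value
`∑ m Sᵢ gᵢ` for the representations `∑ gᵢ [Sᵢ]` of the chain with disjoint summands. (For the mass
below this value does not depend on the representation; the infimum picks it.) -/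
def massOfSimple {k : ℕ} (m : OrientedPolyhedron X k → G → ℝ≥0∞) (P : PolyhedralChain X G k) :
    ℝ≥0∞ :=
  ⨅ (Q : FormalSum X G k) (_ : IsDisjointSum Q ∧ Q.toChain = P), Q.sum m

/-- The mass of the simple chain `g[S]`. -/
def simpleMass : (k : ℕ) → OrientedPolyhedron X k → G → ℝ≥0∞
  | 0, _, g => ‖g‖ₑ
  | k + 1, S, g => ⨆ (f : X →L[ℝ] ℝ) (_ : ‖f‖ = 1),
      ∫⁻ r : ℝ, massOfSimple (simpleMass k) (slice f r (Finsupp.single S g)).toChain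

/-- The mass `M(P)` of a polyhedral chain. -/
def mass {k : ℕ} (P : PolyhedralChain X G k) : ℝ≥0∞ :=
  massOfSimple (simpleMass k) P

/-- The flat norm `F(P) = inf_Q M(Q) + M(∂Q - P)`, over all polyhedral `(k+1)`-chains, given by
formal sums `Q`. -/
def flatNorm {k : ℕ} (P : PolyhedralChain X G k) : ℝ≥0∞ :=
  ⨅ Q : FormalSum X G (k + 1), mass Q.toChain + mass ((boundary Q).toChain - P)

end Chains

end FlatChains

end

namespace FlatChains

variable {X : Type*} [NormedAddCommGroup X] [NormedSpace ℝ X]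

/-! The proof reads both mass and boundary off projections `proj π : X → ℝᵏ` whose components have
norm one. By induction on `k` and Cavalieri's principle, the mass of `g[S]` is `‖g‖` times the
supremum of the Lebesgue measures of the images of `S` under such projections (`simpleMass_eq`).

Chains are equivalence classes and are handled through densities: `density π x` adds up the
coefficients of the polyhedra through `x`, with signs given by `π`. Apart from the fibres over a
null set it respects the relations, and the densities for all `π` determine the chain
(`toChain_eq_of_density_eq`). If the projection is nondegenerate on a `(k+1)`-polyhedron, its fibres
there are segments, and the density of the boundary is the coefficient at the final point minus the
coefficient at the initial point (`density_boundary`).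

For semicontinuity, represent the limit `P₀` by disjoint summands `g[S]`. For each `S` take a nearly
optimal `π` and a compact set `C` in the image of `S` that avoids the images of the intersections
with the other summands. The part of `S` over `C` has positive distance from the other summands, so
there is a `1`-Lipschitz `h` that is `≤ 0` on this part and `> δ` on the others; the sets `{h ≤ δ}`
belonging to different `S` are disjoint. Write `P₀ = P + R - ∂Q`, as in the flat norm of `P - P₀`.
On the fibre over a point of `C`, add the densities over suitable points with `h < t`, where `0 < t
≤ δ`. Then `P₀` gives `±g`, and a segment of `Q` contributes only if `t` separates the values of `h`
at its ends; such `t` have measure at most the length of the segment. Integration over `t` and over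
the fibres bounds `δ ‖g‖ vol(C)` by `δ` times the projected measure of `P` in `{h ≤ δ}`, plus `δ
M(R) + M(Q)` (`local_estimate`).

In the sum over `S`, the disjointness of the sets `{h ≤ δ}` bounds the terms of `P` by `M(P)`, so `∑
‖g‖ vol(C) ≤ M(P) + N F(P - P₀)` with `N` independent of `P` (`exists_le_mass_add_flatNorm`). Let
`F(P - P₀)` tend to zero and afterwards let the sets `C` exhaust the images. -/

/-! ### Projections to Euclidean space and minors -/

/-- The continuous linear map `X → ℝᵏ` whose components are the functionals `π i`. -/
noncomputable def proj {k : ℕ} (π : Fin k → X →L[ℝ] ℝ) : X →L[ℝ] (Fin k → ℝ) :=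
  ContinuousLinearMap.pi π

@[simp] theorem proj_apply {k : ℕ} (π : Fin k → X →L[ℝ] ℝ) (x : X) (i : Fin k) :
    proj π x i = π i x := rfl

/-- The determinant of the matrix `π i (v j)`. -/
noncomputable def minor {k : ℕ} (π : Fin k → X →L[ℝ] ℝ) (v : Fin k → X) : ℝ :=
  (Matrix.of fun i j => π i (v j)).det

theorem minor_change {k : ℕ} (π : Fin k → X →L[ℝ] ℝ) {v w : Fin k → X}
    {A : Matrix (Fin k) (Fin k) ℝ} (h : ∀ j, w j = ∑ i, A i j • v i) :
    minor π w = A.det * minor π v := by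
  rw [minor, minor, mul_comm, ← Matrix.det_mul]
  congr 1
  ext i j
  simp [Matrix.mul_apply, h, mul_comm]

/-- The measure of a projection of an affinely parametrised set. -/
theorem volume_proj_image {k : ℕ} (π : Fin k → X →L[ℝ] ℝ) (v : Fin k → X) (x₀ : X) {T : Set X}
    (hT : ∀ x ∈ T, x - x₀ ∈ Submodule.span ℝ (range v)) :
    volume (proj π '' T) =
      ENNReal.ofReal |minor π v| * volume {t : Fin k → ℝ | x₀ + ∑ j, t j • v j ∈ T} := by
  set A : Matrix (Fin k) (Fin k) ℝ := Matrix.of fun i j => π i (v j) with hA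
  have himage : proj π '' T =
      (fun y => proj π x₀ + y) '' (Matrix.toLin' A '' {t : Fin k → ℝ | x₀ + ∑ j, t j • v j ∈ T}) := by
    have hpar : ∀ t : Fin k → ℝ, proj π (x₀ + ∑ j, t j • v j) = proj π x₀ + Matrix.toLin' A t := by
      intro t
      ext i
      simp [hA, Matrix.mulVec, dotProduct, mul_comm]
    ext y
    simp only [mem_image, mem_ofPred_eq, exists_exists_and_eq_and]
    constructor
    · rintro ⟨x, hx, rfl⟩
      obtain ⟨t, ht⟩ := (Submodule.mem_span_range_iff_exists_fun ℝ).1 (hT x hx)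
      have hx' : x₀ + ∑ j, t j • v j = x := by rw [ht]; abel
      exact ⟨t, by rwa [hx'], by rw [← hpar, hx']⟩
    · rintro ⟨t, ht, rfl⟩
      exact ⟨_, ht, hpar t⟩
  rw [himage, image_add_left, measure_preimage_add, Measure.addHaar_image_linearMap,
    LinearMap.det_toLin']
  rfl

/-- Hahn–Banach extends the coordinate functionals of the span continuously to `X`. -/
theorem exists_dual_family {k : ℕ} {v : Fin k → X} (hv : LinearIndependent ℝ v) :
    ∃ π : Fin k → X →L[ℝ] ℝ, ∀ i j, π i (v j) = if i = j then 1 else 0 := by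
  have hinj : Function.Injective (Fintype.linearCombination ℝ v) :=
    linearIndependent_iff_injective_fintypeLinearCombination.1 hv
  choose π hπ using fun i : Fin k =>
    (SeparatingDual.dualMap_surjective_iff (R := ℝ)).2 hinj (LinearMap.proj i)
  refine ⟨π, fun i j => ?_⟩
  have := congrArg (fun φ : Module.Dual ℝ (Fin k → ℝ) => φ (Pi.single j 1)) (hπ i)
  simpa [Pi.single_apply] using this

theorem exists_minor_eq_one {k : ℕ} {v : Fin k → X} (hv : LinearIndependent ℝ v) :
    ∃ π : Fin k → X →L[ℝ] ℝ, minor π v = 1 := by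
  obtain ⟨π, hπ⟩ := exists_dual_family hv
  refine ⟨π, ?_⟩
  have : (Matrix.of fun i j => π i (v j)) = 1 := by
    ext i j
    simp [hπ, Matrix.one_apply]
  rw [minor, this, Matrix.det_one]

/-- Two frames of one subspace are related by an invertible matrix. -/
theorem exists_change_of_frame {k : ℕ} {v w : Fin k → X} (hw : LinearIndependent ℝ w)
    (h : ∀ j, w j ∈ Submodule.span ℝ (range v)) :
    ∃ A : Matrix (Fin k) (Fin k) ℝ, (∀ j, w j = ∑ i, A i j • v i) ∧ A.det ≠ 0 := by
  choose A hA using fun j => (Submodule.mem_span_range_iff_exists_fun ℝ).1 (h j)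
  have hA' : ∀ j, w j = ∑ i, (Matrix.of fun i j => A j i) i j • v i := fun j => (hA j).symm
  refine ⟨_, hA', fun h0 => ?_⟩
  obtain ⟨π, hπ⟩ := exists_minor_eq_one hw
  rw [minor_change π hA', h0, zero_mul] at hπ
  exact zero_ne_one hπ

theorem eq_zero_of_proj_eq_zero {k : ℕ} {π : Fin k → X →L[ℝ] ℝ} {v : Fin k → X}
    (h : minor π v ≠ 0) {x : X} (hx : x ∈ Submodule.span ℝ (range v)) (h0 : proj π x = 0) :
    x = 0 := by
  obtain ⟨t, rfl⟩ := (Submodule.mem_span_range_iff_exists_fun ℝ).1 hx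
  have ht : t = 0 := by
    refine Matrix.eq_zero_of_mulVec_eq_zero h ?_
    ext i
    have := congrFun h0 i
    simpa [Matrix.mulVec, dotProduct, mul_comm] using this
  simp [ht]

/-- The fibre direction of `proj π` in the span of `v`: the generalised cross product. -/
noncomputable def fiberDir {k : ℕ} (π : Fin k → X →L[ℝ] ℝ) (v : Fin (k + 1) → X) : X :=
  ∑ j : Fin (k + 1), ((-1) ^ (j : ℕ) * minor π (fun i => v (j.succAbove i))) • v j

/-- Laplace expansion along the row of `h`. Since functionals separate points, all properties of
`fiberDir` reduce to determinants. -/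
theorem apply_fiberDir {k : ℕ} (π : Fin k → X →L[ℝ] ℝ) (v : Fin (k + 1) → X)
    (h : X →L[ℝ] ℝ) : h (fiberDir π v) = minor (Fin.cons h π : Fin (k + 1) → X →L[ℝ] ℝ) v := by
  rw [minor, Matrix.det_succ_row_zero, fiberDir, map_sum]
  refine Finset.sum_congr rfl fun j _ => ?_
  simp only [map_smul, smul_eq_mul, Matrix.of_apply, Fin.cons_zero, minor]
  have : (Matrix.of fun (i j : Fin (k + 1)) => (Fin.cons h π : Fin (k + 1) → X →L[ℝ] ℝ) i (v j)).submatrix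
      Fin.succ j.succAbove = Matrix.of fun i l => π i (v (j.succAbove l)) := by
    ext i l
    simp
  rw [this]
  ring

theorem fiberDir_mem_span {k : ℕ} (π : Fin k → X →L[ℝ] ℝ) (v : Fin (k + 1) → X) :
    fiberDir π v ∈ Submodule.span ℝ (range v) :=
  Submodule.sum_mem _ fun j _ => Submodule.smul_mem _ _ (Submodule.subset_span ⟨j, rfl⟩)

theorem proj_fiberDir {k : ℕ} (π : Fin k → X →L[ℝ] ℝ) (v : Fin (k + 1) → X) :
    proj π (fiberDir π v) = 0 := by
  ext i
  rw [proj_apply, apply_fiberDir, Pi.zero_apply, minor]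
  -- Testing `fiberDir` with `π i` produces a matrix with a repeated row.
  refine Matrix.det_zero_of_row_eq (i := 0) (j := i.succ) (Fin.succ_ne_zero i).symm ?_
  ext j
  simp

theorem fiberDir_change {k : ℕ} (π : Fin k → X →L[ℝ] ℝ) {v w : Fin (k + 1) → X}
    {A : Matrix (Fin (k + 1)) (Fin (k + 1)) ℝ} (h : ∀ j, w j = ∑ i, A i j • v i) :
    fiberDir π w = A.det • fiberDir π v := by
  refine (SeparatingDual.eq_iff_forall_dual_eq (R := ℝ)).2 fun f => ?_
  rw [map_smul, apply_fiberDir, apply_fiberDir, minor_change _ h, smul_eq_mul]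

/-- A vector of the span of `v` in the kernel of `proj π` is a multiple of `fiberDir π v`, provided
the latter is nonzero. -/
theorem exists_smul_fiberDir {k : ℕ} {π : Fin k → X →L[ℝ] ℝ} {v : Fin (k + 1) → X}
    (hd : fiberDir π v ≠ 0) {x : X} (hx : x ∈ Submodule.span ℝ (range v)) (h0 : proj π x = 0) :
    ∃ c : ℝ, x = c • fiberDir π v := by
  obtain ⟨h, hh⟩ := SeparatingDual.exists_ne_zero (R := ℝ) hd
  refine ⟨h x / h (fiberDir π v), sub_eq_zero.1 ?_⟩
  have hm : minor (Fin.cons h π : Fin (k + 1) → X →L[ℝ] ℝ) v ≠ 0 := by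
    rwa [← apply_fiberDir]
  refine eq_zero_of_proj_eq_zero hm
    (Submodule.sub_mem _ hx (Submodule.smul_mem _ _ (fiberDir_mem_span π v))) ?_
  ext i
  refine Fin.cases ?_ (fun i => ?_) i
  · simp [hh]
  · have h1 := congrFun h0 i
    have h2 := congrFun (proj_fiberDir π v) i
    simp only [proj_apply, Pi.zero_apply] at h1 h2
    simp [h1, h2]

/-- Only one entry of the row of `h` survives. This compares the orientation of a polyhedron with
that of a facet or of a level set, on whose directions `h` vanishes. -/
theorem minor_cons_cons {k : ℕ} (π : Fin k → X →L[ℝ] ℝ) (h : X →L[ℝ] ℝ) (n : X) (w : Fin k → X)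
    (hw : ∀ i, h (w i) = 0) :
    minor (Fin.cons h π : Fin (k + 1) → X →L[ℝ] ℝ) (Fin.cons n w : Fin (k + 1) → X) =
      h n * minor π w := by
  rw [minor, Matrix.det_succ_row_zero, Fin.sum_univ_succ]
  have : (Matrix.of fun (i j : Fin (k + 1)) => (Fin.cons h π : Fin (k + 1) → X →L[ℝ] ℝ) i
      ((Fin.cons n w : Fin (k + 1) → X) j)).submatrix
      Fin.succ (Fin.succAbove 0) = Matrix.of fun i l => π i (w l) := by
    ext i l
    simp
  rw [this]
  simp [hw, minor]

/-! ### Generic points for a projection -/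

/-- A property holds for generic `x` if it holds on the whole fibre of `proj π` over almost every
point of `ℝᵏ`. -/
noncomputable def generic {k : ℕ} (π : Fin k → X →L[ℝ] ℝ) : Filter X :=
  comap (proj π) (ae volume)

theorem eventually_generic {k : ℕ} {π : Fin k → X →L[ℝ] ℝ} {p : X → Prop} :
    (∀ᶠ x in generic π, p x) ↔ ∀ᵐ y, ∀ x, proj π x = y → p x :=
  eventually_comap

theorem eventually_notMem_generic {k : ℕ} {π : Fin k → X →L[ℝ] ℝ} {N : Set X} :
    (∀ᶠ x in generic π, x ∉ N) ↔ volume (proj π '' N) = 0 := by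
  rw [eventually_generic, ae_iff]
  congr! 2
  ext y
  simp [and_comm]

theorem volume_proj_image_eq_zero {k : ℕ} {π : Fin k → X →L[ℝ] ℝ} {N : Set X}
    (h : (vectorSpan ℝ N).map (proj π : X →ₗ[ℝ] (Fin k → ℝ)) ≠ ⊤) : volume (proj π '' N) = 0 := by
  rcases N.eq_empty_or_nonempty with rfl | ⟨x₀, hx₀⟩
  · simp
  · set W := (vectorSpan ℝ N).map (proj π : X →ₗ[ℝ] (Fin k → ℝ))
    refine measure_mono_null (t := AffineSubspace.mk' (proj π x₀) W) ?_
      (Measure.addHaar_affineSubspace volume _ fun hW => h ?_)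
    · rintro _ ⟨x, hx, rfl⟩
      refine AffineSubspace.mem_mk'.2 ⟨x - x₀, vsub_mem_vectorSpan ℝ hx hx₀, by simp⟩
    · simpa using congrArg AffineSubspace.direction hW

theorem volume_proj_image_eq_zero_of_finrank {k : ℕ} {π : Fin k → X →L[ℝ] ℝ} {N : Set X}
    [FiniteDimensional ℝ (vectorSpan ℝ N)] (h : Module.finrank ℝ (vectorSpan ℝ N) < k) :
    volume (proj π '' N) = 0 := by
  refine volume_proj_image_eq_zero fun htop => ?_
  have := Submodule.finrank_map_le (proj π : X →ₗ[ℝ] (Fin k → ℝ)) (vectorSpan ℝ N)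
  rw [htop, finrank_top, Module.finrank_fin_fun] at this
  omega

/-- The projection collapses the direction `d`, so the image lies in a proper affine subspace even
if `N` has full dimension `k`. -/
theorem volume_proj_image_eq_zero_of_mem {k : ℕ} {π : Fin k → X →L[ℝ] ℝ} {N : Set X}
    [FiniteDimensional ℝ (vectorSpan ℝ N)] (h : Module.finrank ℝ (vectorSpan ℝ N) ≤ k)
    {d : X} (hd : d ∈ vectorSpan ℝ N) (hd0 : d ≠ 0) (hπ : proj π d = 0) :
    volume (proj π '' N) = 0 := by
  refine volume_proj_image_eq_zero fun htop => ?_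
  have h1 := LinearMap.finrank_range_add_finrank_ker
    ((proj π : X →ₗ[ℝ] (Fin k → ℝ)).domRestrict (vectorSpan ℝ N))
  rw [LinearMap.range_domRestrict, htop, finrank_top, Module.finrank_fin_fun] at h1
  have h2 : 0 < Module.finrank ℝ (LinearMap.ker
      ((proj π : X →ₗ[ℝ] (Fin k → ℝ)).domRestrict (vectorSpan ℝ N))) := by
    refine Module.finrank_pos_iff_exists_ne_zero.2 ⟨⟨⟨d, hd⟩, ?_⟩, ?_⟩
    · simpa using hπ
    · simpa [Subtype.ext_iff] using hd0
  omega

/-! ### Convex polyhedra -/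

theorem IsConvexPolyhedron.isClosed {S : Set X} (hS : IsConvexPolyhedron S) : IsClosed S := by
  obtain ⟨-, A, L, hA, rfl⟩ := hS
  have h1 : IsClosed (A : Set X) := A.closed_of_finiteDimensional
  have h2 : IsClosed {x : X | ∀ p ∈ L, p.1 x ≤ p.2} := by
    simp only [ofPred_forall]
    exact isClosed_biInter fun p _ => isClosed_le p.1.continuous continuous_const
  exact h1.inter h2

theorem IsConvexPolyhedron.isCompact {S : Set X} (hS : IsConvexPolyhedron S) : IsCompact S := by
  rcases S.eq_empty_or_nonempty with rfl | ⟨x₀, hx₀⟩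
  · exact isCompact_empty
  have hcl := hS.isClosed
  have hfd := hS.finiteDimensional
  have hprop : ProperSpace (vectorSpan ℝ S) := FiniteDimensional.proper ℝ _
  have hiso : Isometry fun d : vectorSpan ℝ S => x₀ + (d : X) :=
    (IsometryEquiv.addLeft x₀).isometry.comp isometry_subtype_coe
  have hK : IsCompact ((fun d : vectorSpan ℝ S => x₀ + (d : X)) ⁻¹' S) :=
    Metric.isCompact_of_isClosed_isBounded (hcl.preimage hiso.continuous)
      (hiso.antilipschitz.isBounded_preimage hS.1)
  convert hK.image hiso.continuous
  ext x
  constructor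
  · intro hx
    exact ⟨⟨x - x₀, vsub_mem_vectorSpan ℝ hx hx₀⟩, by simpa using hx, by simp⟩
  · rintro ⟨d, hd, rfl⟩
    exact hd

theorem IsConvexPolyhedron.inter {S T : Set X} (hS : IsConvexPolyhedron S)
    (hT : IsConvexPolyhedron T) : IsConvexPolyhedron (S ∩ T) := by
  classical
  obtain ⟨hb, A, L, hA, rfl⟩ := hS
  obtain ⟨-, B, M, hB, rfl⟩ := hT
  refine ⟨hb.subset inter_subset_left, A ⊓ B, L ∪ M, ?_, ?_⟩
  · exact Submodule.finiteDimensional_of_le (AffineSubspace.direction_le inf_le_left)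
  · ext x
    simp only [mem_inter_iff, mem_ofPred_eq, Finset.mem_union, AffineSubspace.mem_inf_iff]
    constructor
    · rintro ⟨⟨h1, h2⟩, h3, h4⟩
      exact ⟨⟨h1, h3⟩, fun p hp => hp.elim (h2 p) (h4 p)⟩
    · rintro ⟨⟨h1, h3⟩, h⟩
      exact ⟨⟨h1, fun p hp => h p (Or.inl hp)⟩, h3, fun p hp => h p (Or.inr hp)⟩

/-- A convex set has a point at which every constraint valid on it that is not an equality is
strict. -/
theorem exists_strict_point {S : Set X} (hS : Convex ℝ S) (hne : S.Nonempty)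
    (L : Finset ((X →L[ℝ] ℝ) × ℝ)) (hL : ∀ x ∈ S, ∀ p ∈ L, p.1 x ≤ p.2) :
    ∃ x ∈ S, ∀ p ∈ L, p.1 x < p.2 ∨ ∀ z ∈ S, p.1 z = p.2 := by
  classical
  induction L using Finset.induction_on with
  | empty => exact ⟨hne.choose, hne.choose_spec, by simp⟩
  | insert p L _ ih =>
    obtain ⟨x, hx, hxL⟩ := ih fun x hx q hq => hL x hx q (Finset.mem_insert_of_mem hq)
    by_cases hc : ∀ z ∈ S, p.1 z = p.2
    · refine ⟨x, hx, fun q hq => ?_⟩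
      rcases Finset.mem_insert.1 hq with rfl | h
      · exact Or.inr hc
      · exact hxL _ h
    · push Not at hc
      obtain ⟨y, hy, hyp⟩ := hc
      -- A constraint that is strict at one of two admissible points is strict at their midpoint.
      refine ⟨(1 / 2 : ℝ) • x + (1 / 2 : ℝ) • y,
        hS hx hy (by norm_num) (by norm_num) (by norm_num), fun q hq => ?_⟩
      have h1 := hL x hx q hq
      have h2 := hL y hy q hq
      simp only [map_add, map_smul, smul_eq_mul]
      rcases Finset.mem_insert.1 hq with rfl | h
      · left
        have := lt_of_le_of_ne h2 hyp
        linarith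
      · rcases hxL _ h with h | h
        · left; linarith
        · exact Or.inr h

theorem apply_eq_of_mem_affineSpan {S : Set X} {f : X →L[ℝ] ℝ} {c : ℝ} (h : ∀ z ∈ S, f z = c)
    {x : X} (hx : x ∈ affineSpan ℝ S) : f x = c := by
  have : affineSpan ℝ S ≤ (affineSpan ℝ {c}).comap (f : X →ₗ[ℝ] ℝ).toAffineMap := by
    rw [affineSpan_le]
    intro z hz
    simp [h z hz]
  simpa using this hx

theorem apply_eq_zero_of_mem_vectorSpan {S : Set X} {f : X →L[ℝ] ℝ} {c : ℝ}
    (h : ∀ z ∈ S, f z = c) {d : X} (hd : d ∈ vectorSpan ℝ S) : f d = 0 := by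
  have : vectorSpan ℝ S ≤ LinearMap.ker (f : X →ₗ[ℝ] ℝ) := by
    rw [vectorSpan, Submodule.span_le]
    rintro _ ⟨x, hx, y, hy, rfl⟩
    simp [h x hx, h y hy]
  exact this hd

/-- Constraints that are equalities on `S` remain so on its affine span, and the strict ones persist
near `x`. -/
theorem mem_intrinsicInterior_of_strict {A : AffineSubspace ℝ X}
    {L : Finset ((X →L[ℝ] ℝ) × ℝ)} {S : Set X} (hS : S = {x | x ∈ A ∧ ∀ p ∈ L, p.1 x ≤ p.2})
    {x : X} (hx : x ∈ S) (hstrict : ∀ p ∈ L, p.1 x < p.2 ∨ ∀ z ∈ S, p.1 z = p.2) :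
    x ∈ intrinsicInterior ℝ S := by
  refine ⟨⟨x, subset_affineSpan ℝ S hx⟩, ?_, rfl⟩
  rw [mem_interior]
  refine ⟨{z | ∀ p ∈ L, p.1 x < p.2 → p.1 z < p.2}, ?_, ?_, fun p _ h => h⟩
  · rintro z hz
    have hzA : (z : X) ∈ A := by
      have : affineSpan ℝ S ≤ A := affineSpan_le.2 fun y hy => by rw [hS] at hy; exact hy.1
      exact this z.2
    refine hS.ge ⟨hzA, fun p hp => ?_⟩
    rcases hstrict p hp with h | h
    · exact (hz p hp h).le
    · exact (apply_eq_of_mem_affineSpan h z.2).le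
  · simp only [ofPred_forall]
    refine isOpen_biInter_finset fun p _ => isOpen_iInter_of_finite fun _ => ?_
    exact isOpen_lt (p.1.continuous.comp continuous_subtype_val) continuous_const

/-- A functional that attains its maximum over a set at a relative interior point is constant. -/
theorem apply_eq_of_mem_intrinsicInterior {S : Set X} {x : X} (hx : x ∈ intrinsicInterior ℝ S)
    {f : X →L[ℝ] ℝ} {c : ℝ} (hf : ∀ z ∈ S, f z ≤ c) (hfx : c ≤ f x) {z : X} (hz : z ∈ S) :
    f z = c := by
  obtain ⟨x', hx', rfl⟩ := hx
  let γ : ℝ → affineSpan ℝ S := fun t =>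
    ⟨AffineMap.lineMap (x' : X) z t, AffineMap.lineMap_mem t x'.2 (subset_affineSpan ℝ S hz)⟩
  have hγ : Continuous γ := by
    refine Continuous.subtype_mk ?_ _
    exact AffineMap.lineMap_continuous
  have h0 : γ 0 = x' := by ext; simp [γ]
  have hev : ∀ᶠ t in 𝓝 (0 : ℝ), γ t ∈ ((↑) : affineSpan ℝ S → X) ⁻¹' S := by
    refine hγ.continuousAt.eventually_mem ?_
    rw [h0]
    exact mem_interior_iff_mem_nhds.1 hx'
  -- A negative `t` continues the segment from `z` to `x` beyond `x`, still inside `S`; if `f z <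
  -- c`, the value there would exceed `c`.
  obtain ⟨t, ht, ht0⟩ := ((hev.filter_mono nhdsWithin_le_nhds).and
    (self_mem_nhdsWithin : Iio (0 : ℝ) ∈ 𝓝[<] 0)).exists
  have h1 := hf _ ht
  simp only [γ, AffineMap.lineMap_apply, vsub_eq_sub, vadd_eq_add, map_add, map_smul, map_sub,
    smul_eq_mul] at h1
  have h2 := hf z hz
  have h3 : (0 : ℝ) < -t := neg_pos.2 ht0
  nlinarith

/-! ### Projections of oriented polyhedra -/

namespace OrientedPolyhedron

variable {k : ℕ}

theorem finiteDimensional (S : OrientedPolyhedron X k) :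
    FiniteDimensional ℝ (vectorSpan ℝ S.carrier) := S.isPolyhedron.finiteDimensional

theorem finrank_vectorSpan (S : OrientedPolyhedron X k) :
    Module.finrank ℝ (vectorSpan ℝ S.carrier) = k := by
  rw [← S.span_frame, finrank_span_eq_card S.linearIndependent, Fintype.card_fin]

theorem sub_mem_span (S : OrientedPolyhedron X k) {x y : X} (hx : x ∈ S.carrier)
    (hy : y ∈ S.carrier) : x - y ∈ Submodule.span ℝ (range S.frame) := by
  rw [S.span_frame]
  exact vsub_mem_vectorSpan ℝ hx hy

theorem isCompact (S : OrientedPolyhedron X k) : IsCompact S.carrier := S.isPolyhedron.isCompact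

theorem convex (S : OrientedPolyhedron X k) : Convex ℝ S.carrier := S.isPolyhedron.convex

theorem measurableSet_proj_image (S : OrientedPolyhedron X k) {m : ℕ} (π : Fin m → X →L[ℝ] ℝ) :
    MeasurableSet (proj π '' S.carrier) :=
  (S.isCompact.image (proj π).continuous).measurableSet

theorem affineSpan_eq_of_subset {S : OrientedPolyhedron X k} {C : Set X} (hC : C.Nonempty)
    (hCS : C ⊆ S.carrier) (hfin : k ≤ Module.finrank ℝ (vectorSpan ℝ C)) :
    affineSpan ℝ C = affineSpan ℝ S.carrier := by
  have := S.finiteDimensional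
  have hle := vectorSpan_mono ℝ hCS
  have hdir : vectorSpan ℝ C = vectorSpan ℝ S.carrier :=
    Submodule.eq_of_le_of_finrank_le hle (by rw [S.finrank_vectorSpan]; exact hfin)
  refine AffineSubspace.eq_of_direction_eq_of_nonempty_of_le ?_ (hC.affineSpan ℝ)
    (affineSpan_mono ℝ hCS)
  rw [direction_affineSpan, direction_affineSpan, hdir]

/-- Polyhedra with disjoint relative interiors meet in a set of smaller dimension. -/
theorem finrank_inter_lt {S T : OrientedPolyhedron X k}
    (h : Disjoint (intrinsicInterior ℝ S.carrier) (intrinsicInterior ℝ T.carrier))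
    (hne : (S.carrier ∩ T.carrier).Nonempty) :
    Module.finrank ℝ (vectorSpan ℝ (S.carrier ∩ T.carrier)) < k := by
  classical
  by_contra hcon
  push Not at hcon
  have hS := affineSpan_eq_of_subset (S := S) hne inter_subset_left hcon
  have hT := affineSpan_eq_of_subset (S := T) hne inter_subset_right hcon
  obtain ⟨-, A, L, -, hAS⟩ := S.isPolyhedron
  obtain ⟨-, B, M, -, hBT⟩ := T.isPolyhedron
  -- An intersection of full dimension has the affine spans of both polyhedra, so a strict point for
  -- both systems of constraints lies in both relative interiors.
  obtain ⟨x, hx, hstrict⟩ := exists_strict_point (S.convex.inter T.convex) hne (L ∪ M) (by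
    rintro x ⟨hxS, hxT⟩ p hp
    rw [hAS] at hxS
    rw [hBT] at hxT
    exact (Finset.mem_union.1 hp).elim (hxS.2 p) (hxT.2 p))
  refine disjoint_left.1 h (mem_intrinsicInterior_of_strict hAS hx.1 fun p hp => ?_)
    (mem_intrinsicInterior_of_strict hBT hx.2 fun p hp => ?_)
  · refine (hstrict p (Finset.mem_union_left _ hp)).imp_right fun h z hz => ?_
    exact apply_eq_of_mem_affineSpan h (hS ▸ subset_affineSpan ℝ _ hz)
  · refine (hstrict p (Finset.mem_union_right _ hp)).imp_right fun h z hz => ?_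
    exact apply_eq_of_mem_affineSpan h (hT ▸ subset_affineSpan ℝ _ hz)

theorem eventually_notMem_inter {S T : OrientedPolyhedron X k}
    (h : Disjoint (intrinsicInterior ℝ S.carrier) (intrinsicInterior ℝ T.carrier))
    (π : Fin k → X →L[ℝ] ℝ) : ∀ᶠ x in generic π, x ∉ S.carrier ∩ T.carrier := by
  rw [eventually_notMem_generic]
  rcases (S.carrier ∩ T.carrier).eq_empty_or_nonempty with he | hne
  · simp [he]
  · have := (S.isPolyhedron.inter T.isPolyhedron).finiteDimensional
    exact volume_proj_image_eq_zero_of_finrank (finrank_inter_lt h hne)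

/-- The measures of different projections of a subset of `S` are proportional. -/
theorem volume_proj_image_subset (S : OrientedPolyhedron X k) (π : Fin k → X →L[ℝ] ℝ) {x₀ : X}
    (hx₀ : x₀ ∈ S.carrier) {T : Set X} (hT : T ⊆ S.carrier) :
    volume (proj π '' T) = ENNReal.ofReal |minor π S.frame| *
      volume {t : Fin k → ℝ | x₀ + ∑ j, t j • S.frame j ∈ T} :=
  volume_proj_image π S.frame x₀ fun _ hx => S.sub_mem_span (hT hx) hx₀

theorem eventually_notMem_of_minor_eq_zero (S : OrientedPolyhedron X k) {π : Fin k → X →L[ℝ] ℝ}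
    (h : minor π S.frame = 0) : ∀ᶠ x in generic π, x ∉ S.carrier := by
  obtain ⟨x₀, hx₀⟩ := S.nonempty
  rw [eventually_notMem_generic, S.volume_proj_image_subset π hx₀ subset_rfl, h]
  simp

theorem injOn_proj (S : OrientedPolyhedron X k) {π : Fin k → X →L[ℝ] ℝ}
    (h : minor π S.frame ≠ 0) : InjOn (proj π) S.carrier := fun x hx y hy hxy =>
  sub_eq_zero.1 (eq_zero_of_proj_eq_zero h (S.sub_mem_span hx hy) (by simp [hxy]))

/-- The projection is injective on the directions of `S`, so the image is a convex set that spans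
`ℝᵏ` and has nonempty interior. -/
theorem volume_proj_image_pos (S : OrientedPolyhedron X k) {π : Fin k → X →L[ℝ] ℝ}
    (h : minor π S.frame ≠ 0) : 0 < volume (proj π '' S.carrier) := by
  have hconv : Convex ℝ (proj π '' S.carrier) :=
    S.convex.linear_image (proj π : X →ₗ[ℝ] (Fin k → ℝ))
  have hspan : affineSpan ℝ (proj π '' S.carrier) = ⊤ := by
    rw [AffineSubspace.affineSpan_eq_top_iff_vectorSpan_eq_top_of_nonempty _ _ _
      (S.nonempty.image _)]
    have h1 : vectorSpan ℝ (proj π '' S.carrier) =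
        (vectorSpan ℝ S.carrier).map (proj π : X →ₗ[ℝ] (Fin k → ℝ)) :=
      ((proj π : X →ₗ[ℝ] (Fin k → ℝ)).toAffineMap.map_vectorSpan).symm
    rw [h1]
    have := S.finiteDimensional
    refine Submodule.eq_top_of_finrank_eq ?_
    have h2 : Function.Injective
        ((proj π : X →ₗ[ℝ] (Fin k → ℝ)).domRestrict (vectorSpan ℝ S.carrier)) := by
      rw [injective_iff_map_eq_zero]
      rintro ⟨x, hx⟩ hx0
      rw [← S.span_frame] at hx
      ext
      exact eq_zero_of_proj_eq_zero h hx hx0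
    rw [← LinearMap.range_domRestrict, LinearMap.finrank_range_of_inj h2, S.finrank_vectorSpan,
      Module.finrank_fin_fun]
  rw [← hconv.interior_nonempty_iff_affineSpan_eq_top] at hspan
  exact Measure.measure_pos_of_nonempty_interior _ hspan

end OrientedPolyhedron

/-! ### Chains as classes of formal sums -/

variable {G : Type*} [NormedAddCommGroup G] {k : ℕ}

theorem toChain_eq_iff {P Q : FormalSum X G k} :
    P.toChain = Q.toChain ↔ P - Q ∈ relations X G k := by
  rw [FormalSum.toChain, FormalSum.toChain, eq_comm, QuotientAddGroup.eq, neg_add_eq_sub]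

@[simp] theorem toChain_add (P Q : FormalSum X G k) :
    (P + Q).toChain = P.toChain + Q.toChain := rfl

@[simp] theorem toChain_sub (P Q : FormalSum X G k) :
    (P - Q).toChain = P.toChain - Q.toChain := rfl

@[simp] theorem toChain_zero : (0 : FormalSum X G k).toChain = 0 := rfl

theorem toChain_sum {ι : Type*} (s : Finset ι) (F : ι → FormalSum X G k) :
    (∑ i ∈ s, F i : FormalSum X G k).toChain = ∑ i ∈ s, (F i).toChain :=
  map_sum (QuotientAddGroup.mk' (relations X G k)) F s

/-- An additive functional of formal sums that vanishes on the relations up to a filter agrees on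
representatives of one chain up to the filter. -/
theorem eventually_eq_of_toChain_eq {ι H : Type*} [AddCommGroup H] {l : Filter ι}
    (φ : ι → FormalSum X G k →+ H)
    (hφ : ∀ R : FormalSum X G k, Relation R → ∀ᶠ x in l, φ x R = 0)
    {P Q : FormalSum X G k} (h : P.toChain = Q.toChain) : ∀ᶠ x in l, φ x P = φ x Q := by
  have key : ∀ R ∈ relations X G k, ∀ᶠ x in l, φ x R = 0 := by
    intro R hR
    induction hR using AddSubgroup.closure_induction with
    | mem R hR => exact hφ R hR
    | zero => simp
    | add R T _ _ hR hT =>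
      filter_upwards [hR, hT] with x h1 h2
      rw [map_add, h1, h2, add_zero]
    | neg R _ hR =>
      filter_upwards [hR] with x h1
      rw [map_neg, h1, neg_zero]
  filter_upwards [key _ (toChain_eq_iff.1 h)] with x hx
  rwa [map_sub, sub_eq_zero] at hx

/-! ### The density of a chain with respect to a projection -/

/-- `sign a` as an endomorphism of an additive group. -/
noncomputable def signSmul (a : ℝ) (g : G) : G := (SignType.sign a : ℤ) • g

theorem signSmul_of_pos {a : ℝ} (ha : 0 < a) (g : G) : signSmul a g = g := by
  simp [signSmul, sign_pos ha]

theorem signSmul_of_neg {a : ℝ} (ha : a < 0) (g : G) : signSmul a g = -g := by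
  simp [signSmul, sign_neg ha]

@[simp] theorem signSmul_zero_left (g : G) : signSmul 0 g = 0 := by
  simp [signSmul]

@[simp] theorem signSmul_zero (a : ℝ) : signSmul a (0 : G) = 0 := by
  simp [signSmul]

theorem signSmul_add (a : ℝ) (g h : G) : signSmul a (g + h) = signSmul a g + signSmul a h :=
  smul_add _ _ _

theorem signSmul_mul (a b : ℝ) (g : G) : signSmul (a * b) g = signSmul a (signSmul b g) := by
  rw [signSmul, signSmul, signSmul, sign_mul, smul_smul]
  push_cast
  rfl

theorem signSmul_neg (a : ℝ) (g : G) : signSmul a (-g) = -signSmul a g := smul_neg _ _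

theorem enorm_signSmul {a : ℝ} (ha : a ≠ 0) (g : G) : ‖signSmul a g‖ₑ = ‖g‖ₑ := by
  rcases ha.lt_or_gt with h | h
  · rw [signSmul_of_neg h, enorm_neg]
  · rw [signSmul_of_pos h]

theorem enorm_signSmul_le (a : ℝ) (g : G) : ‖signSmul a g‖ₑ ≤ ‖g‖ₑ := by
  rcases eq_or_ne a 0 with rfl | h
  · simp
  · exact (enorm_signSmul h g).le

open Classical in
/-- The value at `x` of the `G`-valued density of a formal sum, where every polyhedron is oriented
by the projection `proj π`. -/
noncomputable def density (π : Fin k → X →L[ℝ] ℝ) (x : X) : FormalSum X G k →+ G :=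
  Finsupp.liftAddHom fun S =>
    { toFun := fun g => if x ∈ S.carrier then signSmul (minor π S.frame) g else 0
      map_zero' := by simp
      map_add' := fun g h => by split_ifs <;> simp [signSmul_add] }

open Classical in
theorem density_apply (π : Fin k → X →L[ℝ] ℝ) (x : X) (P : FormalSum X G k) :
    density π x P =
      P.sum fun S g => if x ∈ S.carrier then signSmul (minor π S.frame) g else 0 := rfl

open Classical in
theorem density_single (π : Fin k → X →L[ℝ] ℝ) (x : X) (S : OrientedPolyhedron X k) (g : G) :
    density π x (Finsupp.single S g) =
      if x ∈ S.carrier then signSmul (minor π S.frame) g else 0 := by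
  rw [density_apply, Finsupp.sum_single_index]
  simp

/-- A change of frame multiplies the minor by its determinant, and only the sign counts. In a union
the overlap has dimension less than `k`, so generic points avoid it. -/
theorem density_eq_zero_of_relation (π : Fin k → X →L[ℝ] ℝ) {R : FormalSum X G k}
    (hR : Relation R) : ∀ᶠ x in generic π, density π x R = 0 := by
  classical
  cases hR with
  | same S T g hc ho =>
    obtain ⟨A, hA, hdet⟩ := ho
    refine Eventually.of_forall fun x => ?_
    rw [map_sub, density_single, density_single, hc, minor_change π hA, signSmul_mul,
      signSmul_of_pos hdet, sub_self]
  | opposite S T g hc ho =>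
    obtain ⟨A, hA, hdet⟩ := ho
    refine Eventually.of_forall fun x => ?_
    rw [map_sub, density_single, density_single, hc, minor_change π hA, signSmul_mul,
      signSmul_of_neg hdet, signSmul_neg, sub_self]
  | union S S₁ S₂ g hc hd h₁ h₂ =>
    obtain ⟨A₁, hA₁, hdet₁⟩ := h₁
    obtain ⟨A₂, hA₂, hdet₂⟩ := h₂
    filter_upwards [OrientedPolyhedron.eventually_notMem_inter hd π] with x hx
    rw [map_sub, map_add, density_single, density_single, density_single, hc,
      minor_change π hA₁, minor_change π hA₂, signSmul_mul, signSmul_mul,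
      signSmul_of_pos hdet₁, signSmul_of_pos hdet₂]
    by_cases h1 : x ∈ S₁.carrier <;> by_cases h2 : x ∈ S₂.carrier
    · exact absurd ⟨h1, h2⟩ hx
    · simp [h1, h2]
    · simp [h1, h2]
    · simp [h1, h2]

theorem density_eq_of_toChain_eq (π : Fin k → X →L[ℝ] ℝ) {P Q : FormalSum X G k}
    (h : P.toChain = Q.toChain) : ∀ᶠ x in generic π, density π x P = density π x Q :=
  eventually_eq_of_toChain_eq _ (fun _ hR => density_eq_zero_of_relation π hR) h

/-! ### Representations with disjoint summands -/

theorem sameOrientation_refl (v : Fin k → X) : SameOrientation v v :=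
  ⟨1, fun j => by simp [Matrix.one_apply], by simp⟩

theorem nonempty_inter_gt {S : Set X} {f : X →L[ℝ] ℝ} {r : ℝ} (h : ¬S ⊆ {x | f x ≤ r}) :
    (S ∩ {x | (-f) x < -r}).Nonempty := by
  obtain ⟨x, hx, hxr⟩ := not_subset.1 h
  exact ⟨x, hx, by simpa using hxr⟩

theorem nonempty_inter_lt {S : Set X} {f : X →L[ℝ] ℝ} {r : ℝ} (h : ¬S ⊆ {x | r ≤ f x}) :
    (S ∩ {x | f x < r}).Nonempty := by
  obtain ⟨x, hx, hxr⟩ := not_subset.1 h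
  exact ⟨x, hx, by simpa using hxr⟩

/-- Cutting a simple chain along a hyperplane that crosses it. -/
theorem toChain_single_cut (S : OrientedPolyhedron X k) (f : X →L[ℝ] ℝ) (r : ℝ) (g : G)
    (h₁ : (S.carrier ∩ {x | f x < r}).Nonempty)
    (h₂ : (S.carrier ∩ {x | (-f) x < -r}).Nonempty) :
    FormalSum.toChain (Finsupp.single S g) =
      FormalSum.toChain
        (Finsupp.single (cut S f r h₁) g + Finsupp.single (cut S (-f) (-r) h₂) g) := by
  rw [toChain_eq_iff]
  refine AddSubgroup.subset_closure (Relation.union S _ _ g ?_ ?_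
    (sameOrientation_refl _) (sameOrientation_refl _))
  · ext x
    simp only [cut, mem_union, mem_inter_iff, mem_ofPred_eq, neg_apply, neg_le_neg_iff]
    rw [← and_or_left]
    simp [le_total]
  · rw [disjoint_left]
    intro x hx hx'
    obtain ⟨z, hz, hzr⟩ := h₁
    replace hzr : f z < r := hzr
    have hxr : r ≤ f x := by
      -- A relative interior point of the lower part with `f ≥ r` would force `f = r` on that whole
      -- part, against the choice of `z`.
      have := (intrinsicInterior_subset hx').2
      simpa using this
    exact hzr.ne (apply_eq_of_mem_intrinsicInterior hx (fun z hz => hz.2) hxr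
      ⟨hz, hzr.le⟩)

/-- `T` is cut out of its affine span by hyperplanes from `H`. -/
def CutOutBy (H : Finset ((X →L[ℝ] ℝ) × ℝ)) (T : Set X) : Prop :=
  ∀ x ∈ affineSpan ℝ T, (∀ p ∈ H, (T ⊆ {z | p.1 z ≤ p.2} → p.1 x ≤ p.2) ∧
    (T ⊆ {z | p.2 ≤ p.1 z} → p.2 ≤ p.1 x)) → x ∈ T

/-- `T` lies on one side of the hyperplane `p`. -/
def IsSided (p : (X →L[ℝ] ℝ) × ℝ) (T : Set X) : Prop :=
  T ⊆ {z | p.1 z ≤ p.2} ∨ T ⊆ {z | p.2 ≤ p.1 z}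

theorem IsSided.mono {p : (X →L[ℝ] ℝ) × ℝ} {S T : Set X} (h : IsSided p S) (hT : T ⊆ S) :
    IsSided p T := h.imp hT.trans hT.trans

theorem CutOutBy.inter_left {H : Finset ((X →L[ℝ] ℝ) × ℝ)} {S : Set X} (hS : CutOutBy H S)
    {p : (X →L[ℝ] ℝ) × ℝ} (hp : p ∈ H) : CutOutBy H (S ∩ {x | p.1 x ≤ p.2}) := by
  intro x hx h
  refine ⟨hS x (affineSpan_mono ℝ inter_subset_left hx) fun q hq => ?_,
    (h p hp).1 inter_subset_right⟩
  exact ⟨fun hs => (h q hq).1 (inter_subset_left.trans hs),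
    fun hs => (h q hq).2 (inter_subset_left.trans hs)⟩

theorem CutOutBy.inter_right {H : Finset ((X →L[ℝ] ℝ) × ℝ)} {S : Set X} (hS : CutOutBy H S)
    {p : (X →L[ℝ] ℝ) × ℝ} (hp : p ∈ H) : CutOutBy H (S ∩ {x | p.2 ≤ p.1 x}) := by
  intro x hx h
  refine ⟨hS x (affineSpan_mono ℝ inter_subset_left hx) fun q hq => ?_,
    (h p hp).2 inter_subset_right⟩
  exact ⟨fun hs => (h q hq).1 (inter_subset_left.trans hs),
    fun hs => (h q hq).2 (inter_subset_left.trans hs)⟩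

/-- Subdivision of a simple chain by finitely many hyperplanes. -/
theorem exists_subdivision (H H' : Finset ((X →L[ℝ] ℝ) × ℝ)) (hH : H' ⊆ H)
    (S : OrientedPolyhedron X k) (hS : CutOutBy H S.carrier) (g : G) :
    ∃ Q : FormalSum X G k, Q.toChain = FormalSum.toChain (Finsupp.single S g) ∧ ∀ T ∈ Q.support,
      T.carrier ⊆ S.carrier ∧ CutOutBy H T.carrier ∧ ∀ p ∈ H', IsSided p T.carrier := by
  classical
  -- `H` stays fixed, so that `CutOutBy H` survives every cut; only the set `H'` of hyperplanes
  -- already taken care of grows.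
  induction H' using Finset.induction_on generalizing S with
  | empty =>
    refine ⟨Finsupp.single S g, rfl, fun T hT => ?_⟩
    rw [Finset.mem_singleton.1 (Finsupp.support_single_subset hT)]
    exact ⟨subset_rfl, hS, by simp⟩
  | insert p H' _ ih =>
    have hp : p ∈ H := hH (Finset.mem_insert_self _ _)
    replace ih := fun S hS => ih ((Finset.subset_insert _ _).trans hH) S hS
    by_cases hs : IsSided p S.carrier
    · obtain ⟨Q, hQ, hT⟩ := ih S hS
      refine ⟨Q, hQ, fun T hTQ => ⟨(hT T hTQ).1, (hT T hTQ).2.1, fun q hq => ?_⟩⟩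
      rcases Finset.mem_insert.1 hq with rfl | hq
      · exact hs.mono (hT T hTQ).1
      · exact (hT T hTQ).2.2 q hq
    · rw [IsSided, not_or] at hs
      have h₁ := nonempty_inter_lt hs.2
      have h₂ := nonempty_inter_gt hs.1
      have hc₂ : (cut S (-p.1) (-p.2) h₂).carrier = S.carrier ∩ {x | p.2 ≤ p.1 x} := by
        simp [cut]
      obtain ⟨Q₁, hQ₁, hT₁⟩ := ih (cut S p.1 p.2 h₁) (hS.inter_left hp)
      obtain ⟨Q₂, hQ₂, hT₂⟩ := ih (cut S (-p.1) (-p.2) h₂) (hc₂ ▸ hS.inter_right hp)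
      refine ⟨Q₁ + Q₂, ?_, fun T hT => ?_⟩
      · rw [toChain_single_cut S p.1 p.2 g h₁ h₂, toChain_add, toChain_add, hQ₁, hQ₂]
      · rcases Finset.mem_union.1 (Finsupp.support_add hT) with h | h
        · obtain ⟨a, b, c⟩ := hT₁ T h
          refine ⟨a.trans inter_subset_left, b, fun q hq => ?_⟩
          rcases Finset.mem_insert.1 hq with rfl | hq
          · exact Or.inl (a.trans inter_subset_right)
          · exact c q hq
        · obtain ⟨a, b, c⟩ := hT₂ T h
          rw [hc₂] at a
          refine ⟨a.trans inter_subset_left, b, fun q hq => ?_⟩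
          rcases Finset.mem_insert.1 hq with rfl | hq
          · exact Or.inr (a.trans inter_subset_right)
          · exact c q hq

/-- Cells of a hyperplane arrangement with a common relative interior point lie on the same sides
of all hyperplanes. -/
theorem subset_of_mem_intrinsicInterior {p : (X →L[ℝ] ℝ) × ℝ} {T T' : Set X} {x : X}
    (hx : x ∈ T) (hx' : x ∈ intrinsicInterior ℝ T') (hT' : IsSided p T') :
    (T ⊆ {z | p.1 z ≤ p.2} → T' ⊆ {z | p.1 z ≤ p.2}) ∧
      (T ⊆ {z | p.2 ≤ p.1 z} → T' ⊆ {z | p.2 ≤ p.1 z}) := by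
  constructor
  · intro hT
    refine hT'.elim id fun h z hz => ?_
    have := apply_eq_of_mem_intrinsicInterior hx' (f := -p.1) (c := -p.2)
      (fun z hz => by simpa using h hz) (by simpa using hT hx) hz
    simp only [neg_apply, neg_inj] at this
    exact this.le
  · intro hT
    refine hT'.elim (fun h z hz => ?_) id
    exact (apply_eq_of_mem_intrinsicInterior hx' h (hT hx) hz).ge

/-- Hahn–Banach separates `x` from the closed set `A`, and a functional bounded below on an affine
subspace is constant there. -/
theorem exists_hyperplane_of_notMem {A : AffineSubspace ℝ X} [FiniteDimensional ℝ A.direction]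
    {a x : X} (ha : a ∈ A) (hx : x ∉ A) :
    ∃ p : (X →L[ℝ] ℝ) × ℝ, (∀ z ∈ A, p.1 z = p.2) ∧ p.1 x ≠ p.2 := by
  obtain ⟨f, u, hfx, hfA⟩ := geometric_hahn_banach_point_closed A.convex
    A.closed_of_finiteDimensional hx
  refine ⟨(f, f a), fun z hz => ?_, (hfx.trans (hfA a ha)).ne⟩
  by_contra hne
  have hmem := AffineMap.lineMap_mem ((u - f a) / (f z - f a)) ha hz
  have := hfA _ hmem
  simp only [AffineMap.lineMap_apply, vsub_eq_sub, vadd_eq_add, map_add, map_smul, map_sub,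
    smul_eq_mul] at this
  rw [div_mul_cancel₀ _ (sub_ne_zero.2 hne)] at this
  linarith

theorem exists_separating_hyperplane {S T : OrientedPolyhedron X k}
    (h : affineSpan ℝ S.carrier ≠ affineSpan ℝ T.carrier) :
    ∃ p : (X →L[ℝ] ℝ) × ℝ, (∀ z ∈ T.carrier, p.1 z = p.2) ∧ ∃ z ∈ S.carrier, p.1 z ≠ p.2 := by
  by_contra hcon
  push Not at hcon
  refine h ?_
  have hsub : S.carrier ⊆ affineSpan ℝ T.carrier := by
    intro x hx
    by_contra hxT
    obtain ⟨a, ha⟩ := T.nonempty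
    have : FiniteDimensional ℝ (affineSpan ℝ T.carrier).direction := by
      rw [direction_affineSpan]
      exact T.finiteDimensional
    obtain ⟨p, hp, hpx⟩ := exists_hyperplane_of_notMem (subset_affineSpan ℝ _ ha) hxT
    exact hpx (hcon p (fun z hz => hp z (subset_affineSpan ℝ _ hz)) x hx)
  have hle : affineSpan ℝ S.carrier ≤ affineSpan ℝ T.carrier := affineSpan_le.2 hsub
  have := T.finiteDimensional
  refine AffineSubspace.eq_of_direction_eq_of_nonempty_of_le ?_ (S.nonempty.affineSpan ℝ) hle
  have hd := AffineSubspace.direction_le hle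
  rw [direction_affineSpan, direction_affineSpan] at hd ⊢
  exact Submodule.eq_of_le_of_finrank_le hd
    (by rw [S.finrank_vectorSpan, T.finrank_vectorSpan])

/-- All summands are cut by the hyperplanes of all their constraints, and by hyperplanes that tell
different affine spans apart. Cells with a common relative interior point lie on the same sides of
all these hyperplanes and span the same affine subspace, hence coincide. -/
theorem exists_cells (P : FormalSum X G k) :
    ∃ Q : FormalSum X G k, Q.toChain = P.toChain ∧ ∀ T ∈ Q.support, ∀ T' ∈ Q.support,
      T.carrier = T'.carrier ∨
        Disjoint (intrinsicInterior ℝ T.carrier) (intrinsicInterior ℝ T'.carrier) := by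
  classical
  choose A L hA hL using fun S : OrientedPolyhedron X k => S.isPolyhedron.2
  have hsep : ∀ S T : OrientedPolyhedron X k, ∃ p : (X →L[ℝ] ℝ) × ℝ,
      affineSpan ℝ S.carrier ≠ affineSpan ℝ T.carrier →
        (∀ z ∈ T.carrier, p.1 z = p.2) ∧ ∃ z ∈ S.carrier, p.1 z ≠ p.2 := by
    intro S T
    by_cases h : affineSpan ℝ S.carrier = affineSpan ℝ T.carrier
    · exact ⟨0, fun h' => absurd h h'⟩
    · exact (exists_separating_hyperplane h).imp fun _ hp _ => hp
  choose q hq using hsep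
  let H : Finset ((X →L[ℝ] ℝ) × ℝ) :=
    P.support.biUnion L ∪ (P.support ×ˢ P.support).image fun ST => q ST.1 ST.2
  have hcut : ∀ S ∈ P.support, CutOutBy H S.carrier := by
    intro S hS x hx h
    rw [hL S]
    refine ⟨?_, fun p hp => ?_⟩
    · have : affineSpan ℝ S.carrier ≤ A S :=
        affineSpan_le.2 fun y hy => by rw [hL S] at hy; exact hy.1
      exact this hx
    · refine (h p (Finset.mem_union_left _ (Finset.mem_biUnion.2 ⟨S, hS, hp⟩))).1 fun z hz => ?_
      rw [hL S] at hz
      exact hz.2 p hp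
  have hsub : ∀ S : OrientedPolyhedron X k, ∃ Q : FormalSum X G k, S ∈ P.support →
      Q.toChain = FormalSum.toChain (Finsupp.single S (P S)) ∧ ∀ T ∈ Q.support,
        T.carrier ⊆ S.carrier ∧ CutOutBy H T.carrier ∧ ∀ p ∈ H, IsSided p T.carrier := by
    intro S
    by_cases hS : S ∈ P.support
    · obtain ⟨Q, hQ⟩ := exists_subdivision H H subset_rfl S (hcut S hS) (P S)
      exact ⟨Q, fun _ => hQ⟩
    · exact ⟨0, fun h => absurd h hS⟩
  choose Q hQ using hsub
  refine ⟨∑ S ∈ P.support, Q S, ?_, ?_⟩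
  · rw [toChain_sum, Finset.sum_congr rfl fun S hS => (hQ S hS).1, ← toChain_sum]
    congr 1
    exact P.sum_single
  · have hmem : ∀ T ∈ (∑ S ∈ P.support, Q S : FormalSum X G k).support,
        ∃ S ∈ P.support, T.carrier ⊆ S.carrier ∧ CutOutBy H T.carrier ∧
          ∀ p ∈ H, IsSided p T.carrier := by
      intro T hT
      obtain ⟨S, hS, hTS⟩ := Finset.mem_biUnion.1 (Finsupp.support_finsetSum hT)
      exact ⟨S, hS, (hQ S hS).2 T hTS⟩
    intro T hT T' hT'
    obtain ⟨S, hS, hTS, hTc, hTs⟩ := hmem T hT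
    obtain ⟨S', hS', hTS', hTc', hTs'⟩ := hmem T' hT'
    rw [or_iff_not_imp_right, not_disjoint_iff]
    rintro ⟨x, hx, hx'⟩
    have hside := fun p hp =>
      subset_of_mem_intrinsicInterior (intrinsicInterior_subset hx) hx' (hTs' p hp)
    have hside' := fun p hp =>
      subset_of_mem_intrinsicInterior (intrinsicInterior_subset hx') hx (hTs p hp)
    have haff : affineSpan ℝ T.carrier = affineSpan ℝ S.carrier :=
      OrientedPolyhedron.affineSpan_eq_of_subset T.nonempty hTS T.finrank_vectorSpan.ge
    have haff' : affineSpan ℝ T'.carrier = affineSpan ℝ S'.carrier :=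
      OrientedPolyhedron.affineSpan_eq_of_subset T'.nonempty hTS' T'.finrank_vectorSpan.ge
    -- Otherwise a hyperplane in `H` contains `S'`, hence `T'`, hence by the equality of sides also
    -- `T` and the span of `S`; but it was chosen not to contain `S`.
    have haffS : affineSpan ℝ S.carrier = affineSpan ℝ S'.carrier := by
      by_contra hne
      obtain ⟨h1, z, hz, hzne⟩ := hq S S' hne
      have hqH : q S S' ∈ H := Finset.mem_union_right _
        (Finset.mem_image.2 ⟨(S, S'), Finset.mem_product.2 ⟨hS, hS'⟩, rfl⟩)
      have h2 := (hside' _ hqH).1 fun z hz => (h1 z (hTS' hz)).le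
      have h3 := (hside' _ hqH).2 fun z hz => (h1 z (hTS' hz)).ge
      refine hzne (apply_eq_of_mem_affineSpan (S := T.carrier)
        (fun y hy => le_antisymm (h2 hy) (h3 hy)) ?_)
      rw [haff]
      exact subset_affineSpan ℝ _ hz
    refine Subset.antisymm (fun z hz => ?_) (fun z hz => ?_)
    · refine hTc' z ?_ fun p hp => ⟨fun h => (hside' p hp).1 h hz, fun h => (hside' p hp).2 h hz⟩
      rw [haff', ← haffS, ← haff]
      exact subset_affineSpan ℝ _ hz
    · refine hTc z ?_ fun p hp => ⟨fun h => (hside p hp).1 h hz, fun h => (hside p hp).2 h hz⟩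
      rw [haff, haffS, ← haff']
      exact subset_affineSpan ℝ _ hz

/-- Frames of one carrier differ by an invertible matrix; the sign of its determinant decides
between `g` and `-g`. -/
theorem exists_toChain_single_eq {S T : OrientedPolyhedron X k} (h : S.carrier = T.carrier)
    (g : G) : ∃ g' : G,
      FormalSum.toChain (Finsupp.single S g) = FormalSum.toChain (Finsupp.single T g') := by
  obtain ⟨A, hA, hdet⟩ := exists_change_of_frame T.linearIndependent (v := S.frame) fun j => by
    rw [S.span_frame, h, ← T.span_frame]
    exact Submodule.subset_span ⟨j, rfl⟩
  rcases hdet.lt_or_gt with hdet | hdet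
  · refine ⟨-g, ?_⟩
    rw [toChain_eq_iff]
    have := Relation.opposite (G := G) S T (-g) h ⟨A, hA, hdet⟩
    rw [neg_neg] at this
    exact AddSubgroup.subset_closure this
  · refine ⟨g, ?_⟩
    rw [toChain_eq_iff]
    exact AddSubgroup.subset_closure (Relation.same S T g h ⟨A, hA, hdet⟩)

/-- Every chain has a representation with disjoint summands. -/
theorem exists_isDisjointSum (P : FormalSum X G k) :
    ∃ Q : FormalSum X G k, IsDisjointSum Q ∧ Q.toChain = P.toChain := by
  classical
  obtain ⟨Q, hQP, hQ⟩ := exists_cells P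
  -- One oriented representative is fixed for each carrier, so that coinciding cells merge into a
  -- single summand.
  have hrep : ∀ s : Set X, ∃ T : OrientedPolyhedron X k → OrientedPolyhedron X k,
      ∀ S, S.carrier = s → (T S).carrier = s ∧ ∀ S', S'.carrier = s → T S = T S' := by
    intro s
    by_cases h : ∃ S : OrientedPolyhedron X k, S.carrier = s
    · obtain ⟨S, hS⟩ := h
      exact ⟨fun _ => S, fun _ _ => ⟨hS, fun _ _ => rfl⟩⟩
    · exact ⟨id, fun S hS => absurd ⟨S, hS⟩ h⟩
  choose rep hrep using hrep
  let c : OrientedPolyhedron X k → OrientedPolyhedron X k := fun S => rep S.carrier S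
  have hc : ∀ S, S.carrier = (c S).carrier := fun S => ((hrep _ S rfl).1).symm
  have hc' : ∀ S S', S.carrier = S'.carrier → c S = c S' := fun S S' h => by
    have := (hrep _ S rfl).2 S' h.symm
    simpa [c, h] using this
  choose γ hγ using fun S : OrientedPolyhedron X k => exists_toChain_single_eq (hc S) (Q S)
  refine ⟨∑ S ∈ Q.support, Finsupp.single (c S) (γ S), ?_, ?_⟩
  · intro S hS T hT hST
    have hmem : ∀ S ∈ (∑ S ∈ Q.support, Finsupp.single (c S) (γ S)).support,
        ∃ S' ∈ Q.support, S = c S' := by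
      intro S hS
      obtain ⟨S', hS', h⟩ := Finset.mem_biUnion.1 (Finsupp.support_finsetSum hS)
      exact ⟨S', hS', Finset.mem_singleton.1 (Finsupp.support_single_subset h)⟩
    obtain ⟨S', hS', rfl⟩ := hmem S hS
    obtain ⟨T', hT', rfl⟩ := hmem T hT
    rw [← hc, ← hc]
    exact (hQ S' hS' T' hT').resolve_left fun h => hST (hc' _ _ h)
  · rw [← hQP]
    rw [toChain_sum, ← Finset.sum_congr rfl fun S _ => hγ S, ← toChain_sum]
    congr 1
    exact Q.sum_single

/-- A chain is determined by its densities. -/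
theorem toChain_eq_of_density_eq {P Q : FormalSum X G k}
    (h : ∀ π : Fin k → X →L[ℝ] ℝ, ∀ᶠ x in generic π, density π x P = density π x Q) :
    P.toChain = Q.toChain := by
  classical
  -- If a summand `S` were left in a disjoint representation of the difference, choose `π`
  -- nondegenerate on `S`. At generic points of `S` no other summand contributes, so the density is
  -- the nonzero coefficient of `S`, although it vanishes generically and `S` has an image of
  -- positive measure.
  obtain ⟨R, hR, hRPQ⟩ := exists_isDisjointSum (P - Q)
  suffices R = 0 by
    rw [this, toChain_zero, toChain_sub, eq_comm, sub_eq_zero] at hRPQ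
    exact hRPQ
  by_contra hne
  obtain ⟨S, hS⟩ := Finsupp.support_nonempty_iff.2 hne
  obtain ⟨π, hπ⟩ := exists_minor_eq_one S.linearIndependent
  have hinter : ∀ᶠ x in generic π, ∀ T ∈ R.support, T ≠ S → x ∉ S.carrier ∩ T.carrier := by
    rw [Filter.eventually_all_finset]
    intro T hT
    by_cases hTS : T = S
    · simp [hTS]
    · filter_upwards [OrientedPolyhedron.eventually_notMem_inter (hR hS hT (Ne.symm hTS)) π]
        with x hx _ using hx
  have hzero : ∀ᶠ x in generic π, x ∉ S.carrier := by
    filter_upwards [hinter, h π, density_eq_of_toChain_eq π hRPQ] with x h1 h2 h3 hxS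
    rw [map_sub, h2, sub_self, density_apply, Finsupp.sum,
      Finset.sum_eq_single_of_mem S hS, if_pos hxS, hπ, signSmul_of_pos one_pos] at h3
    · exact Finsupp.mem_support_iff.1 hS h3
    · intro T hT hTS
      exact if_neg fun hxT => h1 T hT hTS ⟨hxS, hxT⟩
  rw [eventually_notMem_generic] at hzero
  exact (S.volume_proj_image_pos (by rw [hπ]; exact one_ne_zero)).ne' hzero

/-! ### Germs of polyhedra along a direction -/

/-- The set `S` contains an initial piece of the ray from `x` in the direction `d`. -/
def HasGerm (S : Set X) (x d : X) : Prop := ∀ᶠ t in 𝓝[>] (0 : ℝ), x + t • d ∈ S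

/-- Closedness puts `x` in `S`, and convexity then fills in the segment to a single point of `S` on
the ray. -/
theorem hasGerm_of_frequently {S : Set X} (hS : Convex ℝ S) (hcl : IsClosed S) {x d : X}
    (h : ∃ᶠ t in 𝓝[>] (0 : ℝ), x + t • d ∈ S) : x ∈ S ∧ HasGerm S x d := by
  have hx : x ∈ S := by
    have hlim : Tendsto (fun t : ℝ => x + t • d) (𝓝[>] 0) (𝓝 x) := by
      have : Continuous fun t : ℝ => x + t • d := by fun_prop
      simpa using (this.tendsto 0).mono_left nhdsWithin_le_nhds
    exact hcl.closure_subset (mem_closure_of_frequently_of_tendsto h hlim)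
  refine ⟨hx, ?_⟩
  obtain ⟨t, ht, ht0⟩ := (h.and_eventually self_mem_nhdsWithin).exists
  replace ht0 : 0 < t := ht0
  filter_upwards [Ioo_mem_nhdsGT ht0] with s hs
  have := hS.add_smul_mem hx ht (t := s / t) ⟨(div_pos hs.1 ht0).le, (div_le_one ht0).2 hs.2.le⟩
  rwa [smul_smul, div_mul_cancel₀ _ ht0.ne'] at this

theorem hasGerm_iff {S : Set X} (hS : Convex ℝ S) (hcl : IsClosed S) {x d : X} :
    HasGerm S x d ↔ x ∈ S ∧ ∃ t : ℝ, 0 < t ∧ x + t • d ∈ S := by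
  constructor
  · intro h
    obtain ⟨t, ht, ht0⟩ := (h.and self_mem_nhdsWithin).exists
    exact ⟨(hasGerm_of_frequently hS hcl h.frequently).1, t, ht0, ht⟩
  · rintro ⟨hx, t, ht0, ht⟩
    filter_upwards [Ioo_mem_nhdsGT ht0] with s hs
    have := hS.add_smul_mem hx ht (t := s / t) ⟨(div_pos hs.1 ht0).le, (div_le_one ht0).2 hs.2.le⟩
    rwa [smul_smul, div_mul_cancel₀ _ ht0.ne'] at this

theorem hasGerm_smul_iff {S : Set X} (hS : Convex ℝ S) (hcl : IsClosed S) {x d : X} {c : ℝ}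
    (hc : 0 < c) : HasGerm S x (c • d) ↔ HasGerm S x d := by
  rw [hasGerm_iff hS hcl, hasGerm_iff hS hcl]
  refine and_congr_right fun _ => ⟨?_, ?_⟩
  · rintro ⟨t, ht0, ht⟩
    exact ⟨t * c, mul_pos ht0 hc, by rwa [← smul_smul]⟩
  · rintro ⟨t, ht0, ht⟩
    exact ⟨t / c, div_pos ht0 hc, by rwa [smul_smul, div_mul_cancel₀ _ hc.ne']⟩

theorem hasGerm_union_iff {S T : Set X} (hS : Convex ℝ S) (hScl : IsClosed S)
    (hT : Convex ℝ T) (hTcl : IsClosed T) {x d : X} :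
    HasGerm (S ∪ T) x d ↔ HasGerm S x d ∨ HasGerm T x d := by
  constructor
  · intro h
    have : ∃ᶠ t in 𝓝[>] (0 : ℝ), x + t • d ∈ S ∨ x + t • d ∈ T := Eventually.frequently h
    rw [frequently_or_distrib] at this
    exact this.imp (fun h => (hasGerm_of_frequently hS hScl h).2)
      fun h => (hasGerm_of_frequently hT hTcl h).2
  · rintro (h | h)
    · exact h.mono fun t ht => Or.inl ht
    · exact h.mono fun t ht => Or.inr ht

theorem HasGerm.mem_vectorSpan {S : Set X} {x d : X} (h : HasGerm S x d) :
    d ∈ vectorSpan ℝ S := by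
  -- The points with parameters `t` and `2 * t` both lie in `S` and differ by `t • d`.
  have h2 : ∀ᶠ t in 𝓝[>] (0 : ℝ), x + (2 * t) • d ∈ S := by
    have hlim : Tendsto (fun t : ℝ => 2 * t) (𝓝[>] 0) (𝓝[>] 0) := by
      refine tendsto_nhdsWithin_iff.2 ⟨?_, ?_⟩
      · have : Continuous fun t : ℝ => 2 * t := by fun_prop
        simpa using (this.tendsto 0).mono_left nhdsWithin_le_nhds
      · filter_upwards [self_mem_nhdsWithin] with t (ht : 0 < t)
        exact mul_pos two_pos ht
    exact hlim.eventually h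
  obtain ⟨t, ⟨ht1, ht2⟩, ht0⟩ := ((h.and h2).and self_mem_nhdsWithin).exists
  have := vsub_mem_vectorSpan ℝ ht2 ht1
  have heq : (x + (2 * t) • d) -ᵥ (x + t • d) = t • d := by
    rw [vsub_eq_sub, two_mul, add_smul]
    abel
  rw [heq] at this
  exact (Submodule.smul_mem_iff _ (ne_of_gt ht0)).1 this

/-- Directions into a polyhedron. -/
theorem hasGerm_of_constraints {A : AffineSubspace ℝ X} {L : Finset ((X →L[ℝ] ℝ) × ℝ)}
    {S : Set X} (hS : S = {x | x ∈ A ∧ ∀ p ∈ L, p.1 x ≤ p.2}) {x w : X} (hx : x ∈ S)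
    (hw : w ∈ vectorSpan ℝ S) (h : ∀ p ∈ L, p.1 x = p.2 → p.1 w ≤ 0) : HasGerm S x w := by
  have hxS := hx
  rw [hS] at hxS
  have h1 : ∀ᶠ t in 𝓝[>] (0 : ℝ), ∀ p ∈ L, p.1 (x + t • w) ≤ p.2 := by
    rw [Filter.eventually_all_finset]
    intro p hp
    by_cases hpx : p.1 x = p.2
    · filter_upwards [self_mem_nhdsWithin] with t (ht : 0 < t)
      have := h p hp hpx
      simp only [map_add, map_smul, smul_eq_mul]
      nlinarith
    · have hcont : Continuous fun t : ℝ => p.1 (x + t • w) := by fun_prop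
      have : ∀ᶠ t in 𝓝 (0 : ℝ), p.1 (x + t • w) < p.2 :=
        hcont.continuousAt.eventually_lt continuousAt_const
          (by simpa using lt_of_le_of_ne (hxS.2 p hp) hpx)
      exact (this.filter_mono nhdsWithin_le_nhds).mono fun t ht => ht.le
  filter_upwards [h1] with t ht
  rw [hS]
  refine ⟨?_, ht⟩
  have hwA : w ∈ A.direction := by
    have : vectorSpan ℝ S ≤ A.direction :=
      vectorSpan_mono ℝ fun z hz => by rw [hS] at hz; exact hz.1
    exact this hw
  have := AffineSubspace.vadd_mem_of_mem_direction (A.direction.smul_mem t hwA) hxS.1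
  simpa [add_comm] using this

theorem hasGerm_inter_le_of_lt {S : Set X} {f : X →L[ℝ] ℝ} {r : ℝ} {x d : X} (hx : f x < r) :
    HasGerm (S ∩ {z | f z ≤ r}) x d ↔ HasGerm S x d := by
  refine ⟨fun h => h.mono fun t ht => ht.1, fun h => ?_⟩
  have hcont : Continuous fun t : ℝ => f (x + t • d) := by fun_prop
  have : ∀ᶠ t in 𝓝 (0 : ℝ), f (x + t • d) < r :=
    hcont.continuousAt.eventually_lt continuousAt_const (by simpa using hx)
  filter_upwards [h, this.filter_mono nhdsWithin_le_nhds] with t h1 h2 using ⟨h1, h2.le⟩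

theorem hasGerm_inter_le_of_eq {S : Set X} {f : X →L[ℝ] ℝ} {r : ℝ} {x d : X} (hx : f x = r) :
    HasGerm (S ∩ {z | f z ≤ r}) x d ↔ HasGerm S x d ∧ f d ≤ 0 := by
  constructor
  · intro h
    refine ⟨h.mono fun t ht => ht.1, ?_⟩
    obtain ⟨t, ht, ht0⟩ := (h.and self_mem_nhdsWithin).exists
    replace ht0 : 0 < t := ht0
    have h1 : f (x + t • d) ≤ r := ht.2
    simp only [map_add, map_smul, smul_eq_mul, hx] at h1
    by_contra hcon
    push Not at hcon
    have := mul_pos ht0 hcon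
    linarith
  · rintro ⟨h, hd⟩
    filter_upwards [h, self_mem_nhdsWithin] with t h1 (ht0 : 0 < t)
    refine ⟨h1, ?_⟩
    simp only [mem_ofPred_eq, map_add, map_smul, smul_eq_mul, hx]
    nlinarith

/-! ### The density of the boundary -/

open Classical in
/-- The value at `x` of the density of the boundary of a formal sum, read off from the fibres of
`proj π`: every fibre is a segment, which contributes its two end points. -/
noncomputable def fiberDensity (π : Fin k → X →L[ℝ] ℝ) (x : X) : FormalSum X G (k + 1) →+ G :=
  Finsupp.liftAddHom fun S =>
    { toFun := fun g => (if HasGerm S.carrier x (-fiberDir π S.frame) then g else 0) -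
        if HasGerm S.carrier x (fiberDir π S.frame) then g else 0
      map_zero' := by simp
      map_add' := fun g h => by
        split_ifs <;> simp
        abel }

open Classical in
theorem fiberDensity_apply (π : Fin k → X →L[ℝ] ℝ) (x : X) (P : FormalSum X G (k + 1)) :
    fiberDensity π x P = P.sum fun S g =>
      (if HasGerm S.carrier x (-fiberDir π S.frame) then g else 0) -
        if HasGerm S.carrier x (fiberDir π S.frame) then g else 0 := rfl

open Classical in
theorem fiberDensity_single (π : Fin k → X →L[ℝ] ℝ) (x : X) (S : OrientedPolyhedron X (k + 1))
    (g : G) : fiberDensity π x (Finsupp.single S g) =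
      (if HasGerm S.carrier x (-fiberDir π S.frame) then g else 0) -
        if HasGerm S.carrier x (fiberDir π S.frame) then g else 0 := by
  rw [fiberDensity_apply, Finsupp.sum_single_index]
  simp

theorem OrientedPolyhedron.isClosed (S : OrientedPolyhedron X k) : IsClosed S.carrier :=
  S.isPolyhedron.isClosed

theorem OrientedPolyhedron.hasGerm_smul_iff (S : OrientedPolyhedron X k) {x d : X} {c : ℝ}
    (hc : 0 < c) : HasGerm S.carrier x (c • d) ↔ HasGerm S.carrier x d :=
  FlatChains.hasGerm_smul_iff S.convex S.isClosed hc

/-- The intersection has dimension at most `k`. A germ puts `d` among its directions, and `proj π`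
collapses `d`, so the image is null. -/
theorem eventually_not_hasGerm_inter {S T : OrientedPolyhedron X (k + 1)}
    (h : Disjoint (intrinsicInterior ℝ S.carrier) (intrinsicInterior ℝ T.carrier))
    (π : Fin k → X →L[ℝ] ℝ) {d : X} (hd : d ≠ 0) (hπ : proj π d = 0) :
    ∀ᶠ x in generic π, ¬HasGerm (S.carrier ∩ T.carrier) x d := by
  by_cases hmem : d ∈ vectorSpan ℝ (S.carrier ∩ T.carrier)
  · have hpoly := S.isPolyhedron.inter T.isPolyhedron
    have := hpoly.finiteDimensional
    rcases (S.carrier ∩ T.carrier).eq_empty_or_nonempty with he | hne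
    · rw [he, vectorSpan_empty, Submodule.mem_bot] at hmem
      exact absurd hmem hd
    · have hfin := OrientedPolyhedron.finrank_inter_lt h hne
      have hnull := volume_proj_image_eq_zero_of_mem (Nat.lt_succ_iff.1 hfin) hmem hd hπ
      filter_upwards [eventually_notMem_generic.2 hnull] with x hx hg
      exact hx ((hasGerm_iff hpoly.convex hpoly.isClosed).1 hg).1
  · exact Eventually.of_forall fun x hx => hmem hx.mem_vectorSpan

/-- A change of frame multiplies `fiberDir` by its determinant; a negative factor interchanges the
two terms. Germs are additive on unions because generic points have no germ in the overlap. -/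
theorem fiberDensity_eq_zero_of_relation (π : Fin k → X →L[ℝ] ℝ) {R : FormalSum X G (k + 1)}
    (hR : Relation R) : ∀ᶠ x in generic π, fiberDensity π x R = 0 := by
  classical
  cases hR with
  | same S T g hc ho =>
    obtain ⟨A, hA, hdet⟩ := ho
    refine Eventually.of_forall fun x => ?_
    rw [map_sub, fiberDensity_single, fiberDensity_single, fiberDir_change π hA, ← smul_neg,
      T.hasGerm_smul_iff hdet, T.hasGerm_smul_iff hdet, hc, sub_self]
  | opposite S T g hc ho =>
    obtain ⟨A, hA, hdet⟩ := ho
    refine Eventually.of_forall fun x => ?_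
    have h1 : HasGerm T.carrier x (-(A.det • fiberDir π S.frame)) ↔
        HasGerm S.carrier x (fiberDir π S.frame) := by
      rw [← neg_smul, T.hasGerm_smul_iff (neg_pos.2 hdet), hc]
    have h2 : HasGerm T.carrier x (A.det • fiberDir π S.frame) ↔
        HasGerm S.carrier x (-fiberDir π S.frame) := by
      rw [← neg_smul_neg, T.hasGerm_smul_iff (neg_pos.2 hdet), hc]
    rw [map_sub, fiberDensity_single, fiberDensity_single, fiberDir_change π hA, h1, h2]
    split_ifs <;> simp
  | union S S₁ S₂ g hc hd h₁ h₂ =>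
    obtain ⟨A₁, hA₁, hdet₁⟩ := h₁
    obtain ⟨A₂, hA₂, hdet₂⟩ := h₂
    have hexp : ∀ x, fiberDensity π x
        (Finsupp.single S g - (Finsupp.single S₁ g + Finsupp.single S₂ g)) =
        ((if HasGerm (S₁.carrier ∪ S₂.carrier) x (-fiberDir π S.frame) then g else 0) -
        if HasGerm (S₁.carrier ∪ S₂.carrier) x (fiberDir π S.frame) then g else 0) -
        (((if HasGerm S₁.carrier x (-fiberDir π S.frame) then g else 0) -
        if HasGerm S₁.carrier x (fiberDir π S.frame) then g else 0) +
        ((if HasGerm S₂.carrier x (-fiberDir π S.frame) then g else 0) -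
        if HasGerm S₂.carrier x (fiberDir π S.frame) then g else 0)) := by
      intro x
      rw [map_sub, map_add, fiberDensity_single, fiberDensity_single, fiberDensity_single,
        fiberDir_change π hA₁, fiberDir_change π hA₂, ← smul_neg, ← smul_neg,
        S₁.hasGerm_smul_iff hdet₁, S₁.hasGerm_smul_iff hdet₁,
        S₂.hasGerm_smul_iff hdet₂, S₂.hasGerm_smul_iff hdet₂, hc]
    -- Without a fibre direction the two terms of each polyhedron agree and cancel.
    by_cases hd0 : fiberDir π S.frame = 0
    · refine Eventually.of_forall fun x => ?_
      rw [hexp, hd0]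
      simp
    · have hu : ∀ x e, HasGerm (S₁.carrier ∪ S₂.carrier) x e ↔
          HasGerm S₁.carrier x e ∨ HasGerm S₂.carrier x e := fun x e =>
        hasGerm_union_iff S₁.convex S₁.isClosed S₂.convex S₂.isClosed
      filter_upwards [eventually_not_hasGerm_inter hd π hd0 (proj_fiberDir π _),
        eventually_not_hasGerm_inter hd π (neg_ne_zero.2 hd0)
          (by rw [map_neg, proj_fiberDir, neg_zero])] with x hx hx'
      have key : ∀ e, ¬HasGerm (S₁.carrier ∩ S₂.carrier) x e →
          (if HasGerm (S₁.carrier ∪ S₂.carrier) x e then g else 0) =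
            (if HasGerm S₁.carrier x e then g else 0) +
              if HasGerm S₂.carrier x e then g else 0 := by
        intro e he
        rw [hu]
        by_cases h1 : HasGerm S₁.carrier x e <;> by_cases h2 : HasGerm S₂.carrier x e
        · exact absurd ((h1.and h2).mono fun t ht => ht) he
        · simp [h1, h2]
        · simp [h1, h2]
        · simp [h1, h2]
      rw [hexp, key _ hx, key _ hx']
      abel

theorem fiberDensity_eq_of_toChain_eq (π : Fin k → X →L[ℝ] ℝ) {P Q : FormalSum X G (k + 1)}
    (h : P.toChain = Q.toChain) : ∀ᶠ x in generic π, fiberDensity π x P = fiberDensity π x Q :=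
  eventually_eq_of_toChain_eq _ (fun _ hR => fiberDensity_eq_zero_of_relation π hR) h

/-! ### Facets and the fibres of a projection -/

theorem finrank_level_lt {C : Set X} [FiniteDimensional ℝ (vectorSpan ℝ C)] {f : X →L[ℝ] ℝ}
    {r : ℝ} {z₀ z₁ : X} (h₀ : z₀ ∈ C) (hf₀ : f z₀ = r) (h₁ : z₁ ∈ C) (hf₁ : f z₁ ≠ r) :
    Module.finrank ℝ (vectorSpan ℝ {z ∈ C | f z = r}) < Module.finrank ℝ (vectorSpan ℝ C) := by
  refine Submodule.finrank_lt_finrank_of_lt (lt_of_le_of_ne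
    (vectorSpan_mono ℝ fun z hz => hz.1) fun h => hf₁ ?_)
  have h2 : z₁ -ᵥ z₀ ∈ vectorSpan ℝ {z ∈ C | f z = r} := h ▸ vsub_mem_vectorSpan ℝ h₁ h₀
  have := apply_eq_zero_of_mem_vectorSpan (fun z hz => hz.2) h2
  rw [vsub_eq_sub, map_sub, hf₀, sub_eq_zero] at this
  exact this

theorem finiteDimensional_of_subset {S : Set X} [FiniteDimensional ℝ (vectorSpan ℝ S)]
    {T : Set X} (h : T ⊆ S) : FiniteDimensional ℝ (vectorSpan ℝ T) :=
  Submodule.finiteDimensional_of_le (vectorSpan_mono ℝ h)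

theorem exists_facet_functional {S : OrientedPolyhedron X (k + 1)} {F : Set X}
    (hF : F ∈ facets S) :
    ∃ (l : X →L[ℝ] ℝ) (c : ℝ), (∀ z ∈ S.carrier, l z ≤ c) ∧ F = {z ∈ S.carrier | l z = c} := by
  obtain ⟨he, ⟨x, hx⟩, -⟩ := hF
  obtain ⟨l, hl⟩ := he ⟨x, hx⟩
  have hx' := hx
  rw [hl] at hx'
  refine ⟨l, l x, hx'.2, ?_⟩
  ext z
  rw [hl]
  exact ⟨fun h => ⟨h.1, le_antisymm (hx'.2 z h.1) (h.2 x hx'.1)⟩,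
    fun h => ⟨h.1, fun y hy => (hx'.2 y hy).trans h.2.ge⟩⟩

theorem facet_subset {S : OrientedPolyhedron X (k + 1)} {F : Set X} (hF : F ∈ facets S) :
    F ⊆ S.carrier := by
  obtain ⟨l, c, -, rfl⟩ := exists_facet_functional hF
  exact fun z hz => hz.1

theorem exists_mem_diff_facet {S : OrientedPolyhedron X (k + 1)} {F : Set X}
    (hF : F ∈ facets S) : ∃ z ∈ S.carrier, z ∉ F := by
  by_contra hcon
  push Not at hcon
  have h := hF.2.2
  rw [Subset.antisymm (facet_subset hF) hcon, S.finrank_vectorSpan] at h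
  omega

/-- A face cut out by a valid constraint is everything, a facet or of smaller dimension. -/
theorem face_trichotomy (S : OrientedPolyhedron X (k + 1)) {p : (X →L[ℝ] ℝ) × ℝ}
    (hp : ∀ z ∈ S.carrier, p.1 z ≤ p.2) {x : X} (hx : x ∈ S.carrier) (hpx : p.1 x = p.2) :
    (∀ z ∈ S.carrier, p.1 z = p.2) ∨ {z ∈ S.carrier | p.1 z = p.2} ∈ facets S ∨
      Module.finrank ℝ (vectorSpan ℝ {z ∈ S.carrier | p.1 z = p.2}) < k := by
  by_cases hall : ∀ z ∈ S.carrier, p.1 z = p.2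
  · exact Or.inl hall
  · right
    push Not at hall
    obtain ⟨z, hz, hzp⟩ := hall
    have := S.finiteDimensional
    have hlt := finrank_level_lt hx hpx hz hzp
    rw [S.finrank_vectorSpan] at hlt
    rcases (Nat.lt_succ_iff.1 hlt).lt_or_eq with h | h
    · exact Or.inr h
    · refine Or.inl ⟨fun _ => ⟨p.1, ?_⟩, ⟨x, hx, hpx⟩, h⟩
      ext z
      exact ⟨fun h => ⟨h.1, fun y hy => (hp y hy).trans h.2.ge⟩,
        fun h => ⟨h.1, le_antisymm (hp z h.1) (hpx ▸ h.2 x hx)⟩⟩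

/-- The functional that exposes `F` is constant on the intersection, which by its dimension has all
directions of `F'`; so it is constant on `F'`. -/
theorem facet_subset_of_finrank_inter {S : OrientedPolyhedron X (k + 1)} {F F' : Set X}
    (hF : F ∈ facets S) (hF' : F' ∈ facets S) (hne : (F ∩ F').Nonempty)
    (h : k ≤ Module.finrank ℝ (vectorSpan ℝ (F ∩ F'))) : F' ⊆ F := by
  have := (isPolyhedron_of_mem_facets hF').finiteDimensional
  have hdir : vectorSpan ℝ (F ∩ F') = vectorSpan ℝ F' :=
    Submodule.eq_of_le_of_finrank_le (vectorSpan_mono ℝ inter_subset_right) (by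
      rw [hF'.2.2]; exact h)
  obtain ⟨x, hx, hx'⟩ := hne
  obtain ⟨l, c, -, hl⟩ := exists_facet_functional hF
  intro z hz
  have h1 : z -ᵥ x ∈ vectorSpan ℝ (F ∩ F') := hdir ▸ vsub_mem_vectorSpan ℝ hz hx'
  have h2 := apply_eq_zero_of_mem_vectorSpan (f := l) (c := c)
    (fun y hy => by have := hy.1; rw [hl] at this; exact this.2) h1
  rw [hl] at hx ⊢
  refine ⟨facet_subset hF' hz, ?_⟩
  rw [vsub_eq_sub, map_sub, sub_eq_zero] at h2
  exact h2.trans hx.2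

theorem eventually_notMem_inter_facets {S : OrientedPolyhedron X (k + 1)} {F F' : Set X}
    (hF : F ∈ facets S) (hF' : F' ∈ facets S) (hne : F ≠ F') (π : Fin k → X →L[ℝ] ℝ) :
    ∀ᶠ x in generic π, x ∉ F ∩ F' := by
  rw [eventually_notMem_generic]
  rcases (F ∩ F').eq_empty_or_nonempty with he | hn
  · simp [he]
  · have := ((isPolyhedron_of_mem_facets hF).inter
      (isPolyhedron_of_mem_facets hF')).finiteDimensional
    refine volume_proj_image_eq_zero_of_finrank ?_
    by_contra hcon
    push Not at hcon
    refine hne (Subset.antisymm (facet_subset_of_finrank_inter hF' hF ?_ ?_)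
      (facet_subset_of_finrank_inter hF hF' hn hcon))
    · rwa [inter_comm]
    · rwa [inter_comm]

open Classical in
theorem boundary_single (S : OrientedPolyhedron X (k + 1)) (g : G) :
    boundary (Finsupp.single S g) = ∑ F : facets S,
      if IsInducedOrientation S F then Finsupp.single (facet S F) g
      else Finsupp.single (facet S F) (-g) := by
  rw [boundary, Finsupp.sum_single_index]
  simp

theorem boundary_zero : boundary (0 : FormalSum X G (k + 1)) = 0 := by
  rw [boundary, Finsupp.sum_zero_index]

theorem boundary_add (P Q : FormalSum X G (k + 1)) :
    boundary (P + Q) = boundary P + boundary Q := by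
  classical
  rw [boundary, Finsupp.sum_add_index']
  · rfl
  · simp
  · intro S g h
    rw [← Finset.sum_add_distrib]
    refine Finset.sum_congr rfl fun F _ => ?_
    split_ifs
    · rw [Finsupp.single_add]
    · rw [neg_add, Finsupp.single_add]

/-- The frame of a facet, completed by an outward vector, in terms of the frame of the
polyhedron. -/
theorem exists_outward_frame_change (S : OrientedPolyhedron X (k + 1)) (F : facets S) :
    ∃ y ∈ (F : Set X), ∃ x ∈ S.carrier \ (F : Set X), ∃ A : Matrix (Fin (k + 1)) (Fin (k + 1)) ℝ,
      (∀ j, (Fin.cons (y - x) (facet S F).frame : Fin (k + 1) → X) j = ∑ i, A i j • S.frame i) ∧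
      ((IsInducedOrientation S F ∧ 0 < A.det) ∨ (¬IsInducedOrientation S F ∧ A.det < 0)) := by
  by_cases hI : IsInducedOrientation S F
  · obtain ⟨y, hy, x, hx, A, hA, hdet⟩ := id hI
    exact ⟨y, hy, x, hx, A, hA, Or.inl ⟨hI, hdet⟩⟩
  · obtain ⟨y, hy⟩ := F.2.2.1
    obtain ⟨x, hxS, hxF⟩ := exists_mem_diff_facet F.2
    obtain ⟨l, c, hl, hF⟩ := exists_facet_functional F.2
    have hlF : ∀ z ∈ (F : Set X), l z = c := fun z hz => by rw [hF] at hz; exact hz.2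
    have hspan : Submodule.span ℝ (range (facet S F).frame) = vectorSpan ℝ (F : Set X) :=
      (facet S F).span_frame
    have hli : LinearIndependent ℝ (Fin.cons (y - x) (facet S F).frame : Fin (k + 1) → X) := by
      refine linearIndependent_finCons.2 ⟨(facet S F).linearIndependent, fun hmem => ?_⟩
      rw [hspan] at hmem
      have := apply_eq_zero_of_mem_vectorSpan hlF hmem
      rw [map_sub, hlF y hy, sub_eq_zero] at this
      exact hxF (by rw [hF]; exact ⟨hxS, this.symm⟩)
    have hmem : ∀ j, (Fin.cons (y - x) (facet S F).frame : Fin (k + 1) → X) j ∈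
        Submodule.span ℝ (range S.frame) := by
      intro j
      refine Fin.cases ?_ (fun j => ?_) j
      · exact S.sub_mem_span (facet_subset F.2 hy) hxS
      · rw [Fin.cons_succ, S.span_frame]
        refine vectorSpan_mono ℝ (facet_subset F.2) ?_
        rw [← hspan]
        exact Submodule.subset_span ⟨j, rfl⟩
    obtain ⟨A, hA, hdet⟩ := exists_change_of_frame hli hmem
    refine ⟨y, hy, x, ⟨hxS, hxF⟩, A, hA, Or.inr ⟨hI, ?_⟩⟩
    -- `IsInducedOrientation` is existential in the two points, so its failure excludes a positive
    -- determinant for this choice.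
    refine hdet.lt_or_gt.resolve_right fun h => hI ⟨y, hy, x, ⟨hxS, hxF⟩, A, hA, h⟩

/-- The density of the boundary of a simple chain is read off from the fibres of the projection. -/
theorem density_boundary_single (π : Fin k → X →L[ℝ] ℝ) (S : OrientedPolyhedron X (k + 1))
    (g : G) : ∀ᶠ x in generic π, density π x (boundary (Finsupp.single S g)) =
      fiberDensity π x (Finsupp.single S g) := by
  classical
  obtain ⟨-, A, L, -, hS⟩ := id S.isPolyhedron
  have hL : ∀ z ∈ S.carrier, ∀ p ∈ L, p.1 z ≤ p.2 := fun z hz => by rw [hS] at hz; exact hz.2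
  have hfd := S.finiteDimensional
  -- A generic point avoids the faces of dimension less than `k`, the intersections of two facets
  -- and the facets on which `π` is degenerate. So it lies outside `S`, or meets no proper face, or
  -- lies on exactly one facet.
  have hG1 : ∀ᶠ x in generic π, ∀ p ∈ L,
      Module.finrank ℝ (vectorSpan ℝ {z ∈ S.carrier | p.1 z = p.2}) < k →
        x ∉ {z ∈ S.carrier | p.1 z = p.2} := by
    rw [Filter.eventually_all_finset]
    intro p _
    by_cases h : Module.finrank ℝ (vectorSpan ℝ {z ∈ S.carrier | p.1 z = p.2}) < k
    · have : FiniteDimensional ℝ (vectorSpan ℝ {z ∈ S.carrier | p.1 z = p.2}) :=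
        finiteDimensional_of_subset (S := S.carrier) fun z hz => hz.1
      filter_upwards [eventually_notMem_generic.2
        (volume_proj_image_eq_zero_of_finrank (π := π) h)] with x hx _ using hx
    · exact Eventually.of_forall fun x h' => absurd h' h
  have hG2 : ∀ᶠ x in generic π, ∀ F F' : facets S, F ≠ F' → x ∉ (F : Set X) ∩ F' := by
    rw [eventually_all]
    intro F
    rw [eventually_all]
    intro F'
    by_cases h : F = F'
    · simp [h]
    · filter_upwards [eventually_notMem_inter_facets F.2 F'.2
        (fun h' => h (Subtype.ext h')) π] with x hx _ using hx
  have hG3 : ∀ᶠ x in generic π, ∀ F : facets S, minor π (facet S F).frame = 0 →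
      x ∉ (F : Set X) := by
    rw [eventually_all]
    intro F
    by_cases h : minor π (facet S F).frame = 0
    · filter_upwards [(facet S F).eventually_notMem_of_minor_eq_zero h] with x hx _ using hx
    · exact Eventually.of_forall fun x h' => absurd h' h
  filter_upwards [hG1, hG2, hG3] with x h1 h2 h3
  set d := fiberDir π S.frame with hd
  have hdV : d ∈ vectorSpan ℝ S.carrier := by
    rw [← S.span_frame]
    exact fiberDir_mem_span π _
  have hdens : density π x (boundary (Finsupp.single S g)) = ∑ F : facets S,
      if x ∈ (F : Set X) then signSmul (minor π (facet S F).frame)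
        (if IsInducedOrientation S F then g else -g) else 0 := by
    rw [boundary_single, map_sum]
    refine Finset.sum_congr rfl fun F _ => ?_
    split_ifs with hi hx hx <;> rw [density_single]
    · exact if_pos hx
    · exact if_neg hx
    · exact if_pos hx
    · exact if_neg hx
  rw [hdens, fiberDensity_single]
  by_cases hxS : x ∈ S.carrier
  swap
  · rw [Finset.sum_eq_zero fun F _ => if_neg fun h => hxS (facet_subset F.2 h),
      if_neg, if_neg, sub_zero]
    · exact fun h => hxS ((hasGerm_iff S.convex S.isClosed).1 h).1
    · exact fun h => hxS ((hasGerm_iff S.convex S.isClosed).1 h).1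
  by_cases hF : ∃ F : facets S, x ∈ (F : Set X)
  swap
  · push Not at hF
    rw [Finset.sum_eq_zero fun F _ => if_neg (hF F)]
    have hgerm : ∀ w ∈ vectorSpan ℝ S.carrier, HasGerm S.carrier x w := by
      intro w hw
      refine hasGerm_of_constraints hS hxS hw fun p hp hpx => ?_
      rcases face_trichotomy S (fun z hz => hL z hz p hp) hxS hpx with h | h | h
      · exact (apply_eq_zero_of_mem_vectorSpan h hw).le
      · exact absurd ⟨hxS, hpx⟩ (hF ⟨_, h⟩)
      · exact absurd ⟨hxS, hpx⟩ (h1 p hp h)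
    rw [if_pos (hgerm _ (Submodule.neg_mem _ hdV)), if_pos (hgerm _ hdV), sub_self]
  obtain ⟨F, hxF⟩ := hF
  rw [Finset.sum_eq_single_of_mem F (Finset.mem_univ _) fun F' _ hne =>
    if_neg fun h => h2 F' F hne ⟨h, hxF⟩, if_pos hxF]
  obtain ⟨l, c, hl, hFl⟩ := exists_facet_functional F.2
  obtain ⟨y, hy, x', ⟨hx'S, hx'F⟩, A', hA', hor⟩ := exists_outward_frame_change S F
  have hspan : Submodule.span ℝ (range (facet S F).frame) = vectorSpan ℝ (F : Set X) :=
    (facet S F).span_frame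
  have hm : minor π (facet S F).frame ≠ 0 := fun h => h3 F h hxF
  have hdet : A'.det ≠ 0 := hor.elim (fun h => h.2.ne') fun h => h.2.ne
  -- The functionals that cut out `F` have the same sign on the fibre direction.
  have hfun : ∀ (q : X →L[ℝ] ℝ) (b : ℝ), (∀ z ∈ S.carrier, q z ≤ b) →
      (F : Set X) = {z ∈ S.carrier | q z = b} →
        ∃ a : ℝ, 0 < a ∧ A'.det * q d = a * minor π (facet S F).frame := by
    intro q b hq hFq
    have hqF : ∀ z ∈ (F : Set X), q z = b := fun z hz => by rw [hFq] at hz; exact hz.2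
    refine ⟨q (y - x'), ?_, ?_⟩
    · rw [map_sub, hqF y hy, sub_pos]
      refine lt_of_le_of_ne (hq x' hx'S) fun h => hx'F ?_
      rw [hFq]
      exact ⟨hx'S, h⟩
    · rw [hd, apply_fiberDir, ← minor_change _ hA', minor_cons_cons]
      intro i
      refine apply_eq_zero_of_mem_vectorSpan hqF ?_
      rw [← hspan]
      exact Submodule.subset_span ⟨i, rfl⟩
  obtain ⟨a, ha, hla⟩ := hfun l c hl hFl
  have hlx : l x = c := by rw [hFl] at hxF; exact hxF.2
  -- The factor `s = ±1` treats both signs of `l d` at once: `s • d` points out of `S` through `F`,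
  -- and `-(s • d)` points into `S`.
  have key : ∀ s : ℝ, 0 < s * l d → HasGerm S.carrier x (-(s • d)) ∧
      ¬HasGerm S.carrier x (s • d) := by
    intro s hs
    refine ⟨hasGerm_of_constraints hS hxS
      (Submodule.neg_mem _ (Submodule.smul_mem _ _ hdV)) fun p hp hpx => ?_, fun h => ?_⟩
    · rw [map_neg, map_smul, smul_eq_mul, neg_nonpos]
      rcases face_trichotomy S (fun z hz => hL z hz p hp) hxS hpx with h | h | h
      · rw [apply_eq_zero_of_mem_vectorSpan h hdV, mul_zero]
      · have hFp : (F : Set X) = {z ∈ S.carrier | p.1 z = p.2} := by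
          by_contra hne
          exact h2 F ⟨_, h⟩ (fun h' => hne (congrArg Subtype.val h')) ⟨hxF, hxS, hpx⟩
        obtain ⟨a', ha', hpa⟩ := hfun p.1 p.2 (fun z hz => hL z hz p hp) hFp
        have h5 : p.1 d = a' / a * l d := by
          refine mul_left_cancel₀ hdet ?_
          rw [hpa, mul_left_comm, hla]
          field_simp
        rw [h5, mul_left_comm]
        exact (mul_pos (div_pos ha' ha) hs).le
      · exact absurd ⟨hxS, hpx⟩ (h1 p hp h)
    · obtain ⟨-, t, ht0, ht⟩ := (hasGerm_iff S.convex S.isClosed).1 h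
      have := hl _ ht
      rw [map_add, map_smul, map_smul, smul_eq_mul, smul_eq_mul, hlx] at this
      have := mul_pos ht0 hs
      linarith
  have hld : l d ≠ 0 := fun h => by
    rw [h, mul_zero, zero_eq_mul] at hla
    exact hla.elim ha.ne' hm
  -- The frame of `F` was chosen arbitrarily; the sign in the boundary and the sign of `A'.det`
  -- compensate for this choice.
  have hsgn : signSmul (minor π (facet S F).frame)
      (if IsInducedOrientation S F then g else -g) = signSmul (l d) g := by
    have h6 : minor π (facet S F).frame = a⁻¹ * (A'.det * l d) := by
      rw [hla, inv_mul_cancel_left₀ ha.ne']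
    rw [h6, signSmul_mul, signSmul_of_pos (inv_pos.2 ha), signSmul_mul]
    rcases hor with ⟨hi, h⟩ | ⟨hi, h⟩
    · rw [if_pos hi, signSmul_of_pos h]
    · rw [if_neg hi, signSmul_of_neg h, signSmul_neg, neg_neg]
  rw [hsgn]
  rcases hld.lt_or_gt with h | h
  · obtain ⟨h7, h8⟩ := key (-1) (by linarith)
    rw [neg_one_smul] at h7 h8
    rw [neg_neg] at h7
    rw [if_neg h8, if_pos h7, signSmul_of_neg h, zero_sub]
  · obtain ⟨h7, h8⟩ := key 1 (by linarith)
    rw [one_smul] at h7 h8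
    rw [if_pos h7, if_neg h8, signSmul_of_pos h, sub_zero]

theorem density_boundary (π : Fin k → X →L[ℝ] ℝ) (P : FormalSum X G (k + 1)) :
    ∀ᶠ x in generic π, density π x (boundary P) = fiberDensity π x P := by
  induction P using Finsupp.induction_linear with
  | zero => simp [boundary_zero]
  | add P Q hP hQ =>
    filter_upwards [hP, hQ] with x h1 h2
    rw [boundary_add, map_add, map_add, h1, h2]
  | single S g => exact density_boundary_single π S g

/-! ### The density of a slice -/

open Classical in
theorem restrict_single (f : X →L[ℝ] ℝ) (r : ℝ) (S : OrientedPolyhedron X k) (g : G) :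
    restrict f r (Finsupp.single S g) =
      if h : (S.carrier ∩ {x | f x < r}).Nonempty then Finsupp.single (cut S f r h) g else 0 := by
  rw [restrict, Finsupp.sum_single_index]
  simp

theorem restrict_add (f : X →L[ℝ] ℝ) (r : ℝ) (P Q : FormalSum X G k) :
    restrict f r (P + Q) = restrict f r P + restrict f r Q := by
  classical
  rw [restrict, Finsupp.sum_add_index']
  · rfl
  · simp
  · intro S g h
    split_ifs
    · rw [Finsupp.single_add]
    · rw [add_zero]

-- `cut` takes the closed half-space, but if `S` meets `{f < r}` the level `{f = r}` in `S` has
-- smaller dimension and contains no generic point.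
open Classical in
theorem density_restrict (π : Fin k → X →L[ℝ] ℝ) (f : X →L[ℝ] ℝ) (r : ℝ)
    (P : FormalSum X G k) : ∀ᶠ x in generic π, density π x (restrict f r P) =
      if f x < r then density π x P else 0 := by
  induction P using Finsupp.induction_linear with
  | zero => simp [restrict]
  | add P Q hP hQ =>
    filter_upwards [hP, hQ] with x h1 h2
    rw [restrict_add, map_add, map_add, h1, h2]
    split_ifs <;> simp
  | single S g =>
    by_cases h : (S.carrier ∩ {x | f x < r}).Nonempty
    · have hlevel : ∀ᶠ x in generic π, x ∉ {z ∈ S.carrier | f z = r} := by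
        rw [eventually_notMem_generic]
        rcases {z ∈ S.carrier | f z = r}.eq_empty_or_nonempty with he | ⟨z₀, hz₀⟩
        · simp [he]
        · obtain ⟨z₁, hz₁, hlt⟩ := h
          have := S.finiteDimensional
          have hlt' := finrank_level_lt hz₀.1 hz₀.2 hz₁ (ne_of_lt hlt)
          rw [S.finrank_vectorSpan] at hlt'
          have : FiniteDimensional ℝ (vectorSpan ℝ {z ∈ S.carrier | f z = r}) :=
            finiteDimensional_of_subset (S := S.carrier) fun z hz => hz.1
          exact volume_proj_image_eq_zero_of_finrank hlt'
      filter_upwards [hlevel] with x hx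
      rw [restrict_single, dif_pos h, density_single, density_single]
      by_cases hxS : x ∈ S.carrier
      · have hne : f x ≠ r := fun h => hx ⟨hxS, h⟩
        by_cases hlt : f x < r
        · simp [cut, hxS, hlt, hlt.le]
        · have : ¬f x ≤ r := fun h => hlt (lt_of_le_of_ne h hne)
          simp [cut, hlt, this]
      · simp [cut, hxS]
    · refine Eventually.of_forall fun x => ?_
      rw [restrict_single, dif_neg h, map_zero, density_single]
      split_ifs with h1 h2
      · exact absurd ⟨x, h2, h1⟩ h
      · rfl
      · rfl

/-! ### Slices at regular levels -/

/-- The level `r` of `f` is in general position with respect to `S`. -/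
def IsRegularLevel (S : Set X) (f : X →L[ℝ] ℝ) (r : ℝ) : Prop :=
  (∀ z ∈ S, f z = r → (∃ y ∈ S, f y < r) ∧ ∃ y ∈ S, r < f y) ∧
    ∃ (A : AffineSubspace ℝ X) (L : Finset ((X →L[ℝ] ℝ) × ℝ)),
      S = {x | x ∈ A ∧ ∀ p ∈ L, p.1 x ≤ p.2} ∧
      ∀ p ∈ L, ∀ z ∈ S, p.1 z = p.2 → ∃ y ∈ S, p.1 y = p.2 ∧ f y ≠ r

/-- Only finitely many levels fail: the extreme values of `f` on `S`, and its values on those of the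
finitely many constraint faces on which it is constant. -/
theorem ae_isRegularLevel {S : Set X} (hS : IsConvexPolyhedron S) (f : X →L[ℝ] ℝ) :
    ∀ᵐ r, IsRegularLevel S f r := by
  obtain ⟨-, A, L, -, hAL⟩ := id hS
  have hsub : ∀ E : Set X, {r : ℝ | E.Nonempty ∧ ∀ y ∈ E, f y = r}.Subsingleton := by
    rintro E r ⟨⟨y, hy⟩, h⟩ r' ⟨-, h'⟩
    rw [← h y hy, ← h' y hy]
  have h1 : ∀ᵐ r : ℝ, ∀ z ∈ S, f z = r → ∃ y ∈ S, f y < r := by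
    have : {r : ℝ | ∃ z ∈ S, f z = r ∧ ∀ y ∈ S, r ≤ f y}.Subsingleton := by
      rintro r ⟨z, hz, rfl, h⟩ r' ⟨z', hz', rfl, h'⟩
      exact le_antisymm (h _ hz') (h' _ hz)
    filter_upwards [this.measure_zero volume |> measure_eq_zero_iff_ae_notMem.1] with r hr z hz hzr
    by_contra hcon
    push Not at hcon
    exact hr ⟨z, hz, hzr, hcon⟩
  have h2 : ∀ᵐ r : ℝ, ∀ z ∈ S, f z = r → ∃ y ∈ S, r < f y := by
    have : {r : ℝ | ∃ z ∈ S, f z = r ∧ ∀ y ∈ S, f y ≤ r}.Subsingleton := by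
      rintro r ⟨z, hz, rfl, h⟩ r' ⟨z', hz', rfl, h'⟩
      exact le_antisymm (h' _ hz) (h _ hz')
    filter_upwards [this.measure_zero volume |> measure_eq_zero_iff_ae_notMem.1] with r hr z hz hzr
    by_contra hcon
    push Not at hcon
    exact hr ⟨z, hz, hzr, hcon⟩
  have h3 : ∀ᵐ r : ℝ, ∀ p ∈ L, ∀ z ∈ S, p.1 z = p.2 → ∃ y ∈ S, p.1 y = p.2 ∧ f y ≠ r := by
    rw [Filter.eventually_all_finset]
    intro p _
    filter_upwards [(hsub {z ∈ S | p.1 z = p.2}).measure_zero volume |>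
      measure_eq_zero_iff_ae_notMem.1] with r hr z hz hzp
    by_contra hcon
    push Not at hcon
    exact hr ⟨⟨z, hz, hzp⟩, fun y hy => hcon y hy.1 hy.2⟩
  filter_upwards [h1, h2, h3] with r h1 h2 h3
  exact ⟨fun z hz hzr => ⟨h1 z hz hzr, h2 z hz hzr⟩, A, L, hAL, h3⟩

/-- Generic points of a regular level are interior points of the polyhedron. -/
theorem eventually_hasGerm_of_isRegularLevel (S : OrientedPolyhedron X (k + 1)) {f : X →L[ℝ] ℝ}
    {r : ℝ} (hr : IsRegularLevel S.carrier f r) (π : Fin k → X →L[ℝ] ℝ) :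
    ∀ᶠ x in generic π, x ∈ S.carrier → f x = r →
      ∀ w ∈ vectorSpan ℝ S.carrier, HasGerm S.carrier x w := by
  obtain ⟨-, A, L, hS, hreg⟩ := hr
  have hfd := S.finiteDimensional
  -- A proper constraint face loses one of the `k + 1` dimensions, and a level on which `f` is not
  -- constant along that face loses another. Less than `k` remain.
  have hgen : ∀ᶠ x in generic π, ∀ p ∈ L, (∃ z ∈ S.carrier, p.1 z ≠ p.2) →
      x ∉ {z ∈ {z ∈ S.carrier | p.1 z = p.2} | f z = r} := by
    rw [Filter.eventually_all_finset]
    intro p hp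
    by_cases hp' : ∃ z ∈ S.carrier, p.1 z ≠ p.2
    · suffices h : volume (proj π '' {z ∈ {z ∈ S.carrier | p.1 z = p.2} | f z = r}) = 0 by
        filter_upwards [eventually_notMem_generic.2 h] with x hx _ using hx
      rcases {z ∈ {z ∈ S.carrier | p.1 z = p.2} | f z = r}.eq_empty_or_nonempty with
        he | ⟨z₀, ⟨hz₀, hz₀p⟩, hz₀r⟩
      · rw [he, image_empty, measure_empty]
      · obtain ⟨y, hy, hyp, hyr⟩ := hreg p hp z₀ hz₀ hz₀p
        obtain ⟨z, hz, hzp⟩ := hp'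
        have h1 := finrank_level_lt hz₀ hz₀p hz hzp
        rw [S.finrank_vectorSpan] at h1
        have : FiniteDimensional ℝ (vectorSpan ℝ {z ∈ S.carrier | p.1 z = p.2}) :=
          finiteDimensional_of_subset (S := S.carrier) fun z hz => hz.1
        have h2 := finrank_level_lt (C := {z ∈ S.carrier | p.1 z = p.2}) ⟨hz₀, hz₀p⟩ hz₀r
          ⟨hy, hyp⟩ hyr
        have : FiniteDimensional ℝ
            (vectorSpan ℝ {z ∈ {z ∈ S.carrier | p.1 z = p.2} | f z = r}) :=
          finiteDimensional_of_subset (S := S.carrier) fun z hz => hz.1.1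
        exact volume_proj_image_eq_zero_of_finrank (by omega)
    · exact Eventually.of_forall fun x h => absurd h hp'
  filter_upwards [hgen] with x hx hxS hxr w hw
  refine hasGerm_of_constraints hS hxS hw fun p hp hpx => ?_
  by_cases hp' : ∃ z ∈ S.carrier, p.1 z ≠ p.2
  · exact absurd ⟨⟨hxS, hpx⟩, hxr⟩ (hx p hp hp')
  · push Not at hp'
    exact (apply_eq_zero_of_mem_vectorSpan hp' hw).le

open Classical in
/-- The density of a slice of a simple chain at a regular level. -/
theorem density_slice (S : OrientedPolyhedron X (k + 1)) {f : X →L[ℝ] ℝ}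
    {r : ℝ} (hr : IsRegularLevel S.carrier f r) (π : Fin k → X →L[ℝ] ℝ) (g : G) :
    ∀ᶠ x in generic π, density π x (slice f r (Finsupp.single S g)) =
      if x ∈ S.carrier ∧ f x = r then signSmul (f (fiberDir π S.frame)) g else 0 := by
  filter_upwards [density_boundary π (restrict f r (Finsupp.single S g)),
    density_restrict π f r (boundary (Finsupp.single S g)),
    density_boundary_single π S g, eventually_hasGerm_of_isRegularLevel S hr π]
    with x h1 h2 h3 h4
  rw [slice, map_sub, h1, h2, h3, restrict_single]
  have hgermS : ∀ e, HasGerm S.carrier x e → x ∈ S.carrier := fun e he =>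
    ((hasGerm_iff S.convex S.isClosed).1 he).1
  by_cases hne : (S.carrier ∩ {x | f x < r}).Nonempty
  · rw [dif_pos hne, fiberDensity_single, fiberDensity_single]
    change (if HasGerm (S.carrier ∩ {z | f z ≤ r}) x (-fiberDir π S.frame) then g else 0) -
      (if HasGerm (S.carrier ∩ {z | f z ≤ r}) x (fiberDir π S.frame) then g else 0) - _ = _
    rcases lt_trichotomy (f x) r with hlt | heq | hgt
    · rw [hasGerm_inter_le_of_lt hlt, hasGerm_inter_le_of_lt hlt, if_pos hlt, sub_self,
        if_neg fun h => hlt.ne h.2]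
    -- On the level the term `(∂P)_r` vanishes. A generic point of the level has germs in all
    -- directions of `S`, so cutting removes exactly those along which `f` increases.
    · rw [hasGerm_inter_le_of_eq heq, hasGerm_inter_le_of_eq heq, if_neg heq.not_lt, sub_zero]
      by_cases hxS : x ∈ S.carrier
      · have hd : fiberDir π S.frame ∈ vectorSpan ℝ S.carrier := by
          rw [← S.span_frame]
          exact fiberDir_mem_span π _
        have hg1 := h4 hxS heq _ hd
        have hg2 := h4 hxS heq _ (Submodule.neg_mem _ hd)
        rw [if_pos (show x ∈ S.carrier ∧ f x = r from ⟨hxS, heq⟩)]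
        rcases lt_trichotomy (f (fiberDir π S.frame)) 0 with h | h | h
        · simp [hg1, hg2, h.le, not_le.2 h, signSmul_of_neg h]
        · simp [hg1, hg2, h]
        · simp [hg1, hg2, h.le, not_le.2 h, signSmul_of_pos h]
      · rw [if_neg fun h => hxS (hgermS _ h.1), if_neg fun h => hxS (hgermS _ h.1),
          if_neg fun h => hxS h.1, sub_self]
    · have hnot : ∀ e, ¬HasGerm (S.carrier ∩ {z | f z ≤ r}) x e := by
        intro e he
        have hcl : IsClosed {z : X | f z ≤ r} := isClosed_le f.continuous continuous_const
        have := ((hasGerm_iff (S.isPolyhedron.inter_halfspace f r).convex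
          (S.isClosed.inter hcl)).1 he).1.2
        exact absurd hgt (not_lt.2 this)
      rw [if_neg (hnot _), if_neg (hnot _), if_neg hgt.not_gt, if_neg fun h => hgt.ne' h.2]
      simp
  · have hlevel : ¬(x ∈ S.carrier ∧ f x = r) := by
      rintro ⟨hxS, hxr⟩
      obtain ⟨⟨y, hy, hyr⟩, -⟩ := hr.1 x hxS hxr
      exact hne ⟨y, hy, hyr⟩
    rw [dif_neg hne, map_zero, if_neg hlevel, zero_sub, neg_eq_zero]
    split_ifs with h
    · rw [fiberDensity_single, if_neg fun h' => hne ⟨x, hgermS _ h', h⟩,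
        if_neg fun h' => hne ⟨x, hgermS _ h', h⟩, sub_self]
    · rfl

/-- A valid constraint that is an equality on an interior level of `f` is an equality. -/
theorem apply_eq_of_forall_level {S : Set X} (hS : Convex ℝ S) {f q : X →L[ℝ] ℝ} {r c : ℝ}
    (hq : ∀ z ∈ S, q z ≤ c) (hlevel : ∀ z ∈ S, f z = r → q z = c) {a b : X} (ha : a ∈ S)
    (hb : b ∈ S) (har : f a < r) (hbr : r < f b) : q a = c ∧ q b = c := by
  -- The segment from `a` to `b` crosses the level at the interior parameter `t`. There the affine
  -- function `q ≤ c` attains `c`, hence it does so at both ends.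
  set t := (r - f a) / (f b - f a) with ht
  have h0 : 0 < t := div_pos (by linarith) (by linarith)
  have h1 : t < 1 := (div_lt_one (by linarith)).2 (by linarith)
  have htf : t * (f b - f a) = r - f a := div_mul_cancel₀ _ (by linarith)
  have hm := hS.add_smul_sub_mem ha hb ⟨h0.le, h1.le⟩
  have h2 := hlevel _ hm (by
    simp only [map_add, map_smul, map_sub, smul_eq_mul]
    linarith)
  simp only [map_add, map_smul, map_sub, smul_eq_mul] at h2
  have h3 := hq a ha
  have h4 := hq b hb
  constructor <;> nlinarith

/-- A regular level of a polyhedron is a polyhedron of one dimension less. -/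
theorem exists_level_polyhedron (S : OrientedPolyhedron X (k + 1)) {f : X →L[ℝ] ℝ}
    {r : ℝ} (hr : IsRegularLevel S.carrier f r) {z₀ : X} (hz₀ : z₀ ∈ S.carrier)
    (hz₀r : f z₀ = r) :
    ∃ T : OrientedPolyhedron X k, T.carrier = {z ∈ S.carrier | f z = r} ∧
      (∀ w ∈ vectorSpan ℝ S.carrier, f w = 0 → w ∈ Submodule.span ℝ (range T.frame)) ∧
      ∃ c : ℝ, c ≠ 0 ∧ ∀ π : Fin k → X →L[ℝ] ℝ,
        f (fiberDir π S.frame) = c * minor π T.frame := by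
  have hfd := S.finiteDimensional
  obtain ⟨hsides, A, L, hS, -⟩ := hr
  obtain ⟨⟨a, ha, har⟩, b, hb, hbr⟩ := hsides z₀ hz₀ hz₀r
  have hL : ∀ z ∈ S.carrier, ∀ p ∈ L, p.1 z ≤ p.2 := fun z hz => by rw [hS] at hz; exact hz.2
  set C : Set X := {z ∈ S.carrier | f z = r} with hC
  have hCeq : C = (S.carrier ∩ {z | f z ≤ r}) ∩ {z | (-f) z ≤ -r} := by
    ext z
    simp only [hC, mem_ofPred_eq, mem_inter_iff, neg_apply, neg_le_neg_iff]
    rw [and_assoc, le_antisymm_iff]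
  have hCpoly : IsConvexPolyhedron C := by
    rw [hCeq]
    exact (S.isPolyhedron.inter_halfspace f r).inter_halfspace _ _
  -- A constraint active at this point is an equality on the level, and therefore on all of `S`. So
  -- every direction of `S` in the kernel of `f` is a direction of the level.
  obtain ⟨x, hx, hstrict⟩ := exists_strict_point hCpoly.convex ⟨z₀, hz₀, hz₀r⟩ L
    fun z hz => hL z hz.1
  have hconst : ∀ p ∈ L, p.1 x = p.2 → ∀ z ∈ S.carrier, p.1 z = p.2 := by
    intro p hp hpx z hz
    have hlev : ∀ z ∈ S.carrier, f z = r → p.1 z = p.2 := fun z hz hzr =>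
      (hstrict p hp).resolve_left (fun h => h.ne hpx) z ⟨hz, hzr⟩
    have hq := fun z hz => hL z hz p hp
    rcases lt_trichotomy (f z) r with h | h | h
    · exact (apply_eq_of_forall_level S.convex hq hlev hz hb h hbr).1
    · exact hlev z hz h
    · exact (apply_eq_of_forall_level S.convex hq hlev ha hz har h).2
  have hspanC : ∀ w ∈ vectorSpan ℝ S.carrier, f w = 0 → w ∈ vectorSpan ℝ C := by
    intro w hw hfw
    have hg : HasGerm S.carrier x w := hasGerm_of_constraints hS hx.1 hw fun p hp hpx =>
      (apply_eq_zero_of_mem_vectorSpan (hconst p hp hpx) hw).le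
    have hgC : HasGerm C x w := hg.mono fun t ht => ⟨ht, by simp [hfw, hx.2]⟩
    exact hgC.mem_vectorSpan
  have hn : b - a ∈ vectorSpan ℝ S.carrier := vsub_mem_vectorSpan ℝ hb ha
  have hfn : 0 < f (b - a) := by rw [map_sub]; linarith
  have hCfd := hCpoly.finiteDimensional
  have hfin : Module.finrank ℝ (vectorSpan ℝ C) = k := by
    have h1 : Module.finrank ℝ (vectorSpan ℝ C) < _ := finrank_level_lt hz₀ hz₀r ha har.ne
    rw [S.finrank_vectorSpan] at h1
    -- The single transversal direction `b - a` completes the directions of the level, so exactly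
    -- one dimension is lost.
    have h2 : vectorSpan ℝ S.carrier ≤ vectorSpan ℝ C ⊔ Submodule.span ℝ {b - a} := by
      intro w hw
      have h3 : w - (f w / f (b - a)) • (b - a) ∈ vectorSpan ℝ C := by
        refine hspanC _ (Submodule.sub_mem _ hw (Submodule.smul_mem _ _ hn)) ?_
        rw [map_sub, map_smul, smul_eq_mul, div_mul_cancel₀ _ hfn.ne', sub_self]
      have h4 := Submodule.add_mem_sup h3
        (Submodule.smul_mem _ (f w / f (b - a)) (Submodule.mem_span_singleton_self (b - a)))
      simpa using h4
    have h5 := Submodule.finrank_mono h2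
    have h6 := Submodule.finrank_add_le_finrank_add_finrank (vectorSpan ℝ C)
      (Submodule.span ℝ {b - a})
    have h7 : Module.finrank ℝ (Submodule.span ℝ {b - a}) ≤ 1 := by
      simpa using finrank_span_le_card (R := ℝ) ({b - a} : Set X)
    rw [S.finrank_vectorSpan] at h5
    omega
  obtain ⟨w, hw, hwspan⟩ := exists_frame hCpoly hfin
  refine ⟨⟨C, hCpoly, ⟨z₀, hz₀, hz₀r⟩, w, hw, hwspan⟩, rfl, fun v hv hfv => ?_, ?_⟩
  · change v ∈ Submodule.span ℝ (range w)
    rw [hwspan]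
    exact hspanC v hv hfv
  have hfw : ∀ i, f (w i) = 0 := fun i =>
    apply_eq_zero_of_mem_vectorSpan (S := C) (fun z hz => hz.2)
      (hwspan ▸ Submodule.subset_span ⟨i, rfl⟩)
  have hli : LinearIndependent ℝ (Fin.cons (b - a) w : Fin (k + 1) → X) := by
    refine linearIndependent_finCons.2 ⟨hw, fun hmem => ?_⟩
    rw [hwspan] at hmem
    exact hfn.ne' (apply_eq_zero_of_mem_vectorSpan (fun z hz => hz.2) hmem)
  obtain ⟨B, hB, hdet⟩ := exists_change_of_frame hli (v := S.frame) (by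
    intro j
    rw [S.span_frame]
    refine Fin.cases hn (fun j => ?_) j
    rw [Fin.cons_succ]
    refine vectorSpan_mono ℝ (fun z (hz : z ∈ C) => hz.1) ?_
    rw [← hwspan]
    exact Submodule.subset_span ⟨j, rfl⟩)
  refine ⟨B.det⁻¹ * f (b - a), mul_ne_zero (inv_ne_zero hdet) hfn.ne', fun π => ?_⟩
  rw [apply_fiberDir, mul_assoc, ← minor_cons_cons π f (b - a) w hfw, minor_change _ hB,
    inv_mul_cancel_left₀ hdet]

/-- The slice of a simple chain at a regular level is a simple chain. -/
theorem exists_toChain_slice_eq (S : OrientedPolyhedron X (k + 1)) {f : X →L[ℝ] ℝ}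
    {r : ℝ} (hr : IsRegularLevel S.carrier f r) (g : G) {T : OrientedPolyhedron X k}
    (hT : T.carrier = {z ∈ S.carrier | f z = r}) {c : ℝ} (hc : c ≠ 0)
    (hcT : ∀ π : Fin k → X →L[ℝ] ℝ, f (fiberDir π S.frame) = c * minor π T.frame) :
    (slice f r (Finsupp.single S g)).toChain =
      FormalSum.toChain (Finsupp.single T (signSmul c g)) := by
  classical
  -- The slice is identified by its densities, without listing the facets of the cut polyhedron.
  refine toChain_eq_of_density_eq fun π => ?_
  filter_upwards [density_slice S hr π g] with x hx
  have hiff : x ∈ T.carrier ↔ x ∈ S.carrier ∧ f x = r := by rw [hT]; rfl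
  rw [hx, density_single, hcT, signSmul_mul]
  refine if_congr hiff.symm ?_ rfl
  rcases hc.lt_or_gt with h | h
  · rw [signSmul_of_neg h, signSmul_of_neg h, signSmul_neg]
  · rw [signSmul_of_pos h, signSmul_of_pos h]

theorem toChain_slice_eq_zero (S : OrientedPolyhedron X (k + 1)) {f : X →L[ℝ] ℝ}
    {r : ℝ} (hr : IsRegularLevel S.carrier f r) (g : G) (h : {z ∈ S.carrier | f z = r} = ∅) :
    (slice f r (Finsupp.single S g)).toChain = 0 := by
  classical
  rw [← toChain_zero]
  refine toChain_eq_of_density_eq fun π => ?_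
  filter_upwards [density_slice S hr π g] with x hx
  rw [hx, map_zero]
  exact if_neg fun hx' => h.le hx'

/-! ### The mass of simple chains -/

/-- The `k`-dimensional mass of a set: the supremum of the Lebesgue measures of its images in `ℝᵏ`
under the maps whose components have norm `1`. -/
noncomputable def projVolume (k : ℕ) (S : Set X) : ℝ≥0∞ :=
  ⨆ π : {π : Fin k → X →L[ℝ] ℝ // ∀ i, ‖π i‖ = 1}, volume (proj π.1 '' S)

theorem le_projVolume {π : Fin k → X →L[ℝ] ℝ} (hπ : ∀ i, ‖π i‖ = 1) (S : Set X) :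
    volume (proj π '' S) ≤ projVolume k S :=
  le_iSup (fun π : {π : Fin k → X →L[ℝ] ℝ // ∀ i, ‖π i‖ = 1} => volume (proj π.1 '' S)) ⟨π, hπ⟩

theorem projVolume_zero {S : Set X} (hS : S.Nonempty) : projVolume 0 S = 1 := by
  have h : ∀ π : {π : Fin 0 → X →L[ℝ] ℝ // ∀ i, ‖π i‖ = 1}, volume (proj π.1 '' S) = 1 := by
    intro π
    have : proj π.1 '' S = univ := Subsingleton.eq_univ_of_nonempty (hS.image _)
    rw [this, volume_pi, Measure.pi_of_empty]
    simp
  have : Nonempty {π : Fin 0 → X →L[ℝ] ℝ // ∀ i, ‖π i‖ = 1} := ⟨⟨Fin.elim0, fun i => i.elim0⟩⟩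
  simp [projVolume, h]

theorem mem_image_cons_iff {f : X →L[ℝ] ℝ} {π : Fin k → X →L[ℝ] ℝ} {S : Set X} {r : ℝ}
    {y : Fin k → ℝ} : (Fin.cons r y : Fin (k + 1) → ℝ) ∈
      proj (Fin.cons f π : Fin (k + 1) → X →L[ℝ] ℝ) '' S ↔ ∃ z ∈ S, f z = r ∧ proj π z = y := by
  refine exists_congr fun z => and_congr_right fun _ => ?_
  rw [funext_iff, Fin.forall_fin_succ]
  simp [funext_iff]

theorem measurableSet_image_cons {f : X →L[ℝ] ℝ} {π : Fin k → X →L[ℝ] ℝ} {S : Set X}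
    (hS : IsCompact S) :
    MeasurableSet {q : ℝ × (Fin k → ℝ) | ∃ z ∈ S, f z = q.1 ∧ proj π z = q.2} := by
  have : {q : ℝ × (Fin k → ℝ) | ∃ z ∈ S, f z = q.1 ∧ proj π z = q.2} =
      (fun z => (f z, proj π z)) '' S := by
    ext q
    simp [Prod.ext_iff]
  rw [this]
  exact (hS.image (f.continuous.prodMk (proj π).continuous)).measurableSet

theorem volume_image_cons (f : X →L[ℝ] ℝ) (π : Fin k → X →L[ℝ] ℝ) {S : Set X}
    (hS : IsCompact S) :
    volume (proj (Fin.cons f π : Fin (k + 1) → X →L[ℝ] ℝ) '' S) =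
      (volume : Measure (ℝ × (Fin k → ℝ)))
        {q : ℝ × (Fin k → ℝ) | ∃ z ∈ S, f z = q.1 ∧ proj π z = q.2} := by
  have hmp := (volume_preserving_piFinSuccAbove (fun _ : Fin (k + 1) => ℝ) 0).symm
  rw [← hmp.measure_preimage
    (hS.image (proj (Fin.cons f π : Fin (k + 1) → X →L[ℝ] ℝ)).continuous).measurableSet.nullMeasurableSet]
  congr 1
  ext q
  have hq : (MeasurableEquiv.piFinSuccAbove (fun _ : Fin (k + 1) => ℝ) 0).symm q =
      (Fin.cons q.1 q.2 : Fin (k + 1) → ℝ) := Fin.insertNth_zero' q.1 q.2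
  rw [mem_preimage, hq]
  exact mem_image_cons_iff

theorem measurable_volume_level (f : X →L[ℝ] ℝ) (π : Fin k → X →L[ℝ] ℝ) {S : Set X}
    (hS : IsCompact S) : Measurable fun r => volume (proj π '' {z ∈ S | f z = r}) := by
  convert measurable_measure_prodMk_left (ν := (volume : Measure (Fin k → ℝ)))
    (measurableSet_image_cons (f := f) (π := π) hS) using 3 with r
  ext y
  simp [and_assoc]

/-- Cavalieri's principle for the image of a compact set. -/
theorem lintegral_volume_level (f : X →L[ℝ] ℝ) (π : Fin k → X →L[ℝ] ℝ) {S : Set X}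
    (hS : IsCompact S) : ∫⁻ r, volume (proj π '' {z ∈ S | f z = r}) =
      volume (proj (Fin.cons f π : Fin (k + 1) → X →L[ℝ] ℝ) '' S) := by
  rw [volume_image_cons f π hS, Measure.volume_eq_prod,
    Measure.prod_apply (measurableSet_image_cons hS)]
  congr! 3 with r
  ext y
  simp [and_assoc]

/-- The levels of `f` are all parallel to the span of `w`, so the ratio of the measures under two
projections does not depend on `r`. -/
theorem volume_proj_level_eq {S : OrientedPolyhedron X (k + 1)} {f : X →L[ℝ] ℝ} {w : Fin k → X}
    (hw : ∀ v ∈ vectorSpan ℝ S.carrier, f v = 0 → v ∈ Submodule.span ℝ (range w))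
    {π₀ : Fin k → X →L[ℝ] ℝ} (hπ₀ : minor π₀ w = 1) (π : Fin k → X →L[ℝ] ℝ) (r : ℝ) :
    volume (proj π '' {z ∈ S.carrier | f z = r}) =
      ENNReal.ofReal |minor π w| * volume (proj π₀ '' {z ∈ S.carrier | f z = r}) := by
  rcases {z ∈ S.carrier | f z = r}.eq_empty_or_nonempty with he | ⟨x₀, hx₀⟩
  · simp [he]
  · have hsub : ∀ x ∈ {z ∈ S.carrier | f z = r}, x - x₀ ∈ Submodule.span ℝ (range w) :=
      fun x hx => hw _ (vsub_mem_vectorSpan ℝ hx.1 hx₀.1) (by rw [map_sub, hx.2, hx₀.2, sub_self])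
    rw [volume_proj_image π w x₀ hsub, volume_proj_image π₀ w x₀ hsub, hπ₀]
    simp

/-- The supremum commutes with the integral because `π` enters the integrand only through a factor
independent of `r`. -/
theorem lintegral_projVolume_level (S : OrientedPolyhedron X (k + 1)) (f : X →L[ℝ] ℝ) :
    ∫⁻ r, projVolume k {z ∈ S.carrier | f z = r} =
      ⨆ π : {π : Fin k → X →L[ℝ] ℝ // ∀ i, ‖π i‖ = 1},
        volume (proj (Fin.cons f π.1 : Fin (k + 1) → X →L[ℝ] ℝ) '' S.carrier) := by
  refine le_antisymm ?_ (iSup_le fun π => ?_)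
  swap
  · rw [← lintegral_volume_level f π.1 S.isCompact]
    exact lintegral_mono fun r => le_projVolume π.2 _
  have hreg := ae_isRegularLevel S.isPolyhedron f
  by_cases hex : ∃ r, IsRegularLevel S.carrier f r ∧ ∃ z ∈ S.carrier, f z = r
  · obtain ⟨r, hr, z, hz, hzr⟩ := hex
    obtain ⟨T, -, hT, -⟩ := exists_level_polyhedron S hr hz hzr
    obtain ⟨π₀, hπ₀⟩ := exists_minor_eq_one T.linearIndependent
    have h1 : ∀ r, projVolume k {z ∈ S.carrier | f z = r} =
        (⨆ π : {π : Fin k → X →L[ℝ] ℝ // ∀ i, ‖π i‖ = 1}, ENNReal.ofReal |minor π.1 T.frame|) *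
          volume (proj π₀ '' {z ∈ S.carrier | f z = r}) := by
      intro r
      rw [projVolume, ENNReal.iSup_mul]
      exact iSup_congr fun π => volume_proj_level_eq hT hπ₀ π.1 r
    simp_rw [h1]
    rw [lintegral_const_mul _ (measurable_volume_level f π₀ S.isCompact), ENNReal.iSup_mul]
    refine iSup_mono fun π => ?_
    rw [← lintegral_const_mul _ (measurable_volume_level f π₀ S.isCompact),
      ← lintegral_volume_level f π.1 S.isCompact]
    exact (lintegral_congr fun r => volume_proj_level_eq hT hπ₀ π.1 r).ge
  · push Not at hex
    have h0 : ∀ᵐ r, projVolume k {z ∈ S.carrier | f z = r} = 0 := by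
      filter_upwards [hreg] with r hr
      have : {z ∈ S.carrier | f z = r} = ∅ := by
        ext z
        simpa using hex r hr z
      simp [projVolume, this]
    rw [lintegral_congr_ae h0, lintegral_zero]
    exact zero_le

/-- The projected volume of a simple chain is bounded by that of any of its representations. -/
theorem volume_proj_le_sum {T : OrientedPolyhedron X k} {g : G} {Q : FormalSum X G k}
    (h : Q.toChain = FormalSum.toChain (Finsupp.single T g)) (π : Fin k → X →L[ℝ] ℝ) :
    ‖g‖ₑ * volume (proj π '' T.carrier) ≤
      ∑ S ∈ Q.support, ‖Q S‖ₑ * volume (proj π '' S.carrier) := by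
  classical
  by_cases hm : minor π T.frame = 0
  · have := eventually_notMem_generic.1 (T.eventually_notMem_of_minor_eq_zero hm)
    simp [this]
  have hind : ∀ (S : OrientedPolyhedron X k) (c : ℝ≥0∞), c * volume (proj π '' S.carrier) =
      ∫⁻ y, (proj π '' S.carrier).indicator (fun _ => c) y := fun S c => by
    rw [lintegral_indicator_const (S.measurableSet_proj_image π)]
  rw [hind T]
  simp_rw [hind]
  rw [← lintegral_finsetSum _ fun S _ => measurable_const.indicator (S.measurableSet_proj_image π)]
  refine lintegral_mono_ae ?_
  have hev := eventually_generic.1 (density_eq_of_toChain_eq π h)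
  filter_upwards [hev] with y hy
  by_cases hyT : y ∈ proj π '' T.carrier
  · obtain ⟨x, hx, hxy⟩ := id hyT
    have hd := hy x hxy
    rw [density_single, if_pos hx] at hd
    rw [indicator_of_mem hyT, ← enorm_signSmul hm g, ← hd, density_apply, Finsupp.sum]
    refine (enorm_sum_le _ _).trans (Finset.sum_le_sum fun S _ => ?_)
    split_ifs with hxS
    · rw [indicator_of_mem (show y ∈ proj π '' S.carrier from ⟨x, hxS, hxy⟩)]
      exact enorm_signSmul_le _ _
    · simp
  · rw [indicator_of_notMem hyT]
    exact zero_le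

theorem isDisjointSum_single (T : OrientedPolyhedron X k) (g : G) :
    IsDisjointSum (Finsupp.single T g : FormalSum X G k) := by
  intro S hS S' hS' hne
  rw [Finset.mem_coe] at hS hS'
  exact absurd ((Finset.mem_singleton.1 (Finsupp.support_single_subset hS)).trans
    (Finset.mem_singleton.1 (Finsupp.support_single_subset hS')).symm) hne

/-- The single summand is itself a disjoint representation; for any other one, every projection
gives the lower bound through `volume_proj_le_sum`. -/
theorem massOfSimple_single {m : OrientedPolyhedron X k → G → ℝ≥0∞}
    (hm : ∀ S g, m S g = ‖g‖ₑ * projVolume k S.carrier) (T : OrientedPolyhedron X k) (g : G) :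
    massOfSimple m (FormalSum.toChain (Finsupp.single T g)) = ‖g‖ₑ * projVolume k T.carrier := by
  refine le_antisymm ?_ (le_iInf₂ fun Q hQ => ?_)
  · refine (iInf₂_le (Finsupp.single T g) ⟨isDisjointSum_single T g, rfl⟩).trans ?_
    rw [Finsupp.sum_single_index, hm]
    rw [hm]
    simp
  · rw [projVolume, ENNReal.mul_iSup]
    refine iSup_le fun π => (volume_proj_le_sum hQ.2 π.1).trans ?_
    rw [Finsupp.sum]
    refine Finset.sum_le_sum fun S _ => ?_
    rw [hm]
    exact mul_le_mul_right (le_projVolume π.2 _) _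

theorem massOfSimple_zero (m : OrientedPolyhedron X k → G → ℝ≥0∞) : massOfSimple m 0 = 0 := by
  refine le_antisymm ((iInf₂_le 0 ⟨fun S hS => by simp at hS, rfl⟩).trans ?_) (zero_le)
  rw [Finsupp.sum_zero_index]

theorem massOfSimple_slice {m : OrientedPolyhedron X k → G → ℝ≥0∞}
    (hm : ∀ S g, m S g = ‖g‖ₑ * projVolume k S.carrier) (S : OrientedPolyhedron X (k + 1)) (g : G)
    {f : X →L[ℝ] ℝ} {r : ℝ} (hr : IsRegularLevel S.carrier f r) :
    massOfSimple m (slice f r (Finsupp.single S g)).toChain =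
      ‖g‖ₑ * projVolume k {z ∈ S.carrier | f z = r} := by
  rcases {z ∈ S.carrier | f z = r}.eq_empty_or_nonempty with he | ⟨z, hz, hzr⟩
  · rw [toChain_slice_eq_zero S hr g he, massOfSimple_zero, he]
    simp [projVolume]
  · obtain ⟨T, hT, -, c, hc, hcT⟩ := exists_level_polyhedron S hr hz hzr
    rw [exists_toChain_slice_eq S hr g hT hc hcT, massOfSimple_single hm, enorm_signSmul hc, hT]

/-- The mass of a simple chain is its norm times the projected volume. -/
theorem simpleMass_eq (k : ℕ) (S : OrientedPolyhedron X k) (g : G) :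
    simpleMass k S g = ‖g‖ₑ * projVolume k S.carrier := by
  induction k generalizing g with
  | zero => rw [simpleMass, projVolume_zero S.nonempty, mul_one]
  | succ k ih =>
    have hf : ∀ f : X →L[ℝ] ℝ,
        ∫⁻ r, massOfSimple (simpleMass k) (slice f r (Finsupp.single S g)).toChain =
          ‖g‖ₑ * ⨆ π : {π : Fin k → X →L[ℝ] ℝ // ∀ i, ‖π i‖ = 1},
            volume (proj (Fin.cons f π.1 : Fin (k + 1) → X →L[ℝ] ℝ) '' S.carrier) := by
      intro f
      rw [← lintegral_projVolume_level, ← lintegral_const_mul' _ _ enorm_ne_top]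
      refine lintegral_congr_ae ?_
      filter_upwards [ae_isRegularLevel S.isPolyhedron f] with r hr
      exact massOfSimple_slice ih S g hr
    rw [simpleMass]
    simp_rw [hf]
    -- The functional `f` of the mass is the first component of a projection to `ℝᵏ⁺¹`, and the
    -- remaining ones come from the slice.
    refine le_antisymm (iSup₂_le fun f hf1 => mul_le_mul_right (iSup_le fun π => ?_) _) ?_
    · exact le_projVolume (Fin.cases hf1 π.2) _
    · rw [projVolume, ENNReal.mul_iSup]
      refine iSup_le fun π => ?_
      refine le_trans ?_ (le_iSup₂ (π.1 0) (π.2 0))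
      refine mul_le_mul_right ?_ _
      refine le_trans ?_ (le_iSup _ ⟨Fin.tail π.1, fun i => π.2 i.succ⟩)
      rw [Fin.cons_self_tail]

/-! ### Sums over the fibres of a projection -/

/-- A polyhedron on which `π` is nondegenerate meets the fibre in at most one point, so it
contributes at most once. -/
theorem enorm_sum_density_le (π : Fin k → X →L[ℝ] ℝ) {y : Fin k → ℝ} {U : Set X} (Z : Finset X)
    (hZ : ∀ x ∈ Z, x ∈ U ∧ proj π x = y) (P : FormalSum X G k) :
    ‖∑ x ∈ Z, density π x P‖ₑ ≤
      ∑ S ∈ P.support, (proj π '' (S.carrier ∩ U)).indicator (fun _ => ‖P S‖ₑ) y := by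
  classical
  simp_rw [density_apply, Finsupp.sum]
  rw [Finset.sum_comm]
  refine (enorm_sum_le _ _).trans (Finset.sum_le_sum fun S _ => ?_)
  by_cases hm : minor π S.frame = 0
  · simp [hm]
  by_cases hx : ∃ x ∈ Z, x ∈ S.carrier
  · obtain ⟨x, hxZ, hxS⟩ := hx
    rw [Finset.sum_eq_single_of_mem x hxZ, if_pos hxS, enorm_signSmul hm,
      indicator_of_mem (show y ∈ proj π '' (S.carrier ∩ U) from
        ⟨x, ⟨hxS, (hZ x hxZ).1⟩, (hZ x hxZ).2⟩)]
    intro x' hx'Z hne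
    refine if_neg fun hx'S => hne (S.injOn_proj hm hx'S hxS ?_)
    rw [(hZ x' hx'Z).2, (hZ x hxZ).2]
  · push Not at hx
    rw [Finset.sum_eq_zero fun x hxZ => if_neg (hx x hxZ), enorm_zero]
    exact zero_le

/-- The fibre of a polyhedron over `y` is a segment. -/
theorem exists_fiber_segment (S : OrientedPolyhedron X (k + 1)) (π : Fin k → X →L[ℝ] ℝ)
    {e : X →L[ℝ] ℝ} (hd : fiberDir π S.frame ≠ 0)
    (he : e (fiberDir π S.frame) = ‖fiberDir π S.frame‖) (y : Fin k → ℝ)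
    (hy : ∃ x ∈ S.carrier, proj π x = y) :
    ∃ p q : X, (p ∈ S.carrier ∧ proj π p = y) ∧ (q ∈ S.carrier ∧ proj π q = y) ∧
      (∀ x ∈ S.carrier, proj π x = y → e p ≤ e x ∧ e x ≤ e q) ∧
      ∀ x ∈ S.carrier, ∀ x' ∈ S.carrier, proj π x = y → proj π x' = y →
        ∃ c : ℝ, x' = x + c • fiberDir π S.frame ∧
          e x' = e x + c * ‖fiberDir π S.frame‖ := by
  have hK : IsCompact {x ∈ S.carrier | proj π x = y} :=
    S.isCompact.inter_right (isClosed_eq (proj π).continuous continuous_const)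
  obtain ⟨p, hp, hpmin⟩ := hK.exists_isMinOn hy e.continuous.continuousOn
  obtain ⟨q, hq, hqmax⟩ := hK.exists_isMaxOn hy e.continuous.continuousOn
  refine ⟨p, q, hp, hq, fun x hx hxy => ⟨hpmin ⟨hx, hxy⟩, hqmax ⟨hx, hxy⟩⟩, ?_⟩
  intro x hx x' hx' hxy hx'y
  obtain ⟨c, hc⟩ := exists_smul_fiberDir hd (S.sub_mem_span hx' hx)
    (by rw [map_sub, hxy, hx'y, sub_self])
  have hx'' : x' = x + c • fiberDir π S.frame := by rw [← hc]; abel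
  exact ⟨c, hx'', by rw [hx'', map_add, map_smul, he, smul_eq_mul]⟩

/-- The fibre density is carried by the end points of the fibres, whose lengths are controlled by
the projected volume. -/
theorem exists_fiber_endpoints (S : OrientedPolyhedron X (k + 1)) {π : Fin k → X →L[ℝ] ℝ}
    (hπ : ∀ i, ‖π i‖ = 1) :
    ∃ ρ : (Fin k → ℝ) → ℝ≥0∞, Measurable ρ ∧ ∫⁻ y, ρ y ≤ projVolume (k + 1) S.carrier ∧
      ∀ y, ∃ p q : X, (p = q ∨ proj π p = y ∧ proj π q = y) ∧ ENNReal.ofReal ‖q - p‖ ≤ ρ y ∧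
        ∀ x, proj π x = y → ∀ g : G, (open Classical in
          fiberDensity π x (Finsupp.single S g) =
            (if x = q then g else 0) - if x = p then g else 0) := by
  classical
  set d := fiberDir π S.frame with hd
  by_cases hd0 : d = 0
  -- The dummy end points `p = q` make the right side vanish, and both germ terms agree for `d = 0`.
  · refine ⟨0, measurable_zero, by simp, fun y => ⟨0, 0, Or.inl rfl, by simp, fun x _ g => ?_⟩⟩
    rw [fiberDensity_single, ← hd, hd0, neg_zero, sub_self, sub_self]
  -- The norm-one functional `e` measures length along the fibres. Together with `π` it is
  -- admissible in `projVolume (k + 1)`, which bounds the integral of the lengths.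
  obtain ⟨e, he1, he⟩ := exists_dual_vector ℝ d (norm_ne_zero_iff.2 hd0)
  replace he : e d = ‖d‖ := he
  have hdpos : 0 < ‖d‖ := norm_pos_iff.2 hd0
  have hmeas := measurableSet_image_cons (f := e) (π := π) S.isCompact
  refine ⟨fun y => volume {s : ℝ | ∃ z ∈ S.carrier, e z = s ∧ proj π z = y},
    measurable_measure_prodMk_right hmeas, ?_, fun y => ?_⟩
  · have : ∫⁻ y, volume {s : ℝ | ∃ z ∈ S.carrier, e z = s ∧ proj π z = y} =
        volume (proj (Fin.cons e π : Fin (k + 1) → X →L[ℝ] ℝ) '' S.carrier) := by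
      rw [volume_image_cons e π S.isCompact, Measure.volume_eq_prod,
        Measure.prod_apply_symm hmeas]
      rfl
    rw [this]
    exact le_projVolume (Fin.cases he1 hπ) _
  have hgerm : ∀ x e', HasGerm S.carrier x e' → x ∈ S.carrier := fun x e' h =>
    ((hasGerm_iff S.convex S.isClosed).1 h).1
  by_cases hy : ∃ x ∈ S.carrier, proj π x = y
  swap
  · push Not at hy
    refine ⟨0, 0, Or.inl rfl, by simp, fun x hx g => ?_⟩
    rw [fiberDensity_single, if_neg fun h => hy x (hgerm x _ h) hx,
      if_neg fun h => hy x (hgerm x _ h) hx, sub_self, sub_self]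
  obtain ⟨p, q, ⟨hp, hpy⟩, ⟨hq, hqy⟩, hpq, hline⟩ := exists_fiber_segment S π hd0 he y hy
  rw [← hd] at hline
  have hepq := (hpq p hp hpy).2
  refine ⟨p, q, Or.inr ⟨hpy, hqy⟩, ?_, fun x hx g => ?_⟩
  · obtain ⟨c, hc, hec⟩ := hline p hp q hq hpy hqy
    have hc0 : 0 ≤ c := by
      by_contra hcon
      push Not at hcon
      have := mul_neg_of_neg_of_pos hcon hdpos
      linarith
    have hnorm : ‖q - p‖ = e q - e p := by
      rw [hec, hc, add_sub_cancel_left, norm_smul, Real.norm_of_nonneg hc0]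
      ring
    rw [hnorm, ← Real.volume_Icc]
    refine measure_mono fun s hs => ?_
    have hsub : Icc (e p) (e q) ⊆ e '' segment ℝ p q := by
      rw [show e '' segment ℝ p q = segment ℝ (e p) (e q) from
        image_segment ℝ (e : X →ₗ[ℝ] ℝ).toAffineMap p q]
      rw [segment_eq_Icc hepq]
    obtain ⟨z, hz, hzs⟩ := hsub hs
    refine ⟨z, S.convex.segment_subset hp hq hz, hzs, ?_⟩
    obtain ⟨a, b, -, -, hab, rfl⟩ := hz
    rw [map_add, map_smul, map_smul, hpy, hqy, ← add_smul, hab, one_smul]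
  · rw [fiberDensity_single]
    by_cases hxS : x ∈ S.carrier
    swap
    · rw [if_neg fun h => hxS (hgerm x _ h), if_neg fun h => hxS (hgerm x _ h),
        if_neg (ne_of_mem_of_not_mem hq hxS).symm, if_neg (ne_of_mem_of_not_mem hp hxS).symm]
    have hfwd : HasGerm S.carrier x d ↔ x ≠ q := by
      rw [hasGerm_iff S.convex S.isClosed]
      constructor
      · rintro ⟨-, t, ht0, ht⟩ rfl
        have h1 := (hpq _ ht (by rw [map_add, map_smul, hd, proj_fiberDir, smul_zero, add_zero,
          hx])).2
        rw [map_add, map_smul, he, smul_eq_mul] at h1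
        have := mul_pos ht0 hdpos
        linarith
      · intro hne
        obtain ⟨c, hc, hec⟩ := hline x hxS q hq hx hqy
        have h1 := (hpq x hxS hx).2
        refine ⟨hxS, c, ?_, hc ▸ hq⟩
        by_contra hcon
        push Not at hcon
        rcases hcon.lt_or_eq with h | h
        · have := mul_neg_of_neg_of_pos h hdpos
          linarith
        · rw [h, zero_smul, add_zero] at hc
          exact hne hc.symm
    have hbwd : HasGerm S.carrier x (-d) ↔ x ≠ p := by
      rw [hasGerm_iff S.convex S.isClosed]
      constructor
      · rintro ⟨-, t, ht0, ht⟩ rfl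
        have h1 := (hpq _ ht (by rw [map_add, map_smul, map_neg, hd, proj_fiberDir, neg_zero,
          smul_zero, add_zero, hx])).1
        rw [map_add, map_smul, map_neg, he, smul_eq_mul] at h1
        have := mul_pos ht0 hdpos
        linarith
      · intro hne
        obtain ⟨c, hc, hec⟩ := hline p hp x hxS hpy hx
        have h1 := (hpq x hxS hx).1
        refine ⟨hxS, c, ?_, ?_⟩
        · by_contra hcon
          push Not at hcon
          rcases hcon.lt_or_eq with h | h
          · have := mul_neg_of_neg_of_pos h hdpos
            linarith
          · rw [h, zero_smul, add_zero] at hc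
            exact hne hc
        · rw [hc, smul_neg, add_neg_cancel_right]
          exact hp
    rw [hfwd, hbwd]
    simp only [ne_eq]
    split_ifs <;> simp

/-- The contributions of the two ends cancel unless exactly one of them lies strictly below `t`;
this half-open condition is membership in `uIoc`. -/
theorem sum_sub_ite_le {h : X → ℝ} {t : ℝ} (Z : Finset X) {p q : X} {y : Fin k → ℝ}
    {π : Fin k → X →L[ℝ] ℝ} (hpq : p = q ∨ proj π p = y ∧ proj π q = y)
    (hp : p ∈ Z ↔ proj π p = y ∧ h p < t) (hq : q ∈ Z ↔ proj π q = y ∧ h q < t) (g : G) :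
    (open Classical in ‖∑ x ∈ Z, ((if x = q then g else 0) - if x = p then g else 0)‖ₑ) ≤
      (uIoc (h p) (h q)).indicator (fun _ => ‖g‖ₑ) t := by
  classical
  rw [Finset.sum_sub_distrib, Finset.sum_ite_eq', Finset.sum_ite_eq']
  rcases hpq with rfl | ⟨hpy, hqy⟩
  · simp
  simp only [hpy, hqy, true_and] at hp hq
  by_cases h1 : h p < t <;> by_cases h2 : h q < t
  · simp [hp, hq, h1, h2]
  · rw [indicator_of_mem (mem_uIoc.2 (Or.inl ⟨h1, not_lt.1 h2⟩))]
    simp [hp, hq, h1, h2]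
  · rw [indicator_of_mem (mem_uIoc.2 (Or.inr ⟨h2, not_lt.1 h1⟩))]
    simp [hp, hq, h1, h2]
  · simp [hp, hq, h1, h2]

/-- The estimate on a single fibre at a single level of `h`. -/
theorem enorm_le_of_fiber {π : Fin k → X →L[ℝ] ℝ} {h : X → ℝ} {δ t : ℝ} (ht0 : 0 < t)
    (htδ : t ≤ δ) {P₀ P R : FormalSum X G k} {Q : FormalSum X G (k + 1)}
    {S₀ : OrientedPolyhedron X k} (hm : minor π S₀.frame ≠ 0)
    (hsep : ∀ T ∈ P₀.support, T ≠ S₀ → ∀ x ∈ T.carrier, δ < h x) {x₀ : X} (hx₀ : x₀ ∈ S₀.carrier)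
    (hhx₀ : h x₀ ≤ 0) {y : Fin k → ℝ} (hx₀y : proj π x₀ = y)
    (hgen : ∀ x, proj π x = y →
      density π x P₀ = density π x P + density π x R - fiberDensity π x Q)
    {p q : OrientedPolyhedron X (k + 1) → X}
    (hpq : ∀ S, p S = q S ∨ proj π (p S) = y ∧ proj π (q S) = y)
    (hfib : ∀ S x, proj π x = y → ∀ g : G, (open Classical in
      fiberDensity π x (Finsupp.single S g) =
        (if x = q S then g else 0) - if x = p S then g else 0)) :
    ‖P₀ S₀‖ₑ ≤
      ∑ S ∈ P.support, (proj π '' (S.carrier ∩ {x | h x ≤ δ})).indicator (fun _ => ‖P S‖ₑ) y +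
      ∑ S ∈ R.support, (proj π '' S.carrier).indicator (fun _ => ‖R S‖ₑ) y +
      ∑ S ∈ Q.support, (uIoc (h (p S)) (h (q S))).indicator (fun _ => ‖Q S‖ₑ) t := by
  classical
  -- The density identity holds at every point of the fibre, so it may be summed over any finite
  -- set. This one contains `x₀` and every end point of a segment of `Q` that lies below the level
  -- `t`.
  let Z : Finset X := (insert x₀ (Q.support.image p ∪ Q.support.image q)).filter
    fun x => proj π x = y ∧ h x < t
  have hZ : ∀ x ∈ Z, proj π x = y ∧ h x < t := fun x hx => (Finset.mem_filter.1 hx).2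
  have hx₀Z : x₀ ∈ Z :=
    Finset.mem_filter.2 ⟨Finset.mem_insert_self _ _, hx₀y, hhx₀.trans_lt ht0⟩
  have hleft : ∑ x ∈ Z, density π x P₀ = signSmul (minor π S₀.frame) (P₀ S₀) := by
    have hx : ∀ x ∈ Z, density π x P₀ =
        if x ∈ S₀.carrier then signSmul (minor π S₀.frame) (P₀ S₀) else 0 := by
      intro x hxZ
      rw [density_apply, Finsupp.sum]
      refine Finset.sum_eq_single S₀ (fun T hT hne => if_neg fun hxT => ?_) fun h0 => ?_
      · have := hsep T hT hne x hxT
        have := (hZ x hxZ).2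
        linarith
      · rw [Finsupp.notMem_support_iff.1 h0]
        simp
    rw [Finset.sum_congr rfl hx, Finset.sum_eq_single_of_mem x₀ hx₀Z, if_pos hx₀]
    intro x hxZ hne
    exact if_neg fun hxS => hne (S₀.injOn_proj hm hxS hx₀ (by rw [(hZ x hxZ).1, hx₀y]))
  have hsum : ∑ x ∈ Z, density π x P₀ = ∑ x ∈ Z, density π x P + ∑ x ∈ Z, density π x R -
      ∑ x ∈ Z, fiberDensity π x Q := by
    rw [← Finset.sum_add_distrib, ← Finset.sum_sub_distrib]
    exact Finset.sum_congr rfl fun x hx => hgen x (hZ x hx).1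
  have hP := enorm_sum_density_le π (y := y) (U := {x | h x ≤ δ}) Z
    (fun x hx => ⟨((hZ x hx).2.trans_le htδ).le, (hZ x hx).1⟩) P
  have hR := enorm_sum_density_le π (y := y) (U := univ) Z
    (fun x hx => ⟨mem_univ x, (hZ x hx).1⟩) R
  simp only [inter_univ] at hR
  have hQ : ‖∑ x ∈ Z, fiberDensity π x Q‖ₑ ≤
      ∑ S ∈ Q.support, (uIoc (h (p S)) (h (q S))).indicator (fun _ => ‖Q S‖ₑ) t := by
    have hx : ∀ x ∈ Z, fiberDensity π x Q = ∑ S ∈ Q.support,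
        ((if x = q S then Q S else 0) - if x = p S then Q S else 0) := by
      intro x hxZ
      conv_lhs => rw [← Q.sum_single]
      rw [Finsupp.sum, map_sum]
      exact Finset.sum_congr rfl fun S _ => hfib S x (hZ x hxZ).1 _
    rw [Finset.sum_congr rfl hx, Finset.sum_comm]
    refine (enorm_sum_le _ _).trans (Finset.sum_le_sum fun S hS => ?_)
    refine sum_sub_ite_le Z (hpq S) ?_ ?_ _
    · rw [Finset.mem_filter, and_iff_right]
      exact Finset.mem_insert_of_mem (Finset.mem_union_left _ (Finset.mem_image_of_mem _ hS))
    · rw [Finset.mem_filter, and_iff_right]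
      exact Finset.mem_insert_of_mem (Finset.mem_union_right _ (Finset.mem_image_of_mem _ hS))
  rw [← enorm_signSmul hm (P₀ S₀), ← hleft, hsum]
  calc _ ≤ ‖∑ x ∈ Z, density π x P + ∑ x ∈ Z, density π x R‖ₑ +
        ‖∑ x ∈ Z, fiberDensity π x Q‖ₑ := enorm_sub_le
    _ ≤ ‖∑ x ∈ Z, density π x P‖ₑ + ‖∑ x ∈ Z, density π x R‖ₑ +
        ‖∑ x ∈ Z, fiberDensity π x Q‖ₑ := by gcongr; exact enorm_add_le _ _
    _ ≤ _ := by gcongr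

/-- The fibre estimate, integrated over the levels of `h` and over the fibres. -/
theorem local_estimate {π : Fin k → X →L[ℝ] ℝ} (hπ : ∀ i, ‖π i‖ = 1) {h : X → ℝ}
    (hh : LipschitzWith 1 h) {δ : ℝ} {P₀ P R : FormalSum X G k}
    {Q : FormalSum X G (k + 1)} {S₀ : OrientedPolyhedron X k}
    (hsep : ∀ T ∈ P₀.support, T ≠ S₀ → ∀ x ∈ T.carrier, δ < h x) {C : Set (Fin k → ℝ)}
    (hC : MeasurableSet C) (hCS : C ⊆ proj π '' {x ∈ S₀.carrier | h x ≤ 0})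
    (hgen : ∀ᶠ x in generic π,
      density π x P₀ = density π x P + density π x R - fiberDensity π x Q) :
    ENNReal.ofReal δ * (‖P₀ S₀‖ₑ * volume C) ≤
      ENNReal.ofReal δ *
        (∑ S ∈ P.support, ‖P S‖ₑ * volume (proj π '' (S.carrier ∩ {x | h x ≤ δ})) +
          ∑ S ∈ R.support, ‖R S‖ₑ * volume (proj π '' S.carrier)) +
      ∑ S ∈ Q.support, ‖Q S‖ₑ * projVolume (k + 1) S.carrier := by
  classical
  by_cases hm : minor π S₀.frame = 0
  · have hzero : volume C = 0 := by
      refine measure_mono_null (hCS.trans (image_mono fun x hx => hx.1)) ?_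
      exact eventually_notMem_generic.1 (S₀.eventually_notMem_of_minor_eq_zero hm)
    simp [hzero]
  choose ρ hρm hρ hρy using fun S : OrientedPolyhedron X (k + 1) =>
    exists_fiber_endpoints (G := G) S hπ
  choose p q hpq hlen hfib using hρy
  have hmeasP : ∀ S : OrientedPolyhedron X k,
      MeasurableSet (proj π '' (S.carrier ∩ {x | h x ≤ δ})) := fun S =>
    ((S.isCompact.inter_right (isClosed_le hh.continuous continuous_const)).image
      (proj π).continuous).measurableSet
  have hpoint : ∀ᵐ y, C.indicator (fun _ => ENNReal.ofReal δ * ‖P₀ S₀‖ₑ) y ≤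
      ENNReal.ofReal δ *
        (∑ S ∈ P.support, (proj π '' (S.carrier ∩ {x | h x ≤ δ})).indicator (fun _ => ‖P S‖ₑ) y +
          ∑ S ∈ R.support, (proj π '' S.carrier).indicator (fun _ => ‖R S‖ₑ) y) +
      ∑ S ∈ Q.support, ‖Q S‖ₑ * ρ S y := by
    filter_upwards [eventually_generic.1 hgen] with y hy
    by_cases hyC : y ∈ C
    swap
    · rw [indicator_of_notMem hyC]
      exact zero_le
    rw [indicator_of_mem hyC]
    obtain ⟨x₀, ⟨hx₀, hhx₀⟩, hx₀y⟩ := hCS hyC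
    set a := ∑ S ∈ P.support,
      (proj π '' (S.carrier ∩ {x | h x ≤ δ})).indicator (fun _ => ‖P S‖ₑ) y +
        ∑ S ∈ R.support, (proj π '' S.carrier).indicator (fun _ => ‖R S‖ₑ) y with ha
    -- Integration over the levels yields the factor `δ`, while each segment of `Q` costs at most
    -- `|h q - h p| ≤ ‖q - p‖` because `h` is `1`-Lipschitz.
    have hint : ∫⁻ _ in Ioc 0 δ, ‖P₀ S₀‖ₑ ≤ ∫⁻ t in Ioc 0 δ, (a + ∑ S ∈ Q.support,
        (uIoc (h (p S y)) (h (q S y))).indicator (fun _ => ‖Q S‖ₑ) t) := by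
      refine setLIntegral_mono' measurableSet_Ioc fun t ht => ?_
      exact enorm_le_of_fiber ht.1 ht.2 hm hsep hx₀ hhx₀ hx₀y hy (fun S => hpq S y)
        (fun S x hx g => hfib S y x hx g)
    rw [setLIntegral_const, lintegral_add_left measurable_const, setLIntegral_const,
      Real.volume_Ioc, sub_zero, lintegral_finsetSum _ fun S _ =>
        measurable_const.indicator measurableSet_uIoc] at hint
    rw [mul_comm]
    refine hint.trans ?_
    rw [mul_comm a]
    gcongr with S hS
    refine (setLIntegral_le_lintegral _ _).trans ?_
    rw [lintegral_indicator_const measurableSet_uIoc]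
    gcongr
    refine le_trans ?_ (hlen S y)
    rw [uIoc, Real.volume_Ioc, max_sub_min_eq_abs]
    refine ENNReal.ofReal_le_ofReal ?_
    have := hh.dist_le_mul (q S y) (p S y)
    rw [Real.dist_eq, dist_eq_norm] at this
    simpa using this
  have hI := lintegral_mono_ae hpoint
  rw [lintegral_indicator_const hC] at hI
  rw [← mul_assoc]
  refine hI.trans ?_
  have hm1 : ∀ S ∈ P.support, Measurable fun y =>
      (proj π '' (S.carrier ∩ {x | h x ≤ δ})).indicator (fun _ => ‖P S‖ₑ) y :=
    fun S _ => measurable_const.indicator (hmeasP S)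
  have hm2 : ∀ S ∈ R.support, Measurable fun y =>
      (proj π '' S.carrier).indicator (fun _ => ‖R S‖ₑ) y :=
    fun S _ => measurable_const.indicator (S.measurableSet_proj_image π)
  have hm3 : ∀ S ∈ Q.support, Measurable fun y => ‖Q S‖ₑ * ρ S y :=
    fun S _ => (hρm S).const_mul _
  have hm12 : Measurable fun y => ∑ S ∈ P.support,
      (proj π '' (S.carrier ∩ {x | h x ≤ δ})).indicator (fun _ => ‖P S‖ₑ) y +
        ∑ S ∈ R.support, (proj π '' S.carrier).indicator (fun _ => ‖R S‖ₑ) y :=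
    (Finset.measurable_fun_sum _ hm1).add (Finset.measurable_fun_sum _ hm2)
  rw [lintegral_add_right _ (Finset.measurable_fun_sum _ hm3), lintegral_const_mul _ hm12,
    lintegral_add_left (Finset.measurable_fun_sum _ hm1), lintegral_finsetSum _ hm1,
    lintegral_finsetSum _ hm2, lintegral_finsetSum _ hm3]
  gcongr with S hS S hS S hS
  · rw [lintegral_indicator_const (hmeasP S)]
  · rw [lintegral_indicator_const (S.measurableSet_proj_image π)]
  · rw [lintegral_const_mul _ (hρm S)]
    gcongr
    exact hρ S

/-- Projections of disjoint parts of a polyhedron. -/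
theorem sum_volume_proj_le {ι : Type*} (s : Finset ι) {π : ι → Fin k → X →L[ℝ] ℝ}
    (hπ : ∀ i ∈ s, ∀ j, ‖π i j‖ = 1) {U : ι → Set X} (hU : ∀ i ∈ s, IsClosed (U i))
    (hdisj : (s : Set ι).PairwiseDisjoint U) (S : OrientedPolyhedron X k) :
    ∑ i ∈ s, volume (proj (π i) '' (S.carrier ∩ U i)) ≤ projVolume k S.carrier := by
  obtain ⟨x₀, hx₀⟩ := S.nonempty
  -- In the coordinates of the frame every projection scales the same Lebesgue measure by its minor.
  -- One supremum of minors serves all parts, and disjoint parts add up.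
  set V : Set X → Set (Fin k → ℝ) := fun T => {t | x₀ + ∑ j, t j • S.frame j ∈ T} with hV
  have hcont : Continuous fun t : Fin k → ℝ => x₀ + ∑ j, t j • S.frame j := by fun_prop
  have hvol : projVolume k S.carrier =
      (⨆ π : {π : Fin k → X →L[ℝ] ℝ // ∀ i, ‖π i‖ = 1}, ENNReal.ofReal |minor π.1 S.frame|) *
        volume (V S.carrier) := by
    rw [projVolume, ENNReal.iSup_mul]
    exact iSup_congr fun π => S.volume_proj_image_subset π.1 hx₀ subset_rfl
  rw [hvol]
  calc _ ≤ ∑ i ∈ s, (⨆ π : {π : Fin k → X →L[ℝ] ℝ // ∀ i, ‖π i‖ = 1},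
        ENNReal.ofReal |minor π.1 S.frame|) * volume (V (S.carrier ∩ U i)) := by
        refine Finset.sum_le_sum fun i hi => ?_
        rw [S.volume_proj_image_subset (π i) hx₀ inter_subset_left]
        gcongr
        exact le_iSup (fun π : {π : Fin k → X →L[ℝ] ℝ // ∀ i, ‖π i‖ = 1} =>
          ENNReal.ofReal |minor π.1 S.frame|) ⟨π i, hπ i hi⟩
    _ ≤ _ := by
        rw [← Finset.mul_sum]
        gcongr
        rw [← measure_biUnion_finset]
        · exact measure_mono (iUnion₂_subset fun i _ t ht => ht.1)
        · intro i hi j hj hij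
          exact Disjoint.preimage _ ((hdisj hi hj hij).mono inter_subset_right inter_subset_right)
        · intro i hi
          exact ((S.isClosed.inter (hU i hi)).preimage hcont).measurableSet

/-! ### Separation of the summands of a chain -/

/-- A compact set has a nonnegative `1`-Lipschitz function vanishing on it whose small sublevel
sets are close to the set. -/
theorem exists_lipschitz_sublevel {Y : Type*} [PseudoMetricSpace Y] (K : Set Y) :
    ∃ h : Y → ℝ, LipschitzWith 1 h ∧ (∀ x ∈ K, h x ≤ 0) ∧
      ∀ δ : ℝ, 0 < δ → δ < 1 → {x | h x ≤ δ} ⊆ Metric.cthickening δ K := by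
  rcases K.eq_empty_or_nonempty with rfl | hne
  -- For empty `K` the constant `1` has empty sublevel sets, since `δ < 1`.
  · refine ⟨fun _ => 1, LipschitzWith.const' 1, by simp, fun δ _ h1 x hx => ?_⟩
    exact absurd (show (1 : ℝ) ≤ δ from hx) (not_le.2 h1)
  · refine ⟨fun x => Metric.infDist x K, Metric.lipschitz_infDist_pt K, fun x hx => ?_,
      fun δ hδ _ x hx => ?_⟩
    · exact (Metric.infDist_zero_of_mem hx).le
    · exact (ENNReal.le_ofReal_iff_toReal_le (Metric.infEDist_ne_top hne) hδ.le).2 hx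

/-- A compact set has disjoint thickenings from a disjoint closed set, and one `δ` serves the
finitely many pairs. As `K T` lies in `T`, the same thickenings separate the sublevel sets. -/
theorem exists_separating_functions {P₀ : FormalSum X G k}
    {K : OrientedPolyhedron X k → Set X} (hK : ∀ S ∈ P₀.support, IsCompact (K S))
    (hKS : ∀ S ∈ P₀.support, K S ⊆ S.carrier)
    (hKT : ∀ S ∈ P₀.support, ∀ T ∈ P₀.support, T ≠ S → Disjoint (K S) T.carrier) :
    ∃ (δ : ℝ) (h : OrientedPolyhedron X k → X → ℝ), 0 < δ ∧ (∀ S, LipschitzWith 1 (h S)) ∧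
      (∀ S, ∀ x ∈ K S, h S x ≤ 0) ∧
      (∀ S ∈ P₀.support, ∀ T ∈ P₀.support, T ≠ S → ∀ x ∈ T.carrier, δ < h S x) ∧
      (P₀.support : Set (OrientedPolyhedron X k)).PairwiseDisjoint fun S => {x | h S x ≤ δ} := by
  choose h hlip hzero hsub using fun S => exists_lipschitz_sublevel (K S)
  have hev : ∀ᶠ δ in 𝓝[>] (0 : ℝ), ∀ S ∈ P₀.support, ∀ T ∈ P₀.support, T ≠ S →
      Disjoint (Metric.cthickening δ (K S)) (Metric.cthickening δ T.carrier) := by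
    simp_rw [Filter.eventually_all_finset]
    intro S hS T hT
    by_cases hTS : T = S
    · simp [hTS]
    · obtain ⟨δ, hδ, hd⟩ := (hKT S hS T hT hTS).exists_cthickenings (hK S hS) T.isClosed
      filter_upwards [Ioo_mem_nhdsGT hδ] with δ' hδ' _
      exact hd.mono (Metric.cthickening_mono hδ'.2.le _) (Metric.cthickening_mono hδ'.2.le _)
  obtain ⟨δ, hδ, hδ0, hδ1⟩ := (hev.and (Ioo_mem_nhdsGT (one_pos (α := ℝ)))).exists
  refine ⟨δ, h, hδ0, hlip, hzero, fun S hS T hT hne x hx => ?_, fun S hS T hT hne => ?_⟩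
  · by_contra hcon
    push Not at hcon
    exact disjoint_left.1 (hδ S hS T hT hne) (hsub S δ hδ0 hδ1 hcon)
      (Metric.self_subset_cthickening _ hx)
  · refine (hδ S hS T hT hne.symm).mono (hsub S δ hδ0 hδ1) ((hsub T δ hδ0 hδ1).trans ?_)
    exact Metric.cthickening_subset_of_subset δ (hKS T hT)

/-! ### Lower semicontinuity -/

/-- Mass is an infimum over representations, so a lower bound may be tested on each of them. -/
theorem le_add_mul_mass {c a N : ℝ≥0∞} (hN0 : N ≠ 0) (hN : N ≠ ⊤) {P : PolyhedralChain X G k}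
    (h : ∀ Q : FormalSum X G k, Q.toChain = P →
      c ≤ a + N * ∑ S ∈ Q.support, ‖Q S‖ₑ * projVolume k S.carrier) : c ≤ a + N * mass P := by
  rw [mass, massOfSimple, iInf_subtype', ENNReal.mul_iInf_of_ne hN0 hN, ENNReal.add_iInf]
  refine le_iInf fun Q => ?_
  have := h Q.1 Q.2.2
  simpa only [Finsupp.sum, simpleMass_eq] using this

/-- The lower bound for the mass of a chain in terms of the flat distance to a chain with disjoint
summands. -/
theorem exists_le_mass_add_flatNorm {P₀ : FormalSum X G k}
    {π : OrientedPolyhedron X k → Fin k → X →L[ℝ] ℝ} (hπ : ∀ S ∈ P₀.support, ∀ i, ‖π S i‖ = 1)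
    {C : OrientedPolyhedron X k → Set (Fin k → ℝ)} (hC : ∀ S ∈ P₀.support, IsCompact (C S))
    (hCS : ∀ S ∈ P₀.support, C S ⊆ proj (π S) '' S.carrier)
    (hCT : ∀ S ∈ P₀.support, ∀ T ∈ P₀.support, T ≠ S →
      Disjoint (C S) (proj (π S) '' (S.carrier ∩ T.carrier))) :
    ∃ N : ℝ≥0∞, N ≠ ⊤ ∧ ∀ P : PolyhedralChain X G k,
      ∑ S ∈ P₀.support, ‖P₀ S‖ₑ * volume (C S) ≤ mass P + N * flatNorm (P - P₀.toChain) := by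
  obtain ⟨δ, h, hδ, hlip, hzero, hsep, hdisj⟩ := exists_separating_functions
    (P₀ := P₀) (K := fun S => S.carrier ∩ proj (π S) ⁻¹' C S)
    (fun S hS => S.isCompact.inter_right ((hC S hS).isClosed.preimage (proj (π S)).continuous))
    (fun S _ => inter_subset_left)
    (fun S hS T hT hne => disjoint_left.2 fun x hx hxT =>
      disjoint_left.1 (hCT S hS T hT hne) hx.2 ⟨x, ⟨hx.1, hxT⟩, rfl⟩)
  set D := ENNReal.ofReal δ with hD
  have hD0 : D ≠ 0 := by simpa [hD] using hδ
  have hDt : D ≠ ⊤ := ENNReal.ofReal_ne_top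
  set n : ℝ≥0∞ := (P₀.support.card : ℝ≥0∞) with hn
  have hnt : n ≠ ⊤ := ENNReal.natCast_ne_top _
  -- `R` will be counted `n` times and `Q` with weight `n / δ`; the summand `1` keeps `N` nonzero
  -- when there are no summands.
  set N : ℝ≥0∞ := 1 + n + D⁻¹ * n with hN
  have hN0 : N ≠ 0 := by simp [hN]
  have hNt : N ≠ ⊤ := by
    simp only [hN, ne_eq, ENNReal.add_eq_top, not_or]
    exact ⟨⟨ENNReal.one_ne_top, hnt⟩, ENNReal.mul_ne_top (ENNReal.inv_ne_top.2 hD0) hnt⟩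
  refine ⟨N, hNt, fun P => ?_⟩
  rw [flatNorm, ENNReal.mul_iInf_of_ne hN0 hNt, ENNReal.add_iInf]
  refine le_iInf fun Q => ?_
  rw [mul_add, ← add_assoc]
  refine le_add_mul_mass hN0 hNt fun R hR => ?_
  rw [add_right_comm]
  refine le_add_mul_mass hN0 hNt fun Q' hQ' => ?_
  rw [add_assoc, add_comm, ← one_mul (mass P)]
  refine le_add_mul_mass one_ne_zero ENNReal.one_ne_top fun P' hP' => ?_
  rw [one_mul]
  set mP := ∑ S ∈ P'.support, ‖P' S‖ₑ * projVolume k S.carrier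
  set mR := ∑ S ∈ R.support, ‖R S‖ₑ * projVolume k S.carrier
  set mQ := ∑ S ∈ Q'.support, ‖Q' S‖ₑ * projVolume (k + 1) S.carrier
  -- `R` represents `∂Q - (P - P₀)`, so this is `P₀ = P + R - ∂Q` in terms of densities.
  have hgen : ∀ π : Fin k → X →L[ℝ] ℝ, ∀ᶠ x in generic π,
      density π x P₀ = density π x P' + density π x R - fiberDensity π x Q' := by
    intro π
    have hchain : (P' + R).toChain = (P₀ + boundary Q).toChain := by
      rw [toChain_add, toChain_add, hP', hR]
      abel
    filter_upwards [density_eq_of_toChain_eq π hchain, density_boundary π Q,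
      fiberDensity_eq_of_toChain_eq π hQ'] with x h1 h2 h3
    rw [map_add, map_add] at h1
    rw [h1, h2, h3, add_sub_cancel_right]
  have hlocal : ∀ S ∈ P₀.support, D * (‖P₀ S‖ₑ * volume (C S)) ≤
      D * (∑ T ∈ P'.support,
        ‖P' T‖ₑ * volume (proj (π S) '' (T.carrier ∩ {x | h S x ≤ δ})) + mR) + mQ := by
    intro S hS
    refine (local_estimate (hπ S hS) (hlip S) (hsep S hS) (hC S hS).measurableSet ?_
      (hgen (π S))).trans ?_
    · intro y hy
      obtain ⟨x, hx, rfl⟩ := hCS S hS hy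
      exact ⟨x, ⟨hx, hzero S x ⟨hx, hy⟩⟩, rfl⟩
    · gcongr
      refine Finset.sum_le_sum fun T _ => ?_
      gcongr
      exact le_projVolume (hπ S hS) _
  -- The neighbourhoods of different summands are disjoint, so `P` is counted once in total, whereas
  -- `R` and `Q` may be counted for every summand.
  have hsum : D * ∑ S ∈ P₀.support, ‖P₀ S‖ₑ * volume (C S) ≤ D * (mP + n * mR) + n * mQ := by
    rw [Finset.mul_sum]
    refine (Finset.sum_le_sum hlocal).trans ?_
    rw [Finset.sum_add_distrib, ← Finset.mul_sum, Finset.sum_add_distrib, Finset.sum_const,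
      Finset.sum_const, nsmul_eq_mul, nsmul_eq_mul, Finset.sum_comm]
    gcongr
    refine Finset.sum_le_sum fun T _ => ?_
    rw [← Finset.mul_sum]
    gcongr
    exact sum_volume_proj_le _ hπ
      (fun S _ => isClosed_le (hlip S).continuous continuous_const) hdisj T
  calc ∑ S ∈ P₀.support, ‖P₀ S‖ₑ * volume (C S)
      = D⁻¹ * (D * ∑ S ∈ P₀.support, ‖P₀ S‖ₑ * volume (C S)) := by
        rw [← mul_assoc, ENNReal.inv_mul_cancel hD0 hDt, one_mul]
    _ ≤ D⁻¹ * (D * (mP + n * mR) + n * mQ) := by gcongr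
    _ = mP + n * mR + D⁻¹ * n * mQ := by
        rw [mul_add, ← mul_assoc, ENNReal.inv_mul_cancel hD0 hDt, one_mul, mul_assoc]
    _ ≤ mP + N * mR + N * mQ := by
        gcongr
        · rw [hN]
          exact (le_add_self).trans le_self_add
        · exact le_add_self
    _ = _ := by abel

theorem le_liminf_of_le_add {u ε : ℕ → ℝ≥0∞} {c : ℝ≥0∞} (h : ∀ j, c ≤ u j + ε j)
    (hε : Tendsto ε atTop (𝓝 0)) : c ≤ liminf u atTop := by
  have ht : Tendsto (fun j => c - ε j) atTop (𝓝 c) := by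
    simpa using ENNReal.Tendsto.sub (tendsto_const_nhds (x := c)) hε (Or.inr ENNReal.zero_ne_top)
  rw [← ht.liminf_eq]
  exact liminf_le_liminf (Eventually.of_forall fun j => tsub_le_iff_right.2 (h j))

/-- The projected volume of a summand of a disjoint sum is the supremum of the measures of compact
sets that avoid the other summands. -/
theorem exists_seq_compact {P₀ : FormalSum X G k} (hP₀ : IsDisjointSum P₀)
    {S : OrientedPolyhedron X k} (hS : S ∈ P₀.support) :
    ∃ (π : ℕ → Fin k → X →L[ℝ] ℝ) (C : ℕ → Set (Fin k → ℝ)), (∀ n i, ‖π n i‖ = 1) ∧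
      (∀ n, IsCompact (C n)) ∧ (∀ n, C n ⊆ proj (π n) '' S.carrier) ∧
      (∀ n, ∀ T ∈ P₀.support, T ≠ S →
        Disjoint (C n) (proj (π n) '' (S.carrier ∩ T.carrier))) ∧
      Tendsto (fun n => volume (C n)) atTop (𝓝 (projVolume k S.carrier)) := by
  let B : Set ℝ≥0∞ := {b | ∃ (π : Fin k → X →L[ℝ] ℝ) (C : Set (Fin k → ℝ)), (∀ i, ‖π i‖ = 1) ∧
    IsCompact C ∧ C ⊆ proj π '' S.carrier ∧ (∀ T ∈ P₀.support, T ≠ S →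
      Disjoint C (proj π '' (S.carrier ∩ T.carrier))) ∧ volume C = b}
  have hne : B.Nonempty := by
    -- `C = ∅` is admissible, but norm-one functionals must exist; the nonzero frame vectors provide
    -- them.
    choose π hπ _ using fun i => exists_dual_vector ℝ (S.frame i)
      (norm_ne_zero_iff.2 (S.linearIndependent.ne_zero i))
    exact ⟨0, π, ∅, hπ, isCompact_empty, empty_subset _, fun _ _ _ => empty_disjoint _, by simp⟩
  have hsup : sSup B = projVolume k S.carrier := by
    refine le_antisymm (sSup_le ?_) (iSup_le fun π => le_of_forall_lt fun b hb => ?_)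
    · rintro b ⟨π, C, hπ, -, hCS, -, rfl⟩
      exact (measure_mono hCS).trans (le_projVolume hπ _)
    · classical
      -- Disjointness of the summands makes `E` a null set, so inner regularity of the image without
      -- `E` loses no measure.
      set E := ⋃ T ∈ P₀.support.erase S, proj π.1 '' (S.carrier ∩ T.carrier) with hE
      have hE0 : volume E = 0 := by
        refine (measure_biUnion_null_iff (P₀.support.erase S).countable_toSet).2 fun T hT => ?_
        have hT' := Finset.mem_erase.1 hT
        exact eventually_notMem_generic.1
          (OrientedPolyhedron.eventually_notMem_inter (hP₀ hS hT'.2 (Ne.symm hT'.1)) π.1)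
      have hEm : MeasurableSet E := Finset.measurableSet_biUnion _ fun T _ =>
        ((S.isCompact.inter T.isCompact).image (proj π.1).continuous).measurableSet
      rw [← measure_sdiff_null hE0] at hb
      obtain ⟨C, hCsub, hC, hbC⟩ :=
        ((S.measurableSet_proj_image π.1).diff hEm).exists_lt_isCompact hb
      refine hbC.trans_le (le_sSup ⟨π.1, C, π.2, hC, hCsub.trans sdiff_subset, ?_, rfl⟩)
      intro T hT hTS
      refine disjoint_left.2 fun y hy hyT => (hCsub hy).2 ?_
      exact mem_iUnion₂.2 ⟨T, Finset.mem_erase.2 ⟨hTS, hT⟩, hyT⟩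
  obtain ⟨u, -, hu, huB⟩ := exists_seq_tendsto_sSup hne (OrderTop.bddAbove _)
  choose π C h1 h2 h3 h4 h5 using huB
  refine ⟨π, C, h1, h2, h3, h4, ?_⟩
  simp_rw [h5, ← hsup]
  exact hu

/-- Lower semicontinuity of mass with respect to flat convergence. -/
theorem mass_le_liminf (P : ℕ → PolyhedralChain X G k) (P₀ : PolyhedralChain X G k)
    (hP : Tendsto (fun j => flatNorm (P j - P₀)) atTop (𝓝 0)) :
    mass P₀ ≤ liminf (fun j => mass (P j)) atTop := by
  obtain ⟨P₀', rfl⟩ := QuotientAddGroup.mk_surjective P₀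
  obtain ⟨Q, hQ, hQP⟩ := exists_isDisjointSum P₀'
  change Q.toChain = QuotientAddGroup.mk P₀' at hQP
  rw [← hQP] at hP ⊢
  have hmass : mass Q.toChain ≤ ∑ S ∈ Q.support, ‖Q S‖ₑ * projVolume k S.carrier := by
    refine (iInf₂_le Q ⟨hQ, rfl⟩).trans ?_
    simp only [Finsupp.sum, simpleMass_eq, le_refl]
  refine hmass.trans ?_
  have hseq : ∀ S : OrientedPolyhedron X k, ∃ (π : ℕ → Fin k → X →L[ℝ] ℝ)
      (C : ℕ → Set (Fin k → ℝ)), S ∈ Q.support → (∀ n i, ‖π n i‖ = 1) ∧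
      (∀ n, IsCompact (C n)) ∧ (∀ n, C n ⊆ proj (π n) '' S.carrier) ∧
      (∀ n, ∀ T ∈ Q.support, T ≠ S →
        Disjoint (C n) (proj (π n) '' (S.carrier ∩ T.carrier))) ∧
      Tendsto (fun n => volume (C n)) atTop (𝓝 (projVolume k S.carrier)) := by
    intro S
    by_cases hS : S ∈ Q.support
    · obtain ⟨π, C, h⟩ := exists_seq_compact hQ hS
      exact ⟨π, C, fun _ => h⟩
    · exact ⟨0, fun _ => ∅, fun h => absurd h hS⟩
  choose π C hπC using hseq
  have hlim : Tendsto (fun n => ∑ S ∈ Q.support, ‖Q S‖ₑ * volume (C S n)) atTop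
      (𝓝 (∑ S ∈ Q.support, ‖Q S‖ₑ * projVolume k S.carrier)) :=
    tendsto_finsetSum _ fun S hS =>
      ENNReal.Tendsto.const_mul (hπC S hS).2.2.2.2 (Or.inr enorm_ne_top)
  -- The compact sets are fixed before the limit in `j`, because `N` depends on them; only then do
  -- they exhaust the images.
  refine le_of_tendsto' hlim fun n => ?_
  obtain ⟨N, hN, hle⟩ := exists_le_mass_add_flatNorm (P₀ := Q) (π := fun S => π S n)
    (C := fun S => C S n) (fun S hS => (hπC S hS).1 n) (fun S hS => (hπC S hS).2.1 n)
    (fun S hS => (hπC S hS).2.2.1 n) (fun S hS => (hπC S hS).2.2.2.1 n)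
  refine le_liminf_of_le_add (fun j => hle (P j)) ?_
  simpa using ENNReal.Tendsto.const_mul hP (Or.inr hN)

end FlatChains

theorem mainTheorem2 {X G : Type*} [NormedAddCommGroup X] [NormedSpace ℝ X] [CompleteSpace X]
    [NormedAddCommGroup G] [CompleteSpace G] (k : ℕ)
    (P : ℕ → FlatChains.PolyhedralChain X G k) (P₀ : FlatChains.PolyhedralChain X G k)
    (hP : Tendsto (fun j => FlatChains.flatNorm (P j - P₀)) atTop (𝓝 0)) :
    FlatChains.mass P₀ ≤ liminf (fun j => FlatChains.mass (P j)) atTop :=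
  FlatChains.mass_le_liminf P P₀ hP
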